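/- Let $d,N\ge 1$. For $1\le k\le N$ let $\mathcal S_s(\mathbb R^{dk})$ be the space of complex Schwartz functions of $(x_1,\dots,x_k)\in(\mathbb R^d)^k$ invariant under permutations of the particles, and let $\mathcal S_s'(\mathbb R^{dk})$ be the space of permutation invariant tempered distributions with the strong dual topology; functions are viewed as distributions through $\varphi\mapsto\int f\varphi$. **Observables.** $\mathfrak g_k$ is the real vector space of continuous linear operators $A$ on $\mathcal S_s(\mathbb R^{dk})$ that are skew-adjoint, $\langle f,Ag\rangle_{L^2}=-\langle Af,g\rangle_{L^2}$, with Lie bracket $[A,B]_{\mathfrak g_k}=k(AB-BA)$. For $1\le k\le N$, the injective map $\varepsilon_{k,N}:\mathfrak g_k\to\mathfrak g_N$ is $$\varepsilon_{k,N}(A)=\frac{1}{N(N-1)\cdots(N-k+1)}\sum_{(j_1,\dots,j_k)}A_{(j_1,\dots,j_k)},$$ where the sum is over $k$-tuples of distinct elements of $\{1,\dots,N\}$ and $A_{(j_1,\dots,j_k)}$ is $A$ acting on the variables $x_{j_1},\dots,x_{j_k}$. Let $\mathfrak G_N=\bigoplus_{k=1}^N\mathfrak g_k$ with the bracket $$[A,B]_{\mathfrak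 G_N}^{(k)}=\sum_{\substack{1\le \ell,j\le N\\ \min(\ell+j-1,N)=k}}\varepsilon_{k,N}^{-1}\Big(\big[\varepsilon_{\ell,N}(A^{(\ell)}),\varepsilon_{j,N}(B^{(j)})\big]_{\mathfrak g_N}\Big),$$ and let $\iota_{\varepsilon,N}:\mathfrak G_N\to\mathfrak g_N$, $\iota_{\varepsilon,N}(A)=\sum_{k=1}^N\varepsilon_{k,N}(A^{(k)})$. **Density matrices.** $\mathfrak g_k^*$ is the real topological vector space of self-adjoint elements of $\mathcal L(\mathcal S_s'(\mathbb R^{dk}),\mathcal S_s(\mathbb R^{dk}))$, with the topology of bounded convergence (self-adjoint: $\langle f,\gamma g\rangle_{L^2}=\langle\gamma f,g\rangle_{L^2}$ for $f,g\in\mathcal S_s(\mathbb R^{dk})$), and $\mathfrak G_N^*=\prod_{k=1}^N\mathfrak g_k^*$. The trace of an operator in $\mathcal L(\mathcal S_s',\mathcal S_s)$ is the integral of its Schwartz kernel over the diagonal. The pairings are the real numbers $i\,\mathrm{Tr}(A\Psi)$ for $A\in\mathfrak g_N$, $\Psi\in\mathfrak g_N^*$, and $i\,\mathrm{Tr}(A\cdot\Gamma)=\sum_{k=1}^N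 i\,\mathrm{Tr}(A^{(k)}\gamma^{(k)})$ for $A\in\mathfrak G_N$, $\Gamma=(\gamma^{(k)})_{k\le N}\in\mathfrak G_N^*$. **Poisson structures.** A map between topological vector spaces is *smooth* if its iterated Gâteaux directional derivatives of all orders exist and are jointly continuous in the base point and the directions. Let $\mathcal A_{DM,N}$, respectively $\mathcal A_{H,N}$, be the unital algebra of functionals on $\mathfrak g_N^*$, respectively $\mathfrak G_N^*$, generated by the constants and the smooth functionals $i\,\mathrm{Tr}(A\,\cdot\,)$ with $A\in\mathfrak g_N$, respectively $A\in\mathfrak G_N$. For $F,G$ in this algebra set $\{F,G\}(m)=i\,\mathrm{Tr}\big([dF[m],dG[m]]\,m\big)$, with the bracket of $\mathfrak g_N$, respectively $\mathfrak G_N$, where the Gâteaux derivative $dF[m]$ is identified through the pairing with an element of $\mathfrak g_N$, respectively $\mathfrak G_N$. A *Poisson map* from $(M_1,\mathcal A_1,\{\cdot,\cdot\}_1)$ to $(M_2,\mathcal A_2,\{\cdot,\cdot\}_2)$ is a smooth map $\phi:M_1\to M_2$ with $F\circ\phi\in\mathcal A_1$ and $\{F,G\}_2\circ\phi=\{F\circ\phi,G\circ\phi\}_1$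 for all $F,G\in\mathcal A_2$. **Proposition.** There is a unique map $$\iota_{RDM,N}:\mathfrak g_N^*\to\mathfrak G_N^*,\qquad \Psi\mapsto\big(\mathrm{Tr}_{k+1,\dots,N}\Psi\big)_{1\le k\le N},$$ where the operator $\mathrm{Tr}_{k+1,\dots,N}\Psi$ has the kernel $\int\Psi(x,y;x',y)\,dy$ for $x,x'\in(\mathbb R^d)^k$, $y\in(\mathbb R^d)^{N-k}$. It is a Poisson map from $(\mathfrak g_N^*,\mathcal A_{DM,N},\{\cdot,\cdot\})$ to $(\mathfrak G_N^*,\mathcal A_{H,N},\{\cdot,\cdot\})$, and it is dual to $\iota_{\varepsilon,N}$: for all $A\in\mathfrak G_N$ and $\Psi\in\mathfrak g_N^*$, $$i\,\mathrm{Tr}\big(\iota_{\varepsilon,N}(A)\,\Psi\big)=i\,\mathrm{Tr}\big(A\cdot\iota_{RDM,N}(\Psi)\big).$$ -/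

import Mathlib

open SchwartzMap MeasureTheory Filter Topology

namespace BosonicRDM

noncomputable section

/-! ### Calculus on locally convex spaces -/

section Calculus

variable {X Y : Type*} [AddCommGroup X] [Module ℝ X] [TopologicalSpace X]
  [AddCommGroup Y] [Module ℝ Y] [TopologicalSpace Y]

/-- `y` is the Gâteaux derivative of `f` at `x` in the direction `v`. -/
def HasGateauxDerivAt (f : X → Y) (x v : X) (y : Y) : Prop :=
  Tendsto (fun t : ℝ => t⁻¹ • (f (x + t • v) - f x)) (𝓝[≠] (0 : ℝ)) (𝓝 y)

/-- `f` is smooth (`C^∞` in the sense of Gâteaux, as in Milnor and Hamilton): all iterated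
directional derivatives `D r x v = f⁽ʳ⁾(x; v₁, …, vᵣ)` exist and are jointly continuous in
`(x; v₁, …, vᵣ)`.  For `r = 0` this is the continuity of `f`. -/
def GateauxSmooth (f : X → Y) : Prop :=
  ∃ D : (r : ℕ) → X → (Fin r → X) → Y,
    (∀ x v, D 0 x v = f x) ∧
    (∀ r, Continuous fun p : X × (Fin r → X) => D r p.1 p.2) ∧
    ∀ (r : ℕ) (x : X) (v : Fin r → X) (w : X),
      HasGateauxDerivAt (fun y => D r y v) x w (D (r + 1) x (Fin.snoc v w))

end Calculus

/-! ### Poisson maps and Lie-Poisson structures -/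

/-- The data of a Poisson structure on `M`: an algebra of admissible functionals, and a bracket
(only its values on admissible functionals are used). -/
structure PoissonData (M : Type*) where
  functionals : Subalgebra ℝ (M → ℝ)
  bracket : (M → ℝ) → (M → ℝ) → (M → ℝ)

/-- Poisson maps: smooth maps that pull admissible functionals back to admissible functionals and
intertwine the brackets. -/
def IsPoissonMap {M₁ M₂ : Type*}
    [AddCommGroup M₁] [Module ℝ M₁] [TopologicalSpace M₁]
    [AddCommGroup M₂] [Module ℝ M₂] [TopologicalSpace M₂]
    (P₁ : PoissonData M₁) (P₂ : PoissonData M₂) (φ : M₁ → M₂) : Prop :=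
  GateauxSmooth φ ∧
  (∀ F ∈ P₂.functionals, F ∘ φ ∈ P₁.functionals) ∧
  ∀ F ∈ P₂.functionals, ∀ G ∈ P₂.functionals,
    P₂.bracket F G ∘ φ = P₁.bracket (F ∘ φ) (G ∘ φ)

section LiePoisson

variable {L M : Type*} [Zero L] [AddCommGroup M] [Module ℝ M] [TopologicalSpace M]

/-- `A : L` represents the Gâteaux derivative `dF[m]` through the pairing of `L` with `M`. -/
def IsFunctionalDeriv (pair : L → M → ℝ) (F : M → ℝ) (m : M) (A : L) : Prop :=
  ∀ v, HasGateauxDerivAt F m v (pair A v)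

open Classical in
/-- The element of `L` identified with `dF[m]`. For the pairings and the admissible functionals
used below there is exactly one such element (the value `0` is irrelevant). -/
def functionalDeriv (pair : L → M → ℝ) (F : M → ℝ) (m : M) : L :=
  if h : ∃ A, IsFunctionalDeriv pair F m A then h.choose else 0

/-- The Lie-Poisson structure on `M` defined by a pairing with `L` and a Lie bracket on `L`:
the admissible functionals form the unital algebra generated by the smooth functionals
`⟨A, ·⟩`, `A ∈ L` (and the constants), and `{F, G}(m) = ⟨[dF[m], dG[m]], m⟩`. -/
def liePoisson (pair : L → M → ℝ) (br : L → L → L) : PoissonData M where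
  functionals := Algebra.adjoin ℝ
    ({F | GateauxSmooth F ∧ ∃ A, ∀ m, F m = pair A m} ∪ {F | ∃ c : ℝ, ∀ m, F m = c})
  bracket F G := fun m => pair (br (functionalDeriv pair F m) (functionalDeriv pair G m)) m

end LiePoisson

/-! ### Bosonic test functions and distributions -/

/-- Configurations of `k` particles in `ℝᵈ`. -/
abbrev Conf (d k : ℕ) : Type := Fin k → EuclideanSpace ℝ (Fin d)

instance instTemperateConf (d k : ℕ) : (volume : Measure (Conf d k)).HasTemperateGrowth :=
  Measure.IsAddHaarMeasure.instHasTemperateGrowth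

/-- The map `(x₁, …, x_k) ↦ (x_{π(1)}, …, x_{π(k)})`. -/
def permConf (d : ℕ) {k : ℕ} (π : Equiv.Perm (Fin k)) : Conf d k ≃L[ℝ] Conf d k :=
  (LinearEquiv.funCongrLeft ℝ (EuclideanSpace ℝ (Fin d)) π).toContinuousLinearEquiv

@[simp] theorem permConf_apply (d : ℕ) {k : ℕ} (π : Equiv.Perm (Fin k)) (x : Conf d k) :
    permConf d π x = x ∘ π := rfl

/-- The action `(π f)(x) = f(x_{π(1)}, …, x_{π(k)})` on Schwartz functions. -/
def permSchwartz (d : ℕ) {k : ℕ} (π : Equiv.Perm (Fin k)) :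
    𝓢(Conf d k, ℂ) →L[ℂ] 𝓢(Conf d k, ℂ) :=
  SchwartzMap.compCLMOfContinuousLinearEquiv ℂ (permConf d π)

@[simp] theorem permSchwartz_apply (d : ℕ) {k : ℕ} (π : Equiv.Perm (Fin k))
    (f : 𝓢(Conf d k, ℂ)) (x : Conf d k) : permSchwartz d π f x = f (x ∘ π) := rfl

/-- The bosonic Schwartz space `𝓢_s(ℝ^{dk})`, with the subspace topology. -/
def SymSchwartz (d k : ℕ) : Submodule ℂ 𝓢(Conf d k, ℂ) where
  carrier := {f | ∀ (π : Equiv.Perm (Fin k)) (x : Conf d k), f (x ∘ π) = f x}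
  add_mem' hf hg π x := by simp [hf π x, hg π x]
  zero_mem' π x := by simp
  smul_mem' c f hf π x := by simp [hf π x]

/-- The bosonic tempered distributions `𝓢_s'(ℝ^{dk})`: the permutation invariant elements of the
strong dual of the Schwartz space, with the subspace topology. -/
def SymTempered (d k : ℕ) : Submodule ℂ (𝓢(Conf d k, ℂ) →L[ℂ] ℂ) where
  carrier := {u | ∀ (π : Equiv.Perm (Fin k)) (f : 𝓢(Conf d k, ℂ)), u (permSchwartz d π f) = u f}
  add_mem' hu hv π f := by simp [hu π f, hv π f]
  zero_mem' π f := by simp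
  smul_mem' c u hu π f := by simp [hu π f]

instance instContinuousConstSMulSymSchwartz (d k : ℕ) :
    ContinuousConstSMul ℝ (SymSchwartz d k) where
  continuous_const_smul r :=
    (continuous_const_smul (r : ℂ) : Continuous fun f : SymSchwartz d k => (r : ℂ) • f)

instance instIsTopologicalAddGroupSymSchwartz (d k : ℕ) :
    IsTopologicalAddGroup (SymSchwartz d k) :=
  inferInstanceAs (IsTopologicalAddGroup (SymSchwartz d k).toAddSubgroup)

instance instAddCommGroupSymTempered (d k : ℕ) : AddCommGroup (SymTempered d k) :=
  Submodule.addCommGroup _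

theorem measurePreserving_permConf (d : ℕ) {k : ℕ} (π : Equiv.Perm (Fin k)) :
    MeasurePreserving (fun x : Conf d k => x ∘ π) volume volume := by
  have h := (volume_measurePreserving_piCongrLeft
    (fun _ : Fin k => EuclideanSpace ℝ (Fin d)) π.symm)
  convert h using 1
  ext x i
  simp [MeasurableEquiv.piCongrLeft, Equiv.piCongrLeft, Equiv.piCongrLeft']

theorem integral_comp_perm (d : ℕ) {k : ℕ} (π : Equiv.Perm (Fin k)) (F : Conf d k → ℂ) :
    ∫ x, F (x ∘ π) = ∫ x, F x :=
  (measurePreserving_permConf d π).integral_comp'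
    (f := (permConf d π).toHomeomorph.toMeasurableEquiv) F

/-- The distribution `φ ↦ ∫ f φ` attached to a bosonic Schwartz function `f`; this is the
inclusion `𝓢_s ⊂ 𝓢_s'`. -/
def toTempered {d k : ℕ} (f : SymSchwartz d k) : SymTempered d k :=
  ⟨(SchwartzMap.integralCLM ℂ (volume : Measure (Conf d k))) ∘L
      (SchwartzMap.smulLeftCLM ℂ (fun x => f.1 x)), by
    intro π φ
    simp only [ContinuousLinearMap.comp_apply, SchwartzMap.integralCLM_apply,
      SchwartzMap.smulLeftCLM_apply_apply f.1.hasTemperateGrowth, permSchwartz_apply]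
    rw [← integral_comp_perm d π (fun x => f.1 x • φ x)]
    simp only [f.2 π]⟩

theorem toTempered_apply {d k : ℕ} (f : SymSchwartz d k) (φ : 𝓢(Conf d k, ℂ)) :
    (toTempered f).1 φ = ∫ x, f.1 x * φ x := by
  simp [toTempered, SchwartzMap.integralCLM_apply,
    SchwartzMap.smulLeftCLM_apply_apply f.1.hasTemperateGrowth]

/-- Evaluation at a point, as a continuous linear functional on the Schwartz space. -/
def evalAt {d k : ℕ} (x : Conf d k) : 𝓢(Conf d k, ℂ) →L[ℂ] ℂ :=
  (BoundedContinuousFunction.evalCLM ℂ x).comp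
    (SchwartzMap.toBoundedContinuousFunctionCLM ℂ (Conf d k) ℂ)

@[simp] theorem evalAt_apply {d k : ℕ} (x : Conf d k) (f : 𝓢(Conf d k, ℂ)) :
    evalAt x f = f x := rfl

/-- The symmetrized Dirac mass `(1/k!) ∑_π δ_{(x_{π(1)}, …, x_{π(k)})}`. -/
def symDelta {d k : ℕ} (x : Conf d k) : SymTempered d k :=
  ⟨(k.factorial : ℂ)⁻¹ • ∑ π : Equiv.Perm (Fin k), evalAt (x ∘ π), by
    intro σ f
    have h : ∑ π : Equiv.Perm (Fin k), f ((x ∘ π) ∘ σ) = ∑ π : Equiv.Perm (Fin k), f (x ∘ π) :=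
      Fintype.sum_equiv (Equiv.mulRight σ) _ _ (fun π => rfl)
    simp [h]⟩

/-- The `L²` inner product, linear in the second entry. -/
def ip {d k : ℕ} (f g : SymSchwartz d k) : ℂ :=
  ∫ x, (starRingEnd ℂ) (f.1 x) * g.1 x

/-! ### Observables and density matrices -/

theorem ip_integrable {d k : ℕ} (f g : SymSchwartz d k) :
    Integrable (fun x => (starRingEnd ℂ) (f.1 x) * g.1 x) := by
  obtain ⟨C, hC⟩ : ∃ C, ∀ x, ‖f.1 x‖ ≤ C :=
    ⟨_, fun x => f.1.norm_le_seminorm ℂ x⟩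
  refine (g.1.integrable (μ := volume)).bdd_mul (c := C) ?_ (Eventually.of_forall fun x => ?_)
  · exact (Complex.continuous_conj.comp f.1.continuous).aestronglyMeasurable
  · simpa using hC x

theorem ip_add_right {d k : ℕ} (f g h : SymSchwartz d k) : ip f (g + h) = ip f g + ip f h := by
  simp only [ip, ← integral_add (ip_integrable f g) (ip_integrable f h)]
  congr 1; ext x; simp [mul_add]

theorem ip_smul_right {d k : ℕ} (r : ℝ) (f g : SymSchwartz d k) : ip f (r • g) = r * ip f g := by
  simp only [ip, ← integral_const_mul]
  congr 1; ext x; simp; ring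

theorem ip_conj {d k : ℕ} (f g : SymSchwartz d k) : (starRingEnd ℂ) (ip f g) = ip g f := by
  simp only [ip, ← integral_conj]
  congr 1; ext x; simp [mul_comm]

theorem ip_add_left {d k : ℕ} (f g h : SymSchwartz d k) : ip (f + g) h = ip f h + ip g h := by
  rw [← ip_conj, ip_add_right, map_add, ip_conj, ip_conj]

theorem ip_smul_left {d k : ℕ} (r : ℝ) (f g : SymSchwartz d k) : ip (r • f) g = r * ip f g := by
  rw [← ip_conj, ip_smul_right, map_mul, ip_conj, Complex.conj_ofReal]

/-- The real vector space `𝔤_k` of `k`-body bosonic observables: the skew-adjoint continuous linear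
operators on the bosonic Schwartz space. (No topology on it is used.) -/
def Obs (d k : ℕ) : Submodule ℝ (SymSchwartz d k →L[ℂ] SymSchwartz d k) where
  carrier := {A | ∀ f g, ip f (A g) = -ip (A f) g}
  add_mem' {A B} hA hB f g := by
    have h1 := hA f g
    have h2 := hB f g
    simp only [add_apply, ip_add_left, ip_add_right, h1, h2]
    ring
  zero_mem' f g := by simp [ip]
  smul_mem' r A hA f g := by
    have h1 := hA f g
    simp only [smul_apply, ip_smul_left, ip_smul_right, h1]
    ring

/-- The real topological vector space `𝔤_k^*` of `k`-body density matrices: the self-adjoint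
elements of `𝓛(𝓢_s', 𝓢_s)`, with the subspace topology of the topology of bounded convergence. -/
def DM (d k : ℕ) : Submodule ℝ (SymTempered d k →L[ℂ] SymSchwartz d k) where
  carrier := {γ | ∀ f g, ip f (γ (toTempered g)) = ip (γ (toTempered f)) g}
  add_mem' {A B} hA hB f g := by
    have h1 := hA f g
    have h2 := hB f g
    simp only [add_apply, ip_add_left, ip_add_right, h1, h2]
  zero_mem' f g := by simp [ip]
  smul_mem' r A hA f g := by
    have h1 := hA f g
    simp only [smul_apply, ip_smul_left, ip_smul_right, h1]

/-- The Lie bracket `[A, B]_{𝔤_k} = k (AB - BA)`. -/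
def obsBracket {d k : ℕ} (A B : Obs d k) : Obs d k :=
  ⟨(k : ℝ) • (A.1 ∘L B.1 - B.1 ∘L A.1), by
    refine Submodule.smul_mem _ _ fun f g => ?_
    have hs : ∀ a b c : SymSchwartz d k, ip a (b - c) = ip a b - ip a c := fun a b c => by
      have := ip_add_right a (b - c) c
      rw [sub_add_cancel] at this
      rw [this, add_sub_cancel_right]
    have hs' : ∀ a b c : SymSchwartz d k, ip (a - b) c = ip a c - ip b c := fun a b c => by
      have := ip_add_left (a - b) b c
      rw [sub_add_cancel] at this
      rw [this, add_sub_cancel_right]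
    have hA := fun f g => A.2 f g
    have hB := fun f g => B.2 f g
    simp only [sub_apply, ContinuousLinearMap.comp_apply, hs, hs']
    rw [hA, hB, hB, hA]
    ring⟩

/-- The Schwartz kernel `γ(x; x')` of `γ ∈ 𝓛(𝓢_s', 𝓢_s)`. -/
def kernel {d k : ℕ} (γ : SymTempered d k →L[ℂ] SymSchwartz d k) (x x' : Conf d k) : ℂ :=
  (γ (symDelta x')).1 x

/-- The operator `γ` has the integral kernel `K`: each `K(x; ·)` is a Schwartz function, and
`(γ u)(x) = ⟨u, K(x; ·)⟩` for every bosonic tempered distribution `u`. -/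
def HasKernel {d k : ℕ} (γ : SymTempered d k →L[ℂ] SymSchwartz d k)
    (K : Conf d k → Conf d k → ℂ) : Prop :=
  ∀ x, ∃ κ : 𝓢(Conf d k, ℂ), (∀ x', κ x' = K x x') ∧
    ∀ u : SymTempered d k, (γ u).1 x = u.1 κ

/-- The trace of an operator in `𝓛(𝓢_s', 𝓢_s)`: the integral of its Schwartz kernel over the
diagonal. -/
def trace {d k : ℕ} (T : SymTempered d k →L[ℂ] SymSchwartz d k) : ℂ :=
  ∫ x, kernel T x x

/-- The pairing `⟨A, Ψ⟩ = i Tr(A Ψ)` of `𝔤_k` with `𝔤_k^*`. (This number is real, as `A` is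
skew-adjoint and `Ψ` is self-adjoint.) -/
def obsPairing {d k : ℕ} (A : Obs d k) (Ψ : DM d k) : ℝ :=
  (Complex.I * trace (A.1 ∘L Ψ.1)).re

/-- The Lie-Poisson structure of the `N`-body density matrices `𝔤_N^*`. -/
def dmPoisson (d N : ℕ) : PoissonData (DM d N) :=
  liePoisson obsPairing obsBracket

/-! ### Hierarchies -/

/-- The configuration `x` with the particles `j(1), …, j(k)` moved to `z₁, …, z_k`. -/
def moveTo {d k N : ℕ} (j : Fin k ↪ Fin N) (x : Conf d N) (z : Conf d k) : Conf d N :=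
  Function.extend j z x

theorem moveTo_self {d k N : ℕ} (j : Fin k ↪ Fin N) (x : Conf d N) (z : Conf d k) (a : Fin k) :
    moveTo j x z (j a) = z a := j.injective.extend_apply _ _ _

theorem moveTo_of_not {d k N : ℕ} (j : Fin k ↪ Fin N) (x : Conf d N) (z : Conf d k) (i : Fin N)
    (h : ¬ ∃ a, j a = i) : moveTo j x z i = x i := Function.extend_apply' _ _ _ h

theorem moveTo_hasTemperateGrowth {d k N : ℕ} (j : Fin k ↪ Fin N) (x : Conf d N) :
    (moveTo j x).HasTemperateGrowth := by
  classical
  let L : Conf d k →L[ℝ] Conf d N := ContinuousLinearMap.pi fun i =>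
    if h : ∃ a, j a = i then ContinuousLinearMap.proj h.choose else 0
  have : moveTo j x = (fun z => L z) + fun _ => moveTo j x 0 := by
    funext z i
    by_cases h : ∃ a, j a = i
    · have h' := h
      obtain ⟨a, rfl⟩ := h'
      have hc : h.choose = a := j.injective h.choose_spec
      simp only [Pi.add_apply, moveTo_self, L, ContinuousLinearMap.coe_pi', dif_pos h, hc]
      simp
    · simp [moveTo_of_not j x _ i h, L, dif_neg h]
  rw [this]
  exact (ContinuousLinearMap.hasTemperateGrowth L).add (Function.HasTemperateGrowth.const _)

theorem moveTo_antilipschitz {d k N : ℕ} (j : Fin k ↪ Fin N) (x : Conf d N) :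
    AntilipschitzWith 1 (moveTo j x) := by
  refine AntilipschitzWith.of_le_mul_dist fun z w => ?_
  rw [NNReal.coe_one, one_mul]
  refine (dist_pi_le_iff dist_nonneg).2 fun a => ?_
  have := dist_le_pi_dist (moveTo j x z) (moveTo j x w) (j a)
  rwa [moveTo_self, moveTo_self] at this

/-- The restriction `z ↦ f(x with the particles j(1), …, j(k) moved to z)` of a bosonic Schwartz
function of `N` particles, a bosonic Schwartz function of `k` particles. -/
def slice {d k N : ℕ} (j : Fin k ↪ Fin N) (x : Conf d N) (f : SymSchwartz d N) :
    SymSchwartz d k :=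
  ⟨SchwartzMap.compCLMOfAntilipschitz ℂ (moveTo_hasTemperateGrowth j x)
      (moveTo_antilipschitz j x) f.1, by
    intro π z
    have key : moveTo j x (z ∘ π) = moveTo j x z ∘ (π.viaFintypeEmbedding j) := by
      funext i
      by_cases h : ∃ a, j a = i
      · obtain ⟨a, rfl⟩ := h
        rw [Function.comp_apply, Equiv.Perm.viaFintypeEmbedding_apply_image, moveTo_self,
          moveTo_self, Function.comp_apply]
      · rw [Function.comp_apply, Equiv.Perm.viaFintypeEmbedding_apply_notMem_range _ _ h,
          moveTo_of_not j x _ i h, moveTo_of_not j x _ i h]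
    change f.1 (moveTo j x (z ∘ π)) = f.1 (moveTo j x z)
    rw [key, f.2]⟩

@[simp] theorem slice_apply {d k N : ℕ} (j : Fin k ↪ Fin N) (x : Conf d N) (f : SymSchwartz d N)
    (z : Conf d k) : (slice j x f).1 z = f.1 (moveTo j x z) := rfl

/-- `T = C_{k,N} ∑_{(j₁, …, j_k)} A_{(j₁, …, j_k)}` on `𝓢_s(ℝ^{dN})`, where `(j₁, …, j_k)` runs over
the tuples of distinct elements of `{1, …, N}`, the operator `A_{(j₁, …, j_k)}` is `A` acting on the
variables `x_{j₁}, …, x_{j_k}` only, and `C_{k,N} = 1/(N (N-1) ⋯ (N-k+1))`. -/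
def IsEmbedded {d k N : ℕ} (A : Obs d k) (T : Obs d N) : Prop :=
  ∀ (f : SymSchwartz d N) (x : Conf d N),
    (T.1 f).1 x = ((N.descFactorial k : ℕ) : ℂ)⁻¹ *
      ∑ j : Fin k ↪ Fin N, (A.1 (slice j x f)).1 (fun a => x (j a))

open Classical in
/-- The embedding `ε_{k,N} : 𝔤_k → 𝔤_N` for `1 ≤ k ≤ N`: the operator `ε_{k,N}(A)` is the unique
`T ∈ 𝔤_N` with `IsEmbedded A T` (the value `0` is irrelevant). -/
def embed {d k : ℕ} (N : ℕ) (A : Obs d k) : Obs d N :=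
  if h : ∃ T, IsEmbedded A T then h.choose else 0

/-- The space `𝔊_N = ⨁_{k=1}^N 𝔤_k` of observable `N`-hierarchies; the component with index
`k : Fin N` belongs to `k + 1` particles. -/
abbrev ObsHier (d N : ℕ) : Type := (k : Fin N) → Obs d (k.val + 1)

/-- The space `𝔊_N^*` of density matrix `N`-hierarchies, with the product topology; the component
with index `k : Fin N` belongs to `k + 1` particles. -/
abbrev DMHier (d N : ℕ) : Type := (k : Fin N) → DM d (k.val + 1)

/-- The Lie bracket of `𝔊_N`: with `ℓ = p.1 + 1` and `j = p.2 + 1`, the `k`-particle component is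
`∑_{min(ℓ + j - 1, N) = k} ε_{k,N}⁻¹ [ε_{ℓ,N}(A^{(ℓ)}), ε_{j,N}(B^{(j)})]_{𝔤_N}`. -/
def hierBracket {d N : ℕ} (A B : ObsHier d N) : ObsHier d N := fun k =>
  ∑ p : Fin N × Fin N with min ((p.1.val + 1) + (p.2.val + 1) - 1) N = k.val + 1,
    Function.invFun (embed (d := d) (k := k.val + 1) N)
      (obsBracket (embed N (A p.1)) (embed N (B p.2)))

/-- The pairing `i Tr(A · Γ) = ∑_k i Tr_{1,…,k}(A^{(k)} γ^{(k)})` of `𝔊_N` with `𝔊_N^*`. -/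
def hierPairing {d N : ℕ} (A : ObsHier d N) (Γ : DMHier d N) : ℝ :=
  ∑ k, obsPairing (A k) (Γ k)

/-- The Lie-Poisson structure of the density matrix `N`-hierarchies `𝔊_N^*`. -/
def hierPoisson (d N : ℕ) : PoissonData (DMHier d N) :=
  liePoisson hierPairing hierBracket

/-- The map `ι_{ε,N} : 𝔊_N → 𝔤_N`, `A ↦ ∑_k ε_{k,N}(A^{(k)})`. -/
def sumEmbed {d N : ℕ} (A : ObsHier d N) : Obs d N := ∑ k, embed N (A k)

/-! ### Reduced density matrices -/

/-- The configuration `(x₁, …, x_k, y₁, …, y_{N-k})`. -/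
def glue {d k N : ℕ} (x : Conf d k) (y : Conf d (N - k)) : Conf d N := fun i =>
  if h : i.val < k then x ⟨i.val, h⟩ else y ⟨i.val - k, by omega⟩

/-- The kernel `∫ Ψ(x, y; x', y) dy` of the partial trace `Tr_{k+1,…,N} Ψ`. -/
def partialTraceKernel {d N : ℕ} (k : ℕ) (Ψ : SymTempered d N →L[ℂ] SymSchwartz d N)
    (x x' : Conf d k) : ℂ :=
  ∫ y : Conf d (N - k), kernel Ψ (glue x y) (glue x' y)

/-- `ι` is the reduced density matrix map `Ψ ↦ (Tr_{k+1,…,N} Ψ)_{1 ≤ k ≤ N}`. -/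
def IsRDMMap {d N : ℕ} (ι : DM d N → DMHier d N) : Prop :=
  ∀ (Ψ : DM d N) (k : Fin N), HasKernel (ι Ψ k).1 (partialTraceKernel (k.val + 1) Ψ.1)

end

end BosonicRDM

open BosonicRDM

/-!
An element of `𝓛(𝓢_s', 𝓢_s)` has a Schwartz kernel and depends continuously on it, so the partial
traces, which integrate the kernel over part of the diagonal, form a continuous linear map
`ι_{RDM,N}`. The operator `A_{(j₁, …, j_k)}` is `A` amplified by the identity; by the symmetry of
`Ψ` all `Tr(A_{(j₁, …, j_k)} Ψ)` agree, and for `(1, …, k)` Fubini gives `Tr(A Tr_{k+1,…,N} Ψ)`.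
This is the duality of `ι_{RDM,N}` and `ι_{ε,N}`.

A map dual to a linear map `ε` of Lie algebras pulls the functional `i Tr(A ·)` back to
`i Tr(ε(A) ·)`, hence is a Poisson map as soon as `ε` preserves brackets; derivatives are unique
because `A` is determined by its pairings with the density matrices of rank one. For `ι_{ε,N}` this
leaves `[ε_{ℓ,N}(A), ε_{j,N}(B)] ∈ ε_{k,N}(𝔤_k)` with `k = min (ℓ + j - 1) N`: operators acting on
disjoint sets of particles commute, so only overlapping pairs contribute to the commutator, and an
overlapping pair involves at most `k` particles. They commute since they visibly do on products of
functions of one particle, and the range of their commutator, which is skew-adjoint, is therefore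
orthogonal to all such products.
-/

namespace BosonicRDM

noncomputable section

/-! ### Differentiability from line derivatives along a basis -/

section LineDerivatives

variable {E V ι : Type*} [NormedAddCommGroup V] [NormedSpace ℝ V]

section Line

variable [AddCommGroup E] [Module ℝ E] {f f' f'' : E → V} {v : E}

theorem hasDerivAt_comp_line (h : ∀ x, HasLineDerivAt ℝ f (f' x) x v) (x : E) (s : ℝ) :
    HasDerivAt (fun t : ℝ => f (x + t • v)) (f' (x + s • v)) s := by
  have hs : HasDerivAt (fun t : ℝ => f (x + s • v + t • v)) (f' (x + s • v)) (s - s) := by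
    rw [sub_self]
    exact h (x + s • v)
  convert hs.comp_sub_const s s using 3 with t
  rw [sub_smul]
  abel

theorem norm_image_add_smul_sub_le (h : ∀ x, HasLineDerivAt ℝ f (f' x) x v) {x : E} {t : ℝ}
    {m : V} {C : ℝ} (hC : ∀ s : ℝ, |s| ≤ |t| → ‖f' (x + s • v) - m‖ ≤ C) :
    ‖f (x + t • v) - f x - t • m‖ ≤ C * |t| := by
  have hderiv : ∀ s, HasDerivAt (fun s : ℝ => f (x + s • v) - s • m) (f' (x + s • v) - m) s :=
    fun s => by
      simpa [Pi.sub_def] using (hasDerivAt_comp_line h x s).sub ((hasDerivAt_id s).smul_const m)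
  have hmvt := (convex_uIcc (0 : ℝ) t).norm_image_sub_le_of_norm_hasDerivWithin_le
    (fun s _ => (hderiv s).hasDerivWithinAt)
    (fun s hs => hC s (by simpa using Set.abs_sub_left_of_mem_uIcc hs))
    Set.left_mem_uIcc Set.right_mem_uIcc
  simpa [sub_right_comm] using hmvt

theorem norm_image_add_smul_sub_sub_smul_le (h : ∀ x, HasLineDerivAt ℝ f (f' x) x v)
    (h' : ∀ x, HasLineDerivAt ℝ f' (f'' x) x v) {x : E} {t C : ℝ}
    (hC : ∀ s : ℝ, |s| ≤ |t| → ‖f'' (x + s • v)‖ ≤ C) :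
    ‖f (x + t • v) - f x - t • f' x‖ ≤ C * |t| ^ 2 := by
  have hC0 : 0 ≤ C := (norm_nonneg _).trans (hC 0 (by simp))
  rw [pow_two, ← mul_assoc]
  refine norm_image_add_smul_sub_le h fun s hs => ?_
  have hs' : ‖f' (x + s • v) - f' x‖ ≤ C * |s| := by
    simpa using norm_image_add_smul_sub_le h' (m := 0)
      fun r hr => by simpa using hC r (hr.trans hs)
  exact hs'.trans (by gcongr)

end Line

variable [NormedAddCommGroup E] [NormedSpace ℝ E]

theorem norm_image_add_sum_sub_le {b : ι → E} {f : E → V} {f' : ι → E → V}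
    (h : ∀ i x, HasLineDerivAt ℝ f (f' i x) x (b i)) {x : E} {c : ι → ℝ} {m : ι → V} {C : ℝ}
    (s : Finset ι)
    (hC : ∀ i ∈ s, ∀ y ∈ Metric.closedBall x (∑ i ∈ s, ‖c i • b i‖), ‖f' i y - m i‖ ≤ C) :
    ‖f (x + ∑ i ∈ s, c i • b i) - f x - ∑ i ∈ s, c i • m i‖ ≤ C * ∑ i ∈ s, |c i| := by
  classical
  induction s using Finset.induction_on with
  | empty => simp
  | insert j s hj ih =>
    simp only [Finset.sum_insert hj] at hC ⊢
    set z := x + ∑ i ∈ s, c i • b i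
    have hz : z ∈ Metric.closedBall x (∑ i ∈ s, ‖c i • b i‖) := by
      simpa [z] using norm_sum_le s fun i => c i • b i
    have hlast : ‖f (z + c j • b j) - f z - c j • m j‖ ≤ C * |c j| := by
      refine norm_image_add_smul_sub_le (h j) fun r hr => hC j (Finset.mem_insert_self j s) _ ?_
      rw [mem_closedBall_iff_norm, add_sub_right_comm, add_comm]
      refine norm_add_le_of_le ?_ (mem_closedBall_iff_norm.1 hz)
      simpa only [norm_smul, Real.norm_eq_abs] using
        mul_le_mul_of_nonneg_right hr (norm_nonneg (b j))
    have hrest := ih fun i hi y hy => hC i (Finset.mem_insert_of_mem hi) y <|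
      Metric.closedBall_subset_closedBall (le_add_of_nonneg_left (norm_nonneg _)) hy
    have hsplit : f (x + (c j • b j + ∑ i ∈ s, c i • b i)) - f x -
          (c j • m j + ∑ i ∈ s, c i • m i) =
        (f (z + c j • b j) - f z - c j • m j) + (f z - f x - ∑ i ∈ s, c i • m i) := by
      rw [add_comm (c j • b j), ← add_assoc]
      abel
    rw [hsplit, mul_add]
    exact norm_add_le_of_le hlast hrest

/-- The `i`-th coordinate with respect to `b`, as a continuous linear functional. -/
def coordCLM [Finite ι] (b : Module.Basis ι ℝ E) (i : ι) : E →L[ℝ] ℝ :=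
  ContinuousLinearMap.proj i ∘L b.equivFunL.toContinuousLinearMap

section Coordinates

variable [Fintype ι]

theorem sum_coordCLM_smul (b : Module.Basis ι ℝ E) (x : E) : ∑ i, coordCLM b i x • b i = x :=
  b.sum_equivFun x

theorem sum_abs_coordCLM_le (b : Module.Basis ι ℝ E) (x : E) :
    ∑ i, |coordCLM b i x| ≤ (∑ i, ‖coordCLM b i‖) * ‖x‖ := by
  rw [Finset.sum_mul]
  exact Finset.sum_le_sum fun i _ => (coordCLM b i).le_opNorm x

theorem norm_sub_sub_sum_coordCLM_le {b : Module.Basis ι ℝ E} {f : E → V} {f' : ι → E → V}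
    (h : ∀ i x, HasLineDerivAt ℝ f (f' i x) x (b i)) {x y : E} {m : ι → V} {C : ℝ} (hC0 : 0 ≤ C)
    (hC : ∀ i, ∀ z ∈ Metric.closedBall x (∑ i, ‖coordCLM b i (y - x) • b i‖),
      ‖f' i z - m i‖ ≤ C) :
    ‖f y - f x - ∑ i, coordCLM b i (y - x) • m i‖ ≤ C * (∑ i, ‖coordCLM b i‖) * ‖y - x‖ := by
  have hsum := norm_image_add_sum_sub_le h (c := fun i => coordCLM b i (y - x)) Finset.univ
    fun i _ => hC i
  rw [sum_coordCLM_smul, add_sub_cancel] at hsum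
  refine hsum.trans ?_
  rw [mul_assoc]
  gcongr
  exact sum_abs_coordCLM_le b (y - x)

theorem hasFDerivAt_of_hasLineDerivAt_basis {b : Module.Basis ι ℝ E} {f : E → V}
    {f' : ι → E → V} (h : ∀ i x, HasLineDerivAt ℝ f (f' i x) x (b i)) {x : E}
    (hc : ∀ i, ContinuousAt (f' i) x) :
    HasFDerivAt f (∑ i, (coordCLM b i).smulRight (f' i x)) x := by
  refine .of_isLittleO (Asymptotics.isLittleO_iff.2 fun ε hε => ?_)
  set M := ∑ i, ‖coordCLM b i‖
  have : 0 ≤ M := Finset.sum_nonneg fun i _ => norm_nonneg _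
  obtain ⟨r, hr, hball⟩ : ∃ r > 0, ∀ z ∈ Metric.closedBall x r, ∀ i,
      ‖f' i z - f' i x‖ ≤ ε / (M + 1) :=
    Metric.nhds_basis_closedBall.eventually_iff.1 <| eventually_all.2 fun i =>
      (hc i).eventually (Metric.closedBall_mem_nhds _ (by positivity)) |>.mono
        fun z hz => mem_closedBall_iff_norm.1 hz
  have hsmall : ∀ᶠ y in 𝓝 x, ∑ i, ‖coordCLM b i (y - x) • b i‖ ≤ r := by
    have hcont : Continuous fun y => ∑ i, ‖coordCLM b i (y - x) • b i‖ := by fun_prop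
    exact (hcont.tendsto' x 0 (by simp)).eventually (ge_mem_nhds hr)
  filter_upwards [hsmall] with y hy
  simp only [sum_apply, ContinuousLinearMap.smulRight_apply]
  calc _ ≤ ε / (M + 1) * M * ‖y - x‖ :=
        norm_sub_sub_sum_coordCLM_le h (by positivity)
          fun i z hz => hball z (Metric.closedBall_subset_closedBall hy hz) i
    _ ≤ ε * ‖y - x‖ := by
        gcongr
        rw [div_mul_eq_mul_div, div_le_iff₀ (by positivity)]
        nlinarith

end Coordinates

theorem continuous_of_hasLineDerivAt_basis [Finite ι] {b : Module.Basis ι ℝ E} {f : E → V}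
    {f' : ι → E → V} (h : ∀ i x, HasLineDerivAt ℝ f (f' i x) x (b i)) {C : ℝ}
    (hC : ∀ i x, ‖f' i x‖ ≤ C) : Continuous f := by
  cases nonempty_fintype ι
  refine (LipschitzWith.of_dist_le_mul
    (K := Real.toNNReal (|C| * ∑ i, ‖coordCLM b i‖)) fun y x => ?_).continuous
  rw [dist_eq_norm, dist_eq_norm, Real.coe_toNNReal _ (by positivity)]
  simpa using norm_sub_sub_sum_coordCLM_le h (m := 0) (abs_nonneg C)
    fun i z _ => by simpa using (hC i z).trans (le_abs_self C)

end LineDerivatives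

/-! ### Schwartz functions from families closed under line derivatives -/

section Families

variable {E V ι X : Type*} [NormedAddCommGroup E] [NormedSpace ℝ E]
  [NormedAddCommGroup V] [NormedSpace ℝ V]

theorem norm_iteratedFDeriv_smulRight_le (g : E →L[ℝ] ℝ) {n : ℕ} {f : E → V}
    (hf : ContDiff ℝ n f) (x : E) :
    ‖iteratedFDeriv ℝ n (fun x => g.smulRight (f x)) x‖ ≤ ‖g‖ * ‖iteratedFDeriv ℝ n f x‖ := by
  have hnorm : ‖ContinuousLinearMap.smulRightL ℝ E V g‖ ≤ ‖g‖ :=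
    ContinuousLinearMap.opNorm_le_bound _ (norm_nonneg _) fun z => by
      simp [ContinuousLinearMap.norm_smulRight_apply]
  exact ((ContinuousLinearMap.smulRightL ℝ E V g).norm_iteratedFDeriv_comp_left
    hf.contDiffAt le_rfl).trans (by gcongr)

/-- A set of parametrized functions that is closed under the line derivatives along a basis and
whose members decay faster than every power of the norm. Every member is then a Schwartz function
for each value of the parameter, and decay estimates on the members control all Schwartz
seminorms. -/
structure IsSchwartzFamily (b : Module.Basis ι ℝ E) (P : Set (X → E → V)) : Prop where
  hasLineDerivAt : ∀ G ∈ P, ∀ i, ∃ G' ∈ P, ∀ p x, HasLineDerivAt ℝ (G p) (G' p x) x (b i)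
  decay : ∀ G ∈ P, ∀ p, ∀ k : ℕ, ∃ C, ∀ x, ‖x‖ ^ k * ‖G p x‖ ≤ C

namespace IsSchwartzFamily

variable {b : Module.Basis ι ℝ E} {P : Set (X → E → V)}

variable [Finite ι]

theorem continuous (hP : IsSchwartzFamily b P) {G : X → E → V} (hG : G ∈ P) (p : X) :
    Continuous (G p) := by
  choose G' hG' hd using hP.hasLineDerivAt G hG
  choose C hC using fun i => hP.decay (G' i) (hG' i) p 0
  obtain ⟨M, hM⟩ := (Set.finite_range C).bddAbove
  exact continuous_of_hasLineDerivAt_basis (fun i => hd i p) fun i x => by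
    simpa using (hC i x).trans (hM (Set.mem_range_self i))

theorem hasFDerivAt [Fintype ι] (hP : IsSchwartzFamily b P) {G : X → E → V} {G' : ι → X → E → V}
    (hG' : ∀ i, G' i ∈ P) (hd : ∀ i p x, HasLineDerivAt ℝ (G p) (G' i p x) x (b i)) (p : X)
    (x : E) : HasFDerivAt (G p) (∑ i, (coordCLM b i).smulRight (G' i p x)) x :=
  hasFDerivAt_of_hasLineDerivAt_basis (fun i => hd i p)
    fun i => (hP.continuous (hG' i) p).continuousAt

theorem contDiff (hP : IsSchwartzFamily b P) (n : ℕ) {G : X → E → V} (hG : G ∈ P) (p : X) :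
    ContDiff ℝ n (G p) := by
  induction n generalizing G with
  | zero => exact contDiff_zero.2 (hP.continuous hG p)
  | succ n ih =>
    cases nonempty_fintype ι
    choose G' hG' hd using hP.hasLineDerivAt G hG
    refine (contDiff_succ_iff_hasFDerivAt (n := n)).2
      ⟨_, ContDiff.sum fun i _ => ?_, hP.hasFDerivAt hG' hd p⟩
    exact (ContinuousLinearMap.smulRightL ℝ E V (coordCLM b i)).contDiff.comp (ih (hG' i))

theorem exists_norm_iteratedFDeriv_le (hP : IsSchwartzFamily b P) (n : ℕ) {G : X → E → V}
    (hG : G ∈ P) : ∃ s : Finset (X → E → V), ↑s ⊆ P ∧ ∃ c, 0 ≤ c ∧ ∀ p x,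
      ‖iteratedFDeriv ℝ n (G p) x‖ ≤ c * ∑ H ∈ s, ‖H p x‖ := by
  classical
  induction n generalizing G with
  | zero => exact ⟨{G}, by simpa using hG, 1, zero_le_one, fun p x => by simp⟩
  | succ n ih =>
    cases nonempty_fintype ι
    choose G' hG' hd using hP.hasLineDerivAt G hG
    choose s hs c hc hle using fun i => ih (hG' i)
    refine ⟨Finset.univ.biUnion s, by simpa using hs, ∑ i, ‖coordCLM b i‖ * c i,
      Finset.sum_nonneg fun i _ => mul_nonneg (norm_nonneg _) (hc i), fun p x => ?_⟩
    have hfderiv : fderiv ℝ (G p) = fun x => ∑ i, (coordCLM b i).smulRight (G' i p x) :=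
      funext fun x => (hP.hasFDerivAt hG' hd p x).fderiv
    have hcd : ∀ i, ContDiff ℝ n (fun x => (coordCLM b i).smulRight (G' i p x)) := fun i =>
      (ContinuousLinearMap.smulRightL ℝ E V (coordCLM b i)).contDiff.comp
        (hP.contDiff n (hG' i) p)
    rw [← norm_iteratedFDeriv_fderiv, hfderiv, Finset.sum_mul,
      iteratedFDeriv_fun_sum_apply fun i _ => (hcd i).contDiffAt]
    refine norm_sum_le_of_le _ fun i _ => ?_
    calc _ ≤ ‖coordCLM b i‖ * ‖iteratedFDeriv ℝ n (G' i p) x‖ :=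
          norm_iteratedFDeriv_smulRight_le _ (hP.contDiff n (hG' i) p) x
      _ ≤ ‖coordCLM b i‖ * (c i * ∑ H ∈ s i, ‖H p x‖) := by gcongr; exact hle i p x
      _ ≤ ‖coordCLM b i‖ * (c i * ∑ H ∈ Finset.univ.biUnion s, ‖H p x‖) := by
          have := hc i
          gcongr
          exact Finset.subset_biUnion_of_mem s (Finset.mem_univ i)
      _ = _ := by ring

theorem exists_norm_pow_mul_iteratedFDeriv_le (hP : IsSchwartzFamily b P) {G : X → E → V}
    (hG : G ∈ P) (k n : ℕ) : ∃ s : Finset (X → E → V), ↑s ⊆ P ∧ ∃ c, 0 ≤ c ∧ ∀ p x,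
      ‖x‖ ^ k * ‖iteratedFDeriv ℝ n (G p) x‖ ≤ c * ∑ H ∈ s, ‖x‖ ^ k * ‖H p x‖ := by
  obtain ⟨s, hs, c, hc, hle⟩ := hP.exists_norm_iteratedFDeriv_le n hG
  refine ⟨s, hs, c, hc, fun p x => ?_⟩
  calc _ ≤ ‖x‖ ^ k * (c * ∑ H ∈ s, ‖H p x‖) := by gcongr; exact hle p x
    _ = _ := by rw [← Finset.mul_sum]; ring

theorem decay_iteratedFDeriv (hP : IsSchwartzFamily b P) {G : X → E → V} (hG : G ∈ P) (p : X)
    (k n : ℕ) : ∃ C, ∀ x, ‖x‖ ^ k * ‖iteratedFDeriv ℝ n (G p) x‖ ≤ C := by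
  obtain ⟨s, hs, c, hc, hle⟩ := hP.exists_norm_pow_mul_iteratedFDeriv_le hG k n
  choose C hC using fun H : s => hP.decay _ (hs H.2) p k
  refine ⟨c * ∑ H : s, C H, fun x => (hle p x).trans ?_⟩
  rw [← Finset.sum_coe_sort s]
  gcongr with H
  exact hC H x

/-- The member `G` at the parameter `p`, as a Schwartz function. -/
def toSchwartz (hP : IsSchwartzFamily b P) {G : X → E → V} (hG : G ∈ P) (p : X) : 𝓢(E, V) where
  toFun := G p
  smooth' := contDiff_infty.2 fun n => hP.contDiff n hG p
  decay' := hP.decay_iteratedFDeriv hG p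

@[simp] theorem toSchwartz_apply (hP : IsSchwartzFamily b P) {G : X → E → V} (hG : G ∈ P) (p : X)
    (x : E) : hP.toSchwartz hG p x = G p x := rfl

theorem tendsto_toSchwartz (hP : IsSchwartzFamily b P) {G : X → E → V} (hG : G ∈ P) {l : Filter X}
    (hl : ∀ H ∈ P, ∀ k : ℕ, ∀ ε > 0, ∀ᶠ p in l, ∀ x, ‖x‖ ^ k * ‖H p x‖ ≤ ε) :
    Tendsto (fun p => hP.toSchwartz hG p) l (𝓝 0) := by
  rw [(schwartz_withSeminorms ℝ E V).tendsto_nhds _ _]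
  rintro ⟨k, n⟩ ε hε
  obtain ⟨s, hs, c, hc, hle⟩ := hP.exists_norm_pow_mul_iteratedFDeriv_le hG k n
  set δ := ε / (2 * (c * s.card + 1))
  have hδ : 0 < δ := by positivity
  have hsmall : ∀ᶠ p in l, ∀ H ∈ s, ∀ x, ‖x‖ ^ k * ‖H p x‖ ≤ δ :=
    (Finset.eventually_all s).2 fun H hH => hl H (hs hH) k δ hδ
  filter_upwards [hsmall] with p hp
  rw [sub_zero]
  refine lt_of_le_of_lt (SchwartzMap.seminorm_le_bound ℝ k n _ (half_pos hε).le fun x => ?_)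
    (half_lt_self hε)
  calc _ ≤ c * ∑ H ∈ s, ‖x‖ ^ k * ‖H p x‖ := hle p x
    _ ≤ c * ∑ _ ∈ s, δ := by gcongr with H hH; exact hp H hH x
    _ = c * s.card * δ := by rw [Finset.sum_const, nsmul_eq_mul]; ring
    _ ≤ (c * s.card + 1) * δ := by gcongr; linarith
    _ = ε / 2 := by simp only [δ]; field_simp

end IsSchwartzFamily

end Families

/-! ### Translations and slices of Schwartz functions -/

open scoped LineDeriv
open LineDeriv (lineDerivOpCLM lineDerivOpCLM_apply)

section Translations

variable {E V : Type*} [NormedAddCommGroup E] [NormedSpace ℝ E]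
  [NormedAddCommGroup V] [NormedSpace ℝ V]

theorem hasLineDerivAt_lineDerivOp (f : 𝓢(E, V)) (x v : E) :
    HasLineDerivAt ℝ f (∂_{v} f x) x v := by
  rw [SchwartzMap.lineDerivOp_apply]
  exact f.differentiableAt.lineDifferentiableAt.hasLineDerivAt

theorem lineDerivOp_comm (v w : E) (f : 𝓢(E, V)) : ∂_{v} (∂_{w} f) = ∂_{w} (∂_{v} f) := by
  ext x
  have hd : DifferentiableAt ℝ (fderiv ℝ f) x :=
    ((f.smooth 2).fderiv_right (m := 1) (by norm_num)).differentiable (by norm_num) x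
  have hsecond : ∀ v w : E, ∂_{v} (∂_{w} f) x = fderiv ℝ (fderiv ℝ f) x v w := fun v w => by
    have hw : ((∂_{w} f : 𝓢(E, V)) : E → V) = fun y => fderiv ℝ f y w :=
      funext fun y => SchwartzMap.lineDerivOp_apply_eq_fderiv w f y
    rw [SchwartzMap.lineDerivOp_apply_eq_fderiv, hw,
      fderiv_clm_apply hd (differentiableAt_const w)]
    simp
  rw [hsecond, hsecond]
  exact (f.smooth 2).contDiffAt.isSymmSndFDerivAt (by simp) v w

theorem norm_le_one_add_norm_mul_one_add_norm (x v : E) {s : ℝ} (hs : |s| ≤ 1) :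
    ‖x‖ ≤ (1 + ‖v‖) * (1 + ‖x + s • v‖) := by
  have hsub : ‖x‖ ≤ ‖x + s • v‖ + ‖s • v‖ := by simpa using norm_sub_le (x + s • v) (s • v)
  have hsmul : ‖s • v‖ ≤ ‖v‖ := by
    rw [norm_smul, Real.norm_eq_abs]
    exact mul_le_of_le_one_left (norm_nonneg _) hs
  nlinarith [norm_nonneg v, norm_nonneg (x + s • v),
    mul_nonneg (norm_nonneg v) (norm_nonneg (x + s • v))]

theorem exists_norm_pow_mul_norm_add_smul_le (f : 𝓢(E, V)) (v : E) (k : ℕ) :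
    ∃ C, ∀ (x : E) (s : ℝ), |s| ≤ 1 → ‖x‖ ^ k * ‖f (x + s • v)‖ ≤ C := by
  refine ⟨(1 + ‖v‖) ^ k * (2 ^ k * (Finset.Iic (k, 0)).sup
    (fun m => SchwartzMap.seminorm ℝ m.1 m.2) f), fun x s hs => ?_⟩
  calc _ ≤ ((1 + ‖v‖) * (1 + ‖x + s • v‖)) ^ k * ‖f (x + s • v)‖ := by
        gcongr
        exact norm_le_one_add_norm_mul_one_add_norm x v hs
    _ = (1 + ‖v‖) ^ k * ((1 + ‖x + s • v‖) ^ k * ‖iteratedFDeriv ℝ 0 f (x + s • v)‖) := by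
        rw [mul_pow, mul_assoc, norm_iteratedFDeriv_zero]
    _ ≤ _ := mul_le_mul_of_nonneg_left (SchwartzMap.one_add_le_sup_seminorm_apply (𝕜 := ℝ)
        (m := (k, 0)) le_rfl le_rfl f _) (by positivity)

theorem exists_norm_pow_mul_norm_slope_sub_le (f : 𝓢(E, V)) (v : E) (k : ℕ) :
    ∃ C, ∀ (x : E) (t : ℝ), |t| ≤ 1 → t ≠ 0 →
      ‖x‖ ^ k * ‖t⁻¹ • (f (x + t • v) - f x) - ∂_{v} f x‖ ≤ C * |t| := by
  obtain ⟨C, hC⟩ := exists_norm_pow_mul_norm_add_smul_le (∂_{v} (∂_{v} f)) v k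
  refine ⟨C, fun x t ht ht0 => ?_⟩
  have hweighted : ∀ (g : 𝓢(E, V)) y,
      HasLineDerivAt ℝ (fun y => (‖x‖ ^ k) • g y) ((‖x‖ ^ k) • ∂_{v} g y) y v :=
    fun g y => (hasLineDerivAt_lineDerivOp g y v).const_smul (‖x‖ ^ k)
  have htaylor := norm_image_add_smul_sub_sub_smul_le (hweighted f) (hweighted (∂_{v} f))
    (x := x) (t := t) fun s hs => by
      rw [norm_smul, norm_pow, norm_norm]
      exact hC x s (hs.trans ht)
  have hslope : (‖x‖ ^ k) • (t⁻¹ • (f (x + t • v) - f x) - ∂_{v} f x) =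
      t⁻¹ • ((‖x‖ ^ k) • f (x + t • v) - (‖x‖ ^ k) • f x - t • (‖x‖ ^ k) • ∂_{v} f x) := by
    simp only [smul_sub, smul_comm (‖x‖ ^ k) t⁻¹, inv_smul_smul₀ ht0]
  have hnorm := congrArg norm hslope
  rw [norm_smul, norm_pow, norm_norm] at hnorm
  rw [hnorm, norm_smul, norm_inv, Real.norm_eq_abs, inv_mul_le_iff₀ (abs_pos.2 ht0)]
  calc _ ≤ C * |t| ^ 2 := htaylor
    _ = |t| * (C * |t|) := by ring

theorem eventually_seminorm_le (k n : ℕ) {ε : ℝ} (hε : 0 < ε) :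
    ∀ᶠ f in 𝓝 (0 : 𝓢(E, V)), SchwartzMap.seminorm ℝ k n f ≤ ε :=
  (((schwartz_withSeminorms ℝ E V).continuous_seminorm (k, n)).tendsto' 0 0
    (map_zero _)).eventually (ge_mem_nhds hε)

theorem tendsto_slope_compSubConstCLM [FiniteDimensional ℝ E] (f : 𝓢(E, V)) (v : E) :
    Tendsto (fun t : ℝ => t⁻¹ • (f.compSubConstCLM ℝ (-(t • v)) - f)) (𝓝[≠] 0) (𝓝 (∂_{v} f)) := by
  let P : Set (ℝ → E → V) :=
    {G | ∃ g : 𝓢(E, V), G = fun t x => t⁻¹ • (g (x + t • v) - g x) - ∂_{v} g x}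
  have hP : IsSchwartzFamily (Module.finBasis ℝ E) P := by
    constructor
    · rintro G ⟨g, rfl⟩ i
      refine ⟨_, ⟨∂_{Module.finBasis ℝ E i} g, rfl⟩, fun t x => ?_⟩
      have hshift := hasLineDerivAt_lineDerivOp g (x + t • v) (Module.finBasis ℝ E i)
      have hx := hasLineDerivAt_lineDerivOp g x (Module.finBasis ℝ E i)
      have hdir := hasLineDerivAt_lineDerivOp (∂_{v} g) x (Module.finBasis ℝ E i)
      rw [lineDerivOp_comm] at hdir
      refine (((hshift.sub hx).const_smul t⁻¹).sub hdir).congr_of_eventuallyEq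
        (Eventually.of_forall fun s => ?_)
      simp [add_right_comm]
    · rintro G ⟨g, rfl⟩ t k
      obtain ⟨C, -, hC⟩ :=
        (t⁻¹ • (g.compSubConstCLM ℝ (-(t • v)) - g) - ∂_{v} g).decay k 0
      exact ⟨C, fun x => by simpa using hC x⟩
  have hlim : Tendsto (fun t => hP.toSchwartz ⟨f, rfl⟩ t) (𝓝[≠] 0) (𝓝 0) := by
    refine hP.tendsto_toSchwartz ⟨f, rfl⟩ ?_
    rintro H ⟨g, rfl⟩ k ε hε
    obtain ⟨C, hC⟩ := exists_norm_pow_mul_norm_slope_sub_le g v k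
    have hCt : ∀ᶠ t : ℝ in 𝓝 0, C * |t| ≤ ε :=
      (Continuous.tendsto' (by fun_prop) 0 0 (by simp)).eventually (ge_mem_nhds hε)
    have ht1 : ∀ᶠ t : ℝ in 𝓝 0, |t| ≤ 1 :=
      (continuous_abs.tendsto' (0 : ℝ) 0 abs_zero).eventually (ge_mem_nhds one_pos)
    filter_upwards [nhdsWithin_le_nhds hCt, nhdsWithin_le_nhds ht1, self_mem_nhdsWithin]
      with t hCt ht1 ht0 x
    exact (hC x t ht1 ht0).trans hCt
  rw [← tendsto_sub_nhds_zero_iff]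
  refine hlim.congr fun t => ?_
  ext x
  simp

end Translations

section Slices

variable {E F V : Type*} [NormedAddCommGroup E] [NormedAddCommGroup F]

theorem antilipschitzWith_prodMk_right (x : E) : AntilipschitzWith 1 (fun y : F => (y, x)) :=
  AntilipschitzWith.of_le_mul_dist fun y z => by simp [Prod.dist_eq]

variable [NormedSpace ℝ E] [NormedSpace ℝ F] [NormedAddCommGroup V] [NormedSpace ℂ V]

theorem hasTemperateGrowth_prodMk_right (x : E) : (fun y : F => (y, x)).HasTemperateGrowth := by
  have hsplit : (fun y : F => (y, x)) = ⇑(ContinuousLinearMap.inl ℝ F E) + fun _ => (0, x) := by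
    ext y <;> simp
  rw [hsplit]
  exact (ContinuousLinearMap.hasTemperateGrowth _).add (Function.HasTemperateGrowth.const _)

/-- The slice `f ↦ f(·, x)` on Schwartz functions of two variables. -/
def sliceAt (x : E) : 𝓢(F × E, V) →L[ℂ] 𝓢(F, V) :=
  SchwartzMap.compCLMOfAntilipschitz ℂ (hasTemperateGrowth_prodMk_right x)
    (antilipschitzWith_prodMk_right x)

@[simp] theorem sliceAt_apply (x : E) (f : 𝓢(F × E, V)) (y : F) : sliceAt x f y = f (y, x) := rfl

theorem norm_pow_mul_norm_smul_slice_le (f : 𝓢(F × E, V)) (x : E) (y : F) (k m : ℕ) :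
    ‖y‖ ^ k * ‖(‖x‖ ^ m : ℝ) • f (y, x)‖ ≤ SchwartzMap.seminorm ℝ (k + m) 0 f := by
  rw [norm_smul, norm_pow, norm_norm, ← mul_assoc]
  refine le_trans ?_ (SchwartzMap.norm_pow_mul_le_seminorm ℝ f (k + m) (y, x))
  rw [pow_add]
  gcongr
  · exact norm_fst_le (y, x)
  · exact norm_snd_le (y, x)

theorem eventually_smul_sliceAt_mem [FiniteDimensional ℝ F] (m : ℕ) {U : Set 𝓢(F, V)}
    (hU : U ∈ 𝓝 0) : ∀ᶠ f in 𝓝 (0 : 𝓢(F × E, V)), ∀ x, (‖x‖ ^ m : ℝ) • sliceAt x f ∈ U := by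
  let P : Set (𝓢(F × E, V) × E → F → V) :=
    {G | ∃ D : 𝓢(F × E, V) →L[ℂ] 𝓢(F × E, V), G = fun p y => (‖p.2‖ ^ m : ℝ) • D p.1 (y, p.2)}
  have hP : IsSchwartzFamily (Module.finBasis ℝ F) P := by
    constructor
    · rintro G ⟨D, rfl⟩ i
      refine ⟨_, ⟨lineDerivOpCLM ℂ 𝓢(F × E, V) (Module.finBasis ℝ F i, (0 : E)) ∘L D, rfl⟩,
        fun p y => ?_⟩
      refine ((hasLineDerivAt_lineDerivOp (D p.1) (y, p.2) (Module.finBasis ℝ F i, 0)).const_smul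
        (‖p.2‖ ^ m : ℝ)).congr_of_eventuallyEq (Eventually.of_forall fun t => ?_)
      simp
    · rintro G ⟨D, rfl⟩ p k
      exact ⟨_, fun y => norm_pow_mul_norm_smul_slice_le (D p.1) p.2 y k m⟩
  have hlim : Tendsto (fun p => hP.toSchwartz ⟨ContinuousLinearMap.id ℂ _, rfl⟩ p)
      (𝓝 0 ×ˢ ⊤) (𝓝 0) := by
    refine hP.tendsto_toSchwartz _ ?_
    rintro H ⟨D, rfl⟩ k ε hε
    have hsmall : ∀ᶠ f in 𝓝 (0 : 𝓢(F × E, V)), SchwartzMap.seminorm ℝ (k + m) 0 (D f) ≤ ε :=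
      (D.continuous.tendsto' 0 0 (map_zero D)).eventually (eventually_seminorm_le _ _ hε)
    filter_upwards [hsmall.prod_inl ⊤] with p hp y
    exact (norm_pow_mul_norm_smul_slice_le (D p.1) p.2 y k m).trans hp
  exact mem_prod_top.1 (hlim hU)

theorem tendsto_slope_sliceAt [FiniteDimensional ℝ E] [FiniteDimensional ℝ F] (f : 𝓢(F × E, V))
    (x v : E) :
    Tendsto (fun t : ℝ => t⁻¹ • (sliceAt (x + t • v) f - sliceAt x f)) (𝓝[≠] 0)
      (𝓝 (sliceAt x (∂_{((0 : F), v)} f))) := by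
  refine (((sliceAt x).continuous.tendsto _).comp
    (tendsto_slope_compSubConstCLM f (0, v))).congr fun t => ?_
  ext y
  simp

end Slices

/-! ### Schwartz functions of two variables -/

theorem exists_bound_of_eventually {𝕜 X Y : Type*} [NontriviallyNormedField 𝕜] [AddCommGroup X]
    [Module 𝕜 X] [TopologicalSpace X] [ContinuousSMul 𝕜 X] {N : X → Y → ℝ}
    (hN : ∀ (c : 𝕜) p y, N (c • p) y = ‖c‖ * N p y)
    (hsmall : ∀ᶠ p in 𝓝 (0 : X), ∀ y, N p y ≤ 1) (p : X) : ∃ C, ∀ y, N p y ≤ C := by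
  have hscale : Tendsto (fun c : 𝕜 => c • p) (𝓝[≠] 0) (𝓝 0) :=
    ((continuous_id.smul continuous_const).tendsto' (0 : 𝕜) 0 (zero_smul 𝕜 p)).mono_left
      nhdsWithin_le_nhds
  obtain ⟨c, hc, hc0⟩ := ((hscale.eventually hsmall).and self_mem_nhdsWithin).exists
  refine ⟨‖c‖⁻¹, fun y => ?_⟩
  rw [← one_div, le_div_iff₀' (norm_pos_iff.2 hc0), ← hN]
  exact hc y

theorem norm_prod_pow_le {E F : Type*} [NormedAddCommGroup E] [NormedAddCommGroup F] (z : F × E)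
    (k : ℕ) : ‖z‖ ^ k ≤ ‖z.1‖ ^ k + ‖z.2‖ ^ k := by
  rcases max_choice ‖z.1‖ ‖z.2‖ with h | h <;> rw [Prod.norm_def, h]
  · exact le_add_of_nonneg_right (by positivity)
  · exact le_add_of_nonneg_left (by positivity)

section VectorValued

variable {E F V X ι : Type*} [NormedAddCommGroup E] [NormedSpace ℝ E]
  [NormedAddCommGroup F] [NormedSpace ℝ F] [NormedAddCommGroup V] [NormedSpace ℂ V]
  [AddCommGroup X] [Module ℂ X] [TopologicalSpace X]

/-- A set of functions on `E` with values in the Schwartz space of `F`, depending linearly on a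
parameter, that is closed under derivatives along `b` and consists of functions that are rapidly
decreasing, uniformly for small parameters. -/
structure IsVectorSchwartzFamily (b : Module.Basis ι ℝ E) (Θ : Set (E → X →ₗ[ℂ] 𝓢(F, V))) :
    Prop where
  tendsto_slope : ∀ θ ∈ Θ, ∀ i, ∃ θ' ∈ Θ, ∀ p x,
    Tendsto (fun t : ℝ => t⁻¹ • (θ (x + t • b i) p - θ x p)) (𝓝[≠] 0) (𝓝 (θ' x p))
  eventually_smul_mem : ∀ θ ∈ Θ, ∀ m : ℕ, ∀ U ∈ 𝓝 (0 : 𝓢(F, V)), ∀ᶠ p in 𝓝 (0 : X), ∀ x,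
    (‖x‖ ^ m : ℝ) • θ x p ∈ U

namespace IsVectorSchwartzFamily

variable {b : Module.Basis ι ℝ E} {Θ : Set (E → X →ₗ[ℂ] 𝓢(F, V))}

/-- The functions `(y, x) ↦ (D θ(x))(y)` of two variables attached to a vector-valued family; the
operators `D` make this set closed under derivatives in `y`. -/
def uncurried (Θ : Set (E → X →ₗ[ℂ] 𝓢(F, V))) : Set (X → F × E → V) :=
  {G | ∃ θ ∈ Θ, ∃ D : 𝓢(F, V) →L[ℂ] 𝓢(F, V), G = fun p z => D (θ z.2 p) z.1}

theorem eventually_norm_pow_mul_norm_le (hΘ : IsVectorSchwartzFamily b Θ) {G : X → F × E → V}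
    (hG : G ∈ uncurried Θ) (k : ℕ) {ε : ℝ} (hε : 0 < ε) :
    ∀ᶠ p in 𝓝 (0 : X), ∀ z, ‖z‖ ^ k * ‖G p z‖ ≤ ε := by
  obtain ⟨θ, hθ, D, rfl⟩ := hG
  have hnhds (n : ℕ) : {f : 𝓢(F, V) | SchwartzMap.seminorm ℝ n 0 (D f) ≤ ε / 2} ∈ 𝓝 0 :=
    (D.continuous.tendsto' 0 0 (map_zero D)).eventually
      (eventually_seminorm_le n 0 (half_pos hε))
  filter_upwards [hΘ.eventually_smul_mem θ hθ 0 _ (hnhds k),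
    hΘ.eventually_smul_mem θ hθ k _ (hnhds 0)] with p hfst hsnd z
  have hfst : ‖z.1‖ ^ k * ‖D (θ z.2 p) z.1‖ ≤ ε / 2 := by
    have hz := hfst z.2
    rw [pow_zero, one_smul] at hz
    exact (SchwartzMap.norm_pow_mul_le_seminorm ℝ (D (θ z.2 p)) k z.1).trans hz
  have hsnd : ‖z.2‖ ^ k * ‖D (θ z.2 p) z.1‖ ≤ ε / 2 := by
    have hz := (SchwartzMap.norm_le_seminorm ℝ (D ((‖z.2‖ ^ k : ℝ) • θ z.2 p)) z.1).trans
      (hsnd z.2)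
    rwa [D.map_smul_of_tower, smul_apply, norm_smul, norm_pow, norm_norm] at hz
  calc ‖z‖ ^ k * ‖D (θ z.2 p) z.1‖ ≤ (‖z.1‖ ^ k + ‖z.2‖ ^ k) * ‖D (θ z.2 p) z.1‖ := by
        gcongr
        exact norm_prod_pow_le z k
    _ ≤ ε := by linarith [add_mul (‖z.1‖ ^ k) (‖z.2‖ ^ k) ‖D (θ z.2 p) z.1‖]

theorem isSchwartzFamily [FiniteDimensional ℝ F] [ContinuousSMul ℂ X]
    (hΘ : IsVectorSchwartzFamily b Θ) :
    IsSchwartzFamily ((Module.finBasis ℝ F).prod b) (uncurried Θ) := by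
  constructor
  · rintro G ⟨θ, hθ, D, rfl⟩ (i | i)
    · refine ⟨_, ⟨θ, hθ, lineDerivOpCLM ℂ 𝓢(F, V) (Module.finBasis ℝ F i) ∘L D, rfl⟩,
        fun p z => ?_⟩
      simpa [Module.Basis.prod_apply, HasLineDerivAt] using
        hasLineDerivAt_lineDerivOp (D (θ z.2 p)) z.1 (Module.finBasis ℝ F i)
    · obtain ⟨θ', hθ', hslope⟩ := hΘ.tendsto_slope θ hθ i
      refine ⟨_, ⟨θ', hθ', D, rfl⟩, fun p z => ?_⟩
      rw [HasLineDerivAt, hasDerivAt_iff_tendsto_slope_zero]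
      have heval := ((BoundedContinuousFunction.evalCLM ℂ z.1).comp
        (SchwartzMap.toBoundedContinuousFunctionCLM ℂ F V) ∘L D).continuous.tendsto (θ' z.2 p)
      refine (heval.comp (hslope p z.2)).congr fun t => ?_
      simp [Module.Basis.prod_apply, D.map_smul_of_tower]
  · intro G hG p k
    refine exists_bound_of_eventually (𝕜 := ℂ) (N := fun p z => ‖z‖ ^ k * ‖G p z‖) ?_
      (hΘ.eventually_norm_pow_mul_norm_le hG k one_pos) p
    obtain ⟨θ, -, D, rfl⟩ := hG
    intro c p y
    simp only [map_smul, smul_apply, norm_smul]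
    ring

variable [ContinuousSMul ℂ X] [IsTopologicalAddGroup X] [FiniteDimensional ℝ F] [Finite ι]

/-- The Schwartz function `(y, x) ↦ θ(x)(y)` of two variables, depending linearly and continuously
on the parameter. -/
def uncurryCLM (hΘ : IsVectorSchwartzFamily b Θ) {θ : E → X →ₗ[ℂ] 𝓢(F, V)} (hθ : θ ∈ Θ) :
    X →L[ℂ] 𝓢(F × E, V) :=
  let hG : (fun p z => θ z.2 p z.1) ∈ uncurried Θ := ⟨θ, hθ, ContinuousLinearMap.id ℂ _, rfl⟩
  let L : X →ₗ[ℂ] 𝓢(F × E, V) :=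
    { toFun := hΘ.isSchwartzFamily.toSchwartz hG
      map_add' := fun p q => by ext z; simp
      map_smul' := fun c p => by ext z; simp }
  ⟨L, continuous_of_continuousAt_zero L <| by
    rw [ContinuousAt, map_zero]
    exact hΘ.isSchwartzFamily.tendsto_toSchwartz hG
      fun H hH k ε hε => hΘ.eventually_norm_pow_mul_norm_le hH k hε⟩

end IsVectorSchwartzFamily

end VectorValued

section Ampliation

variable {E F F' V W : Type*} [NormedAddCommGroup E] [NormedSpace ℝ E]
  [NormedAddCommGroup F] [NormedSpace ℝ F] [NormedAddCommGroup F'] [NormedSpace ℝ F']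
  [NormedAddCommGroup V] [NormedSpace ℂ V] [NormedAddCommGroup W] [NormedSpace ℂ W]
  [FiniteDimensional ℝ F]

theorem eventually_norm_pow_mul_norm_apply_sliceAt_le (u : 𝓢(F, V) →L[ℂ] W)
    (D : 𝓢(F × E, V) →L[ℂ] 𝓢(F × E, V)) (k : ℕ) {ε : ℝ} (hε : 0 < ε) :
    ∀ᶠ f in 𝓝 0, ∀ x, ‖x‖ ^ k * ‖u (sliceAt x (D f))‖ ≤ ε := by
  have hu : {f | ‖u f‖ ≤ ε} ∈ 𝓝 0 :=
    (u.continuous.norm.tendsto' 0 0 (by simp)).eventually (ge_mem_nhds hε)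
  filter_upwards [(D.continuous.tendsto' 0 0 (map_zero D)).eventually
    (eventually_smul_sliceAt_mem k hu)] with f hf x
  simpa [u.map_smul_of_tower, norm_smul] using hf x

variable [FiniteDimensional ℝ E]

theorem isVectorSchwartzFamily_ampl (B : 𝓢(F, V) →L[ℂ] 𝓢(F', W)) :
    IsVectorSchwartzFamily (X := 𝓢(F × E, V)) (Module.finBasis ℝ E)
      {θ | ∃ D : 𝓢(F × E, V) →L[ℂ] 𝓢(F × E, V),
        θ = fun x => (B ∘L sliceAt x ∘L D : 𝓢(F × E, V) →L[ℂ] 𝓢(F', W)).toLinearMap} := by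
  constructor
  · rintro θ ⟨D, rfl⟩ i
    refine ⟨_, ⟨lineDerivOpCLM ℂ 𝓢(F × E, V) ((0 : F), Module.finBasis ℝ E i) ∘L D, rfl⟩,
      fun p x => ?_⟩
    refine ((B.continuous.tendsto _).comp
      (tendsto_slope_sliceAt (D p) x (Module.finBasis ℝ E i))).congr fun t => ?_
    simp [B.map_smul_of_tower]
  · rintro θ ⟨D, rfl⟩ m U hU
    filter_upwards [(D.continuous.tendsto' 0 0 (map_zero D)).eventually
      (eventually_smul_sliceAt_mem m (B.continuous.tendsto' 0 0 (map_zero B) hU))] with p hp x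
    have hx : B ((‖x‖ ^ m : ℝ) • sliceAt x (D p)) ∈ U := hp x
    rwa [B.map_smul_of_tower] at hx

/-- The operator `B` acting on the first of two variables. -/
def ampl [FiniteDimensional ℝ F'] (B : 𝓢(F, V) →L[ℂ] 𝓢(F', W)) :
    𝓢(F × E, V) →L[ℂ] 𝓢(F' × E, W) :=
  (isVectorSchwartzFamily_ampl B).uncurryCLM ⟨ContinuousLinearMap.id ℂ _, rfl⟩

@[simp] theorem ampl_apply [FiniteDimensional ℝ F'] (B : 𝓢(F, V) →L[ℂ] 𝓢(F', W))
    (f : 𝓢(F × E, V)) (z : F' × E) : ampl B f z = B (sliceAt z.2 f) z.1 := rfl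

/-- The functions `x ↦ u((D f)(·, x))`, with `(f, u)` as a parameter; the operators `D` make this
set closed under derivatives. -/
def partialFamily (E F V W : Type*) [NormedAddCommGroup E] [NormedSpace ℝ E]
    [NormedAddCommGroup F] [NormedSpace ℝ F] [NormedAddCommGroup V] [NormedSpace ℂ V]
    [NormedAddCommGroup W] [NormedSpace ℂ W] :
    Set (𝓢(F × E, V) × (𝓢(F, V) →L[ℂ] W) → E → W) :=
  {G | ∃ D : 𝓢(F × E, V) →L[ℂ] 𝓢(F × E, V), G = fun p x => p.2 (sliceAt x (D p.1))}

theorem isSchwartzFamily_partialFamily :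
    IsSchwartzFamily (Module.finBasis ℝ E) (partialFamily E F V W) := by
  constructor
  · rintro G ⟨D, rfl⟩ i
    refine ⟨_, ⟨lineDerivOpCLM ℂ 𝓢(F × E, V) ((0 : F), Module.finBasis ℝ E i) ∘L D, rfl⟩,
      fun p x => ?_⟩
    rw [HasLineDerivAt, hasDerivAt_iff_tendsto_slope_zero]
    refine ((p.2.continuous.tendsto _).comp
      (tendsto_slope_sliceAt (D p.1) x (Module.finBasis ℝ E i))).congr fun t => ?_
    simp [p.2.map_smul_of_tower]
  · rintro G ⟨D, rfl⟩ ⟨f, u⟩ k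
    exact exists_bound_of_eventually (𝕜 := ℂ) (N := fun f x => ‖x‖ ^ k * ‖u (sliceAt x (D f))‖)
      (fun c p x => by simp only [map_smul, norm_smul]; ring)
      (eventually_norm_pow_mul_norm_apply_sliceAt_le u D k one_pos) f

/-- The function `x ↦ u(f(·, x))`. -/
def partialApply (f : 𝓢(F × E, V)) (u : 𝓢(F, V) →L[ℂ] W) : 𝓢(E, W) :=
  isSchwartzFamily_partialFamily.toSchwartz
    (G := fun p x => p.2 (sliceAt x p.1)) ⟨ContinuousLinearMap.id ℂ _, rfl⟩ (f, u)

@[simp] theorem partialApply_apply (f : 𝓢(F × E, V)) (u : 𝓢(F, V) →L[ℂ] W) (x : E) :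
    partialApply f u x = u (sliceAt x f) := rfl

theorem tendsto_partialApply {Y : Type*} {l : Filter Y} {f : Y → 𝓢(F × E, V)}
    {u : Y → 𝓢(F, V) →L[ℂ] W}
    (h : ∀ (D : 𝓢(F × E, V) →L[ℂ] 𝓢(F × E, V)) (k : ℕ), ∀ ε > 0, ∀ᶠ p in l, ∀ x,
      ‖x‖ ^ k * ‖u p (sliceAt x (D (f p)))‖ ≤ ε) :
    Tendsto (fun p => partialApply (f p) (u p)) l (𝓝 0) := by
  refine (isSchwartzFamily_partialFamily (E := E) (F := F)).tendsto_toSchwartz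
    (G := fun p x => p.2 (sliceAt x p.1)) ⟨ContinuousLinearMap.id ℂ _, rfl⟩
    (l := l.map fun p => (f p, u p)) ?_ |>.comp tendsto_map
  rintro H ⟨D, rfl⟩ k ε hε
  exact h D k ε hε

/-- The operator `f ↦ (x ↦ u(f(·, x)))`. -/
def partialApplyCLM (u : 𝓢(F, V) →L[ℂ] W) : 𝓢(F × E, V) →L[ℂ] 𝓢(E, W) :=
  let L : 𝓢(F × E, V) →ₗ[ℂ] 𝓢(E, W) :=
    { toFun := fun f => partialApply f u
      map_add' := fun f g => by ext x; simp
      map_smul' := fun c f => by ext x; simp }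
  ⟨L, continuous_of_continuousAt_zero L <| by
    rw [ContinuousAt, map_zero]
    exact tendsto_partialApply fun D k ε hε =>
      eventually_norm_pow_mul_norm_apply_sliceAt_le u D k hε⟩

@[simp] theorem partialApplyCLM_apply (u : 𝓢(F, V) →L[ℂ] W) (f : 𝓢(F × E, V)) (x : E) :
    partialApplyCLM u f x = u (sliceAt x f) := rfl

end Ampliation

/-! ### Skew-adjoint operators on the Schwartz space -/

section SkewAdjoint

variable {E F : Type*}
  [NormedAddCommGroup E] [NormedSpace ℝ E] [MeasureSpace E] [BorelSpace E]
  [NormedAddCommGroup F] [NormedSpace ℝ F] [MeasureSpace F] [BorelSpace F]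

/-- The `L²` inner product of Schwartz functions, linear in the second entry; on bosonic functions
it is `ip`. -/
def l2Inner (f g : 𝓢(E, ℂ)) : ℂ := ∫ x, (starRingEnd ℂ) (f x) * g x

theorem l2Inner_compCLM {e : E ≃L[ℝ] F} (he : MeasurePreserving e volume volume)
    (f g : 𝓢(F, ℂ)) : l2Inner (compCLMOfContinuousLinearEquiv ℂ e f)
      (compCLMOfContinuousLinearEquiv ℂ e g) = l2Inner f g :=
  he.integral_comp' (f := e.toHomeomorph.toMeasurableEquiv)
    fun x => (starRingEnd ℂ) (f x) * g x

variable [(volume : Measure E).HasTemperateGrowth] [(volume : Measure F).HasTemperateGrowth]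

theorem integrable_conj_mul (f g : 𝓢(E, ℂ)) :
    Integrable fun x => (starRingEnd ℂ) (f x) * g x := by
  refine (L2.integrable_inner (𝕜 := ℂ) (f.toLp 2) (g.toLp 2)).congr ?_
  filter_upwards [f.coeFn_toLp 2, g.coeFn_toLp 2] with x hf hg
  rw [hf, hg, RCLike.inner_apply, mul_comm]

variable [FiniteDimensional ℝ E] [FiniteDimensional ℝ F]

theorem l2Inner_eq_inner (f g : 𝓢(E, ℂ)) :
    l2Inner f g = inner ℂ (toLpCLM ℂ ℂ 2 volume f) (toLpCLM ℂ ℂ 2 volume g) := by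
  refine Eq.trans ?_ (inner_toL2_toL2_eq f g).symm
  simp only [RCLike.inner_apply, mul_comm, l2Inner]

theorem conj_l2Inner (f g : 𝓢(E, ℂ)) : (starRingEnd ℂ) (l2Inner f g) = l2Inner g f := by
  rw [l2Inner_eq_inner, l2Inner_eq_inner, inner_conj_symm]

theorem l2Inner_add_right (f g h : 𝓢(E, ℂ)) : l2Inner f (g + h) = l2Inner f g + l2Inner f h := by
  simp only [l2Inner_eq_inner, map_add, inner_add_right]

theorem l2Inner_add_left (f g h : 𝓢(E, ℂ)) : l2Inner (f + g) h = l2Inner f h + l2Inner g h := by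
  simp only [l2Inner_eq_inner, map_add, inner_add_left]

theorem l2Inner_sub_right (f g h : 𝓢(E, ℂ)) : l2Inner f (g - h) = l2Inner f g - l2Inner f h := by
  simp only [l2Inner_eq_inner, map_sub, inner_sub_right]

theorem l2Inner_sub_left (f g h : 𝓢(E, ℂ)) : l2Inner (f - g) h = l2Inner f h - l2Inner g h := by
  simp only [l2Inner_eq_inner, map_sub, inner_sub_left]

theorem l2Inner_smul_right (c : ℂ) (f g : 𝓢(E, ℂ)) : l2Inner f (c • g) = c * l2Inner f g := by
  simp only [l2Inner_eq_inner, map_smul, inner_smul_right]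

theorem l2Inner_smul_left (c : ℂ) (f g : 𝓢(E, ℂ)) :
    l2Inner (c • f) g = (starRingEnd ℂ) c * l2Inner f g := by
  simp only [l2Inner_eq_inner, map_smul, inner_smul_left]

theorem l2Inner_sum_right {ι : Type*} (s : Finset ι) (f : 𝓢(E, ℂ)) (g : ι → 𝓢(E, ℂ)) :
    l2Inner f (∑ i ∈ s, g i) = ∑ i ∈ s, l2Inner f (g i) := by
  simp only [l2Inner_eq_inner, map_sum, inner_sum]

theorem l2Inner_self_eq_zero [(volume : Measure E).IsOpenPosMeasure] {f : 𝓢(E, ℂ)} :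
    l2Inner f f = 0 ↔ f = 0 := by
  rw [l2Inner_eq_inner, inner_self_eq_zero]
  exact (injective_toLp 2 (volume : Measure E)).eq_iff' (map_zero (toLpCLM ℂ ℂ 2 volume))

variable (E) in
/-- The real vector space of skew-adjoint continuous operators on the Schwartz space. -/
def skewOps : Submodule ℝ (𝓢(E, ℂ) →L[ℂ] 𝓢(E, ℂ)) where
  carrier := {B | ∀ f g, l2Inner f (B g) = -l2Inner (B f) g}
  add_mem' {A B} hA hB f g := by
    rw [add_apply, add_apply, l2Inner_add_right, l2Inner_add_left, hA, hB, neg_add]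
  zero_mem' f g := by simp [l2Inner]
  smul_mem' r A hA f g := by
    rw [smul_apply, smul_apply, ← Complex.coe_smul, ← Complex.coe_smul, l2Inner_smul_right,
      l2Inner_smul_left, hA, Complex.conj_ofReal, mul_neg]

theorem lie_mem_skewOps {A B : 𝓢(E, ℂ) →L[ℂ] 𝓢(E, ℂ)} (hA : A ∈ skewOps E)
    (hB : B ∈ skewOps E) : ⁅A, B⁆ ∈ skewOps E := fun f g => by
  simp only [Ring.lie_def, sub_apply, ContinuousLinearMap.mul_def, ContinuousLinearMap.comp_apply,
    l2Inner_sub_right, l2Inner_sub_left]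
  rw [hA, hB, hB f, hA _ g]
  ring

omit [(volume : Measure E).HasTemperateGrowth] in
theorem ampl_mem_skewOps [(volume : Measure (F × E)).HasTemperateGrowth]
    [SFinite (volume : Measure E)] [SFinite (volume : Measure F)]
    {B : 𝓢(F, ℂ) →L[ℂ] 𝓢(F, ℂ)} (hB : B ∈ skewOps F) : ampl (E := E) B ∈ skewOps (F × E) :=
  fun f g => by
  have fubini : ∀ f g : 𝓢(F × E, ℂ), l2Inner f g = ∫ x, l2Inner (sliceAt x f) (sliceAt x g) :=
    fun f g => integral_prod_symm _ (integrable_conj_mul f g)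
  have sliceAt_ampl : ∀ (f : 𝓢(F × E, ℂ)) (x : E), sliceAt x (ampl B f) = B (sliceAt x f) :=
    fun _ _ => rfl
  rw [fubini, fubini, ← integral_neg]
  simp only [sliceAt_ampl, hB _ (sliceAt _ g)]

/-- Transport of an operator on Schwartz functions along a linear change of variables. -/
def conjOp (e : E ≃L[ℝ] F) (B : 𝓢(F, ℂ) →L[ℂ] 𝓢(F, ℂ)) : 𝓢(E, ℂ) →L[ℂ] 𝓢(E, ℂ) :=
  compCLMOfContinuousLinearEquiv ℂ e ∘L B ∘L compCLMOfContinuousLinearEquiv ℂ e.symm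

theorem conjOp_mem_skewOps {e : E ≃L[ℝ] F} (he : MeasurePreserving e volume volume)
    {B : 𝓢(F, ℂ) →L[ℂ] 𝓢(F, ℂ)} (hB : B ∈ skewOps F) : conjOp e B ∈ skewOps E := fun f g => by
  have comp_symm : ∀ f : 𝓢(E, ℂ), compCLMOfContinuousLinearEquiv ℂ e
      (compCLMOfContinuousLinearEquiv ℂ e.symm f) = f := fun f => by ext; simp
  have adjoint_right : ∀ f g, l2Inner f (compCLMOfContinuousLinearEquiv ℂ e g)
      = l2Inner (compCLMOfContinuousLinearEquiv ℂ e.symm f) g := fun f g => by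
    rw [← l2Inner_compCLM he, comp_symm]
  have adjoint_left : ∀ f g, l2Inner (compCLMOfContinuousLinearEquiv ℂ e f) g
      = l2Inner f (compCLMOfContinuousLinearEquiv ℂ e.symm g) := fun f g => by
    rw [← conj_l2Inner, adjoint_right, conj_l2Inner]
  simp only [conjOp, ContinuousLinearMap.comp_apply]
  rw [adjoint_right, adjoint_left, hB]

end SkewAdjoint

/-! ### Operators acting on some of the particles -/

section SplitEquiv

variable {α β γ V : Type*} [NormedAddCommGroup V] [NormedSpace ℝ V]

/-- The decomposition of the configurations of particles labelled by `γ ≃ α ⊕ β` into those of the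
particles labelled by `α` and those of the particles labelled by `β`. -/
def splitEquiv (V : Type*) [NormedAddCommGroup V] [NormedSpace ℝ V] (e : α ⊕ β ≃ γ) :
    (γ → V) ≃L[ℝ] (α → V) × (β → V) :=
  (ContinuousLinearEquiv.piCongrLeft ℝ (fun _ : γ => V) e).symm.trans
    (ContinuousLinearEquiv.sumPiEquivProdPi ℝ α β fun _ => V)

@[simp] theorem splitEquiv_apply (e : α ⊕ β ≃ γ) (x : γ → V) :
    splitEquiv V e x = (fun a => x (e (Sum.inl a)), fun b => x (e (Sum.inr b))) := rfl

theorem measurePreserving_splitEquiv [Fintype α] [Fintype β] [Fintype γ] [MeasureSpace V]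
    [SigmaFinite (volume : Measure V)] (e : α ⊕ β ≃ γ) :
    MeasurePreserving (splitEquiv V e) volume volume :=
  (volume_measurePreserving_sumPiEquivProdPi fun _ => V).comp
    (volume_measurePreserving_piCongrLeft (fun _ => V) e).symm

end SplitEquiv

section ActOn

variable {d k m N : ℕ}

instance instTemperateConfProd (d k l : ℕ) :
    (volume : Measure (Conf d k × Conf d l)).HasTemperateGrowth :=
  have : (volume : Measure (Conf d k × Conf d l)).IsAddHaarMeasure :=
    Measure.prod.instIsAddHaarMeasure _ _
  Measure.IsAddHaarMeasure.instHasTemperateGrowth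

theorem moveTo_eq {j : Fin k ↪ Fin N} {x w : Conf d N} {z : Conf d k}
    (mem_range : ∀ a, w (j a) = z a) (notMem_range : ∀ i, (∀ a, j a ≠ i) → w i = x i) :
    moveTo j x z = w := by
  funext i
  by_cases h : ∃ a, j a = i
  · obtain ⟨a, rfl⟩ := h
    rw [moveTo_self, mem_range]
  · rw [moveTo_of_not _ _ _ _ h, notMem_range i (not_exists.1 h)]

theorem moveTo_comp_self (j : Fin k ↪ Fin N) (x : Conf d N) : moveTo j x (x ∘ j) = x :=
  moveTo_eq (fun _ => rfl) fun _ _ => rfl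

theorem moveTo_moveTo (j : Fin k ↪ Fin N) (x : Conf d N) (z w : Conf d k) :
    moveTo j (moveTo j x z) w = moveTo j x w :=
  moveTo_eq (moveTo_self j x w) fun i hi => by
    rw [moveTo_of_not _ _ _ _ (not_exists.2 hi), moveTo_of_not _ _ _ _ (not_exists.2 hi)]

theorem moveTo_trans (j : Fin k ↪ Fin N) (α : Fin m ↪ Fin k) (x : Conf d N) (z : Conf d m) :
    moveTo (α.trans j) x z = moveTo j x (moveTo α (x ∘ j) z) :=
  moveTo_eq (fun b => by rw [Function.Embedding.trans_apply, moveTo_self, moveTo_self])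
    fun i hi => by
      by_cases h : ∃ a, j a = i
      · obtain ⟨a, rfl⟩ := h
        rw [moveTo_self, moveTo_of_not, Function.comp_apply]
        exact fun ⟨b, hb⟩ => hi b (congrArg j hb)
      · rw [moveTo_of_not _ _ _ _ h]

theorem moveTo_trans_perm (j : Fin k ↪ Fin N) (π : Equiv.Perm (Fin N)) (x : Conf d N)
    (z : Conf d k) : moveTo (j.trans π.toEmbedding) x z ∘ π = moveTo j (x ∘ π) z :=
  Eq.symm <| moveTo_eq (fun a => moveTo_self (j.trans π.toEmbedding) x z a) fun i hi =>
    moveTo_of_not (j.trans π.toEmbedding) x z (π i) fun ⟨a, ha⟩ => hi a (π.injective ha)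

theorem moveTo_perm_trans (j : Fin k ↪ Fin N) (π : Equiv.Perm (Fin k)) (x : Conf d N)
    (z : Conf d k) : moveTo (π.toEmbedding.trans j) x (z ∘ π) = moveTo j x z :=
  moveTo_eq (fun a => moveTo_self j x z (π a)) fun i hi =>
    moveTo_of_not _ _ _ _ fun ⟨a, ha⟩ => hi (π.symm a) <| by simp [ha]

theorem le_of_embedding (j : Fin k ↪ Fin N) : k ≤ N := by
  simpa using Fintype.card_le_of_embedding j

/-- The labelling of `N` particles by the first `k` and the remaining ones. -/
def glueEquiv (h : k ≤ N) : Fin k ⊕ Fin (N - k) ≃ Fin N :=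
  finSumFinEquiv.trans (finCongr (Nat.add_sub_of_le h))

@[simp] theorem glueEquiv_inl (h : k ≤ N) (a : Fin k) :
    glueEquiv h (Sum.inl a) = Fin.castLE h a := rfl

theorem exists_perm_trans (j j' : Fin k ↪ Fin N) :
    ∃ σ : Equiv.Perm (Fin N), j.trans σ.toEmbedding = j' :=
  MulAction.isMultiplyPretransitive_iff.1 (Equiv.Perm.isMultiplyPretransitive (Fin N) k) j j'

theorem exists_equiv_extending (j : Fin k ↪ Fin N) :
    ∃ e : Fin k ⊕ Fin (N - k) ≃ Fin N, ∀ a, e (Sum.inl a) = j a := by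
  obtain ⟨σ, hσ⟩ := exists_perm_trans (Fin.castLEEmb (le_of_embedding j)) j
  exact ⟨(glueEquiv (le_of_embedding j)).trans σ, DFunLike.congr_fun hσ⟩

/-- A labelling of the particles by `j` and the remaining ones. -/
def extendEquiv (j : Fin k ↪ Fin N) : Fin k ⊕ Fin (N - k) ≃ Fin N :=
  (exists_equiv_extending j).choose

@[simp] theorem extendEquiv_inl (j : Fin k ↪ Fin N) (a : Fin k) :
    extendEquiv j (Sum.inl a) = j a := (exists_equiv_extending j).choose_spec a

theorem splitEquiv_moveTo (j : Fin k ↪ Fin N) (x : Conf d N) (z : Conf d k) :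
    splitEquiv _ (extendEquiv j) (moveTo j x z) = (z, (splitEquiv _ (extendEquiv j) x).2) := by
  refine Prod.ext (funext fun a => ?_) (funext fun b => ?_)
  · simp [moveTo_self]
  · refine moveTo_of_not _ _ _ _ fun ⟨a, ha⟩ => ?_
    rw [← extendEquiv_inl] at ha
    exact Sum.inl_ne_inr ((extendEquiv j).injective ha)

/-- The restriction `z ↦ f(x with the particles j(1), …, j(k) moved to z)` of Schwartz functions;
on bosonic functions it is `slice`. -/
def sliceCLM (j : Fin k ↪ Fin N) (x : Conf d N) : 𝓢(Conf d N, ℂ) →L[ℂ] 𝓢(Conf d k, ℂ) :=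
  compCLMOfAntilipschitz ℂ (moveTo_hasTemperateGrowth j x) (moveTo_antilipschitz j x)

@[simp] theorem sliceCLM_apply (j : Fin k ↪ Fin N) (x : Conf d N) (f : 𝓢(Conf d N, ℂ))
    (z : Conf d k) : sliceCLM j x f z = f (moveTo j x z) := rfl

/-- The function underlying `actOn`. -/
def actOnFun (j : Fin k ↪ Fin N) (B : 𝓢(Conf d k, ℂ) →L[ℂ] 𝓢(Conf d k, ℂ)) :
    𝓢(Conf d N, ℂ) →L[ℂ] 𝓢(Conf d N, ℂ) :=
  conjOp (splitEquiv _ (extendEquiv j)) (ampl B)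

theorem actOnFun_apply (j : Fin k ↪ Fin N) (B : 𝓢(Conf d k, ℂ) →L[ℂ] 𝓢(Conf d k, ℂ))
    (f : 𝓢(Conf d N, ℂ)) (x : Conf d N) : actOnFun j B f x = B (sliceCLM j x f) (x ∘ j) := by
  have slice_eq : sliceAt (splitEquiv _ (extendEquiv j) x).2
      (compCLMOfContinuousLinearEquiv ℂ (splitEquiv _ (extendEquiv j)).symm f)
        = sliceCLM j x f := by
    ext z
    rw [sliceAt_apply, sliceCLM_apply, ← splitEquiv_moveTo]
    exact congrArg f (ContinuousLinearEquiv.symm_apply_apply _ _)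
  rw [← slice_eq]
  have comp_eq : x ∘ j = (splitEquiv _ (extendEquiv j) x).1 := by ext; simp
  rw [comp_eq]
  rfl

/-- The operator `B_{(j₁, …, j_k)}`, i.e. `B` acting on the variables `x_{j₁}, …, x_{j_k}`. -/
def actOn (j : Fin k ↪ Fin N) :
    (𝓢(Conf d k, ℂ) →L[ℂ] 𝓢(Conf d k, ℂ)) →ₐ[ℂ] (𝓢(Conf d N, ℂ) →L[ℂ] 𝓢(Conf d N, ℂ)) :=
  AlgHom.ofLinearMap
    { toFun := actOnFun j
      map_add' := fun A B => by ext f x; simp [actOnFun_apply]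
      map_smul' := fun c A => by ext f x; simp [actOnFun_apply] }
    (by ext f x; simp [actOnFun_apply, moveTo_comp_self])
    fun A B => by
      ext f x
      have slice_eq : sliceCLM j x (actOnFun j B f) = B (sliceCLM j x f) := by
        ext z
        rw [sliceCLM_apply, actOnFun_apply]
        congr 1
        · congr 1
          ext w
          rw [sliceCLM_apply, moveTo_moveTo, sliceCLM_apply]
        · exact funext (moveTo_self j x z)
      simp [actOnFun_apply, slice_eq]

theorem actOn_apply (j : Fin k ↪ Fin N) (B : 𝓢(Conf d k, ℂ) →L[ℂ] 𝓢(Conf d k, ℂ))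
    (f : 𝓢(Conf d N, ℂ)) (x : Conf d N) : actOn j B f x = B (sliceCLM j x f) (x ∘ j) :=
  actOnFun_apply j B f x

theorem actOn_mem_skewOps (j : Fin k ↪ Fin N) {B : 𝓢(Conf d k, ℂ) →L[ℂ] 𝓢(Conf d k, ℂ)}
    (hB : B ∈ skewOps (Conf d k)) : actOn j B ∈ skewOps (Conf d N) :=
  conjOp_mem_skewOps (measurePreserving_splitEquiv _) (ampl_mem_skewOps hB)

theorem actOn_actOn (j : Fin k ↪ Fin N) (α : Fin m ↪ Fin k)
    (A : 𝓢(Conf d m, ℂ) →L[ℂ] 𝓢(Conf d m, ℂ)) : actOn j (actOn α A) = actOn (α.trans j) A := by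
  ext f x
  simp only [actOn_apply]
  congr 2
  ext z
  simp only [sliceCLM_apply, moveTo_trans]

end ActOn

/-! ### Symmetrization and the embeddings of observables -/

section Symmetrization

variable {d k N : ℕ}

/-- The projection of the Schwartz space onto the bosonic Schwartz space. -/
def symmetrize (d k : ℕ) : 𝓢(Conf d k, ℂ) →L[ℂ] SymSchwartz d k :=
  ((k.factorial : ℂ)⁻¹ • ∑ π : Equiv.Perm (Fin k), permSchwartz d π).codRestrict (SymSchwartz d k)
    fun f σ x => by
      have reindex : ∑ π : Equiv.Perm (Fin k), f ((x ∘ σ) ∘ π)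
          = ∑ π : Equiv.Perm (Fin k), f (x ∘ π) :=
        Fintype.sum_equiv (Equiv.mulLeft σ) _ _ fun π => rfl
      simp [reindex]

theorem coe_symmetrize (f : 𝓢(Conf d k, ℂ)) : (symmetrize d k f).1
    = (k.factorial : ℂ)⁻¹ • ∑ π : Equiv.Perm (Fin k), permSchwartz d π f := by
  change ((k.factorial : ℂ)⁻¹ • ∑ π : Equiv.Perm (Fin k), permSchwartz d π) f = _
  simp

theorem symmetrize_apply (f : 𝓢(Conf d k, ℂ)) (x : Conf d k) :
    (symmetrize d k f).1 x = (k.factorial : ℂ)⁻¹ * ∑ π : Equiv.Perm (Fin k), f (x ∘ π) := by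
  simp [coe_symmetrize]

theorem inv_factorial_mul_sum_perm_const (k : ℕ) (c : ℂ) :
    (k.factorial : ℂ)⁻¹ * ∑ _π : Equiv.Perm (Fin k), c = c := by
  simp [Fintype.card_perm, Nat.factorial_ne_zero]

@[simp] theorem symmetrize_coe (f : SymSchwartz d k) : symmetrize d k f.1 = f := by
  ext x
  simp only [symmetrize_apply, f.2 _ x, inv_factorial_mul_sum_perm_const]

theorem coe_symmetrize_of_mem {f : 𝓢(Conf d k, ℂ)} (hf : f ∈ SymSchwartz d k) :
    (symmetrize d k f).1 = f :=
  congrArg Subtype.val (symmetrize_coe ⟨f, hf⟩)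

theorem l2Inner_coe (f : 𝓢(Conf d k, ℂ)) (h : SymSchwartz d k) :
    l2Inner f h.1 = ip (symmetrize d k f) h := by
  have perm_invariance : ∀ π : Equiv.Perm (Fin k),
      l2Inner h.1 (permSchwartz d π f) = l2Inner h.1 f := fun π => by
    rw [← l2Inner_compCLM (e := permConf d π) (measurePreserving_permConf d π) h.1 f]
    congr 1
    exact SchwartzMap.ext fun x => (h.2 π x).symm
  change _ = l2Inner (symmetrize d k f).1 h.1
  rw [← conj_l2Inner h.1 f, ← conj_l2Inner h.1, coe_symmetrize, l2Inner_smul_right,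
    l2Inner_sum_right]
  simp only [perm_invariance, inv_factorial_mul_sum_perm_const]

/-- An operator on bosonic functions, extended to all functions by symmetrizing them. -/
def fullOp (A : SymSchwartz d k →L[ℂ] SymSchwartz d k) : 𝓢(Conf d k, ℂ) →L[ℂ] 𝓢(Conf d k, ℂ) :=
  (SymSchwartz d k).subtypeL ∘L A ∘L symmetrize d k

theorem fullOp_apply (A : SymSchwartz d k →L[ℂ] SymSchwartz d k) (f : 𝓢(Conf d k, ℂ)) :
    fullOp A f = (A (symmetrize d k f)).1 := rfl

theorem fullOp_mem_skewOps (A : Obs d k) : fullOp A.1 ∈ skewOps (Conf d k) := fun f g => by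
  rw [fullOp_apply, fullOp_apply, l2Inner_coe, A.2, ← conj_l2Inner g, l2Inner_coe, ip_conj]

/-- The observable obtained from a skew-adjoint operator by symmetrization. -/
def obsOfSkew : skewOps (Conf d k) →ₗ[ℝ] Obs d k where
  toFun D := ⟨symmetrize d k ∘L D.1 ∘L (SymSchwartz d k).subtypeL, fun f g => by
    change ip f (symmetrize d k (D.1 g.1)) = -ip (symmetrize d k (D.1 f.1)) g
    rw [← ip_conj, ← l2Inner_coe, ← l2Inner_coe, conj_l2Inner, D.2]⟩
  map_add' A B := by ext f x; simp
  map_smul' r A := by ext f x; simp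

theorem obsOfSkew_apply (D : skewOps (Conf d k)) (f : SymSchwartz d k) :
    (obsOfSkew D).1 f = symmetrize d k (D.1 f.1) := rfl

theorem obsOfSkew_fullOp (A : Obs d k) : obsOfSkew ⟨fullOp A.1, fullOp_mem_skewOps A⟩ = A := by
  ext f x
  simp [obsOfSkew_apply, fullOp_apply]

/-- The average of the operators `D_{(j₁, …, j_k)}`. -/
def average (N : ℕ) :
    (𝓢(Conf d k, ℂ) →L[ℂ] 𝓢(Conf d k, ℂ)) →ₗ[ℂ] (𝓢(Conf d N, ℂ) →L[ℂ] 𝓢(Conf d N, ℂ)) :=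
  (N.descFactorial k : ℂ)⁻¹ • ∑ j : Fin k ↪ Fin N, (actOn j).toLinearMap

theorem average_eq (D : 𝓢(Conf d k, ℂ) →L[ℂ] 𝓢(Conf d k, ℂ)) :
    average N D = (N.descFactorial k : ℂ)⁻¹ • ∑ j : Fin k ↪ Fin N, actOn j D := by
  simp [average]

theorem average_apply (D : 𝓢(Conf d k, ℂ) →L[ℂ] 𝓢(Conf d k, ℂ)) (f : 𝓢(Conf d N, ℂ))
    (x : Conf d N) : average N D f x
      = (N.descFactorial k : ℂ)⁻¹ * ∑ j : Fin k ↪ Fin N, actOn j D f x := by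
  simp [average_eq]

theorem average_mem_skewOps {D : 𝓢(Conf d k, ℂ) →L[ℂ] 𝓢(Conf d k, ℂ)}
    (hD : D ∈ skewOps (Conf d k)) : average N D ∈ skewOps (Conf d N) := by
  have real_scalar : average N D
      = ((N.descFactorial k : ℝ)⁻¹) • ∑ j : Fin k ↪ Fin N, actOn j D := by
    rw [average_eq, ← Complex.coe_smul]
    push_cast
    rfl
  rw [real_scalar]
  exact Submodule.smul_mem _ _ (Submodule.sum_mem _ fun j _ => actOn_mem_skewOps j hD)

theorem actOn_trans_perm (j : Fin k ↪ Fin N) (π : Equiv.Perm (Fin N))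
    (D : 𝓢(Conf d k, ℂ) →L[ℂ] 𝓢(Conf d k, ℂ)) (f : SymSchwartz d N) (x : Conf d N) :
    actOn (j.trans π.toEmbedding) D f.1 x = actOn j D f.1 (x ∘ π) := by
  rw [actOn_apply, actOn_apply]
  congr 2
  ext z
  rw [sliceCLM_apply, sliceCLM_apply, ← f.2 π, moveTo_trans_perm]

theorem average_mem_symSchwartz (D : 𝓢(Conf d k, ℂ) →L[ℂ] 𝓢(Conf d k, ℂ))
    (f : SymSchwartz d N) : average N D f.1 ∈ SymSchwartz d N := fun π x => by
  simp only [average_apply, ← actOn_trans_perm]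
  congr 1
  exact Fintype.sum_equiv (Equiv.embeddingCongr (Equiv.refl _) π) _ _ fun j => rfl

theorem sliceCLM_perm_trans (j : Fin k ↪ Fin N) (π : Equiv.Perm (Fin k)) (f : SymSchwartz d N)
    (x : Conf d N) : sliceCLM (π.toEmbedding.trans j) x f.1 = sliceCLM j x f.1 := by
  ext z
  rw [sliceCLM_apply, sliceCLM_apply, ← moveTo_perm_trans j π]
  exact ((slice (π.toEmbedding.trans j) x f).2 π z).symm

theorem IsEmbedded.embed_eq {A : Obs d k} {T : Obs d N} (h : IsEmbedded A T) :
    embed N A = T := by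
  have exists_embedded : ∃ T : Obs d N, IsEmbedded A T := ⟨T, h⟩
  have isEmbedded_embed : IsEmbedded A (embed N A) := by
    rw [embed, dif_pos exists_embedded]
    exact exists_embedded.choose_spec
  ext f x
  rw [isEmbedded_embed f x, h f x]

theorem obsOfSkew_slice_apply (D : skewOps (Conf d k)) (j : Fin k ↪ Fin N) (f : SymSchwartz d N)
    (x : Conf d N) : ((obsOfSkew D).1 (slice j x f)).1 (fun a => x (j a))
      = (k.factorial : ℂ)⁻¹ *
        ∑ π : Equiv.Perm (Fin k), actOn (π.toEmbedding.trans j) D.1 f.1 x := by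
  simp only [obsOfSkew_apply, symmetrize_apply, actOn_apply, sliceCLM_perm_trans]
  rfl

theorem embed_obsOfSkew (D : skewOps (Conf d k)) :
    embed N (obsOfSkew D) = obsOfSkew ⟨average N D.1, average_mem_skewOps D.2⟩ := by
  refine IsEmbedded.embed_eq fun f x => ?_
  have reindex : ∀ π : Equiv.Perm (Fin k),
      ∑ j : Fin k ↪ Fin N, actOn (π.toEmbedding.trans j) D.1 f.1 x
        = ∑ j : Fin k ↪ Fin N, actOn j D.1 f.1 x := fun π =>
    Fintype.sum_equiv (Equiv.embeddingCongr π.symm (Equiv.refl _)) _ _ fun j => rfl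
  rw [obsOfSkew_apply, coe_symmetrize_of_mem (average_mem_symSchwartz D.1 f), average_apply,
    Finset.sum_congr rfl fun j _ => obsOfSkew_slice_apply D j f x, ← Finset.mul_sum,
    Finset.sum_comm]
  simp only [reindex, inv_factorial_mul_sum_perm_const]

theorem embed_eq_obsOfSkew (A : Obs d k) : embed N A
    = obsOfSkew ⟨average N (fullOp A.1), average_mem_skewOps (fullOp_mem_skewOps A)⟩ := by
  conv_lhs => rw [← obsOfSkew_fullOp A]
  exact embed_obsOfSkew _

theorem coe_embed_apply (A : Obs d k) (f : SymSchwartz d N) :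
    ((embed N A).1 f).1 = average N (fullOp A.1) f.1 := by
  rw [embed_eq_obsOfSkew, obsOfSkew_apply, coe_symmetrize_of_mem (average_mem_symSchwartz _ f)]

end Symmetrization

/-! ### Operators acting on disjoint sets of particles commute -/

section BumpProduct

variable {ι V : Type*} [Fintype ι] [NormedAddCommGroup V] [InnerProductSpace ℝ V]
  [FiniteDimensional ℝ V]

theorem hasCompactSupport_prod_bump {c : ι → V} (b : ∀ i, ContDiffBump (c i)) :
    HasCompactSupport fun x : ι → V => ∏ i, b i (x i) :=
  HasCompactSupport.of_support_subset_isCompact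
    (isCompact_univ_pi fun i => (b i).hasCompactSupport.isCompact) fun _ hx i _ =>
      subset_tsupport _ fun h => hx (Finset.prod_eq_zero (Finset.mem_univ i) h)

/-- The function `x ↦ ∏ᵢ bᵢ(xᵢ)`. -/
def bumpProduct {c : ι → V} (b : ∀ i, ContDiffBump (c i)) : 𝓢(ι → V, ℂ) :=
  HasCompactSupport.toSchwartzMap (f := fun x : ι → V => ((∏ i, b i (x i) : ℝ) : ℂ))
    ((hasCompactSupport_prod_bump b).comp_left Complex.ofReal_zero)
    (Complex.ofRealCLM.contDiff.comp
      (contDiff_prod fun i _ => (b i).contDiff.comp (contDiff_apply ℝ _ i)))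

@[simp] theorem bumpProduct_apply {c : ι → V} (b : ∀ i, ContDiffBump (c i)) (x : ι → V) :
    bumpProduct b x = ((∏ i, b i (x i) : ℝ) : ℂ) := rfl

theorem mem_ball_of_prod_bump_ne_zero {c : ι → V} {b : ∀ i, ContDiffBump (c i)} {δ : ℝ}
    (hδ : 0 < δ) (hb : ∀ i, (b i).rOut ≤ δ) {x : ι → V} (hx : ∏ i, b i (x i) ≠ 0) :
    x ∈ Metric.ball c δ := by
  refine (dist_pi_lt_iff hδ).2 fun i => ?_
  have mem_support : x i ∈ Function.support (b i) :=
    Finset.prod_ne_zero_iff.1 hx i (Finset.mem_univ i)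
  rw [(b i).support_eq, Metric.mem_ball] at mem_support
  exact mem_support.trans_le (hb i)

variable [MeasurableSpace V] [BorelSpace V]

-- Near a point `c` with `h c ≠ 0` the real part of `conj (h c) * h` is positive.
theorem eq_zero_of_forall_l2Inner_bumpProduct {h : 𝓢(ι → V, ℂ)}
    (orthogonal : ∀ (c : ι → V) (b : ∀ i, ContDiffBump (c i)), l2Inner (bumpProduct b) h = 0) :
    h = 0 := by
  ext c
  by_contra ne_zero
  rw [zero_apply] at ne_zero
  let r : (ι → V) → ℝ := fun x => ((starRingEnd ℂ) (h c) * h x).re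
  have continuous_r : Continuous r :=
    Complex.continuous_re.comp (continuous_const.mul h.continuous)
  have r_pos : 0 < r c := by
    simp only [r, ← Complex.normSq_eq_conj_mul_self, Complex.ofReal_re]
    exact Complex.normSq_pos.2 ne_zero
  obtain ⟨δ, hδ, ball_subset⟩ := Metric.mem_nhds_iff.1
    (continuous_r.continuousAt.eventually (lt_mem_nhds r_pos))
  let b : ∀ i, ContDiffBump (c i) := fun i => ⟨δ / 2, δ, half_pos hδ, half_lt_self hδ⟩
  let g : (ι → V) → ℝ := fun x => ∏ i, b i (x i)
  have integral_pos : 0 < ∫ x, g x * r x := by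
    refine Continuous.integral_pos_of_hasCompactSupport_nonneg_nonzero (x := c)
      ((continuous_finsetProd _ fun i _ => (b i).continuous.comp (continuous_apply i)).mul
        continuous_r) (hasCompactSupport_prod_bump b).mul_right (fun x => ?_) ?_
    · by_cases hx : g x = 0
      · simp [hx]
      · exact mul_nonneg (Finset.prod_nonneg fun i _ => (b i).nonneg)
          (ball_subset (mem_ball_of_prod_bump_ne_zero hδ (fun _ => le_rfl) hx)).le
    · exact mul_ne_zero (Finset.prod_pos fun i _ =>
        (b i).pos_of_mem_ball (Metric.mem_ball_self hδ)).ne' r_pos.ne'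
  refine integral_pos.ne' ?_
  calc ∫ x, g x * r x = ∫ x, RCLike.re ((starRingEnd ℂ) (h c)
          * ((starRingEnd ℂ) (bumpProduct b x) * h x)) := by
        refine integral_congr_ae (.of_forall fun x => ?_)
        simp only [bumpProduct_apply, Complex.conj_ofReal, mul_left_comm _ (Complex.ofReal _)]
        exact (Complex.re_ofReal_mul _ _).symm
    _ = RCLike.re ((starRingEnd ℂ) (h c) * l2Inner (bumpProduct b) h) := by
        rw [integral_re ((integrable_conj_mul _ h).const_mul _), integral_const_mul, l2Inner]
    _ = 0 := by rw [orthogonal, mul_zero, map_zero]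

end BumpProduct

section Commutation

variable {d k l N : ℕ}

theorem actOn_apply_of_factor (α : Fin k ↪ Fin N) (A : 𝓢(Conf d k, ℂ) →L[ℂ] 𝓢(Conf d k, ℂ))
    {f : 𝓢(Conf d N, ℂ)} {x : Conf d N} {c : ℂ} {u : 𝓢(Conf d k, ℂ)}
    (h : ∀ z, f (moveTo α x z) = c * u z) : actOn α A f x = c * A u (x ∘ α) := by
  have slice_eq : sliceCLM α x f = c • u := by
    ext z
    rw [sliceCLM_apply, h, smul_apply, smul_eq_mul]
  rw [actOn_apply, slice_eq, map_smul, smul_apply, smul_eq_mul]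

theorem prod_moveTo (b : Fin N → EuclideanSpace ℝ (Fin d) → ℝ) (α : Fin k ↪ Fin N)
    {s : Finset (Fin N)} (hs : Disjoint (Finset.univ.map α) s) (x : Conf d N) (z : Conf d k) :
    ∏ i ∈ sᶜ, b i (moveTo α x z i)
      = (∏ i ∈ (Finset.univ.map α ∪ s)ᶜ, b i (x i)) * ∏ a, b (α a) (z a) := by
  have range_subset : Finset.univ.map α ⊆ sᶜ := Finset.subset_compl_iff_disjoint_right.2 hs
  rw [← Finset.prod_sdiff range_subset, Finset.prod_map, Finset.compl_union, Finset.inter_comm,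
    ← Finset.sdiff_eq_inter_compl]
  congr 1
  · refine Finset.prod_congr rfl fun i hi => ?_
    rw [moveTo_of_not]
    simpa using (Finset.mem_sdiff.1 hi).2
  · simp only [moveTo_self]

theorem actOn_actOn_bumpProduct {c : Conf d N} (b : ∀ i, ContDiffBump (c i))
    {α : Fin k ↪ Fin N} {β : Fin l ↪ Fin N} (disjoint : ∀ a c, α a ≠ β c)
    (A : 𝓢(Conf d k, ℂ) →L[ℂ] 𝓢(Conf d k, ℂ)) (B : 𝓢(Conf d l, ℂ) →L[ℂ] 𝓢(Conf d l, ℂ))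
    (x : Conf d N) : actOn α A (actOn β B (bumpProduct b)) x =
      ((∏ i ∈ (Finset.univ.map α ∪ Finset.univ.map β)ᶜ, b i (x i) : ℝ) : ℂ)
        * B (bumpProduct fun a => b (β a)) (x ∘ β) * A (bumpProduct fun a => b (α a)) (x ∘ α) := by
  have inner_action : ∀ y, actOn β B (bumpProduct b) y
      = ((∏ i ∈ (Finset.univ.map β)ᶜ, b i (y i) : ℝ) : ℂ)
        * B (bumpProduct fun a => b (β a)) (y ∘ β) := by
    refine fun y => actOn_apply_of_factor β B fun z => ?_
    have prod_eq := prod_moveTo (fun i => b i) β (Finset.disjoint_empty_right _) y z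
    rw [Finset.compl_empty, Finset.union_empty] at prod_eq
    rw [bumpProduct_apply, bumpProduct_apply, prod_eq, Complex.ofReal_mul]
  refine actOn_apply_of_factor α A fun z => ?_
  have disjoint_range : Disjoint (Finset.univ.map α) (Finset.univ.map β) := by
    simpa [Finset.disjoint_left] using fun a c h => disjoint a c h.symm
  have moveTo_comp : moveTo α x z ∘ β = x ∘ β :=
    funext fun c => moveTo_of_not _ _ _ _ fun ⟨a, h⟩ => disjoint a c h
  rw [inner_action, prod_moveTo (fun i => b i) α disjoint_range, moveTo_comp, bumpProduct_apply,
    Complex.ofReal_mul]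
  ring

-- The commutator annihilates the products of bump functions, so by skewness its range is
-- orthogonal to them.
theorem lie_actOn_eq_zero {α : Fin k ↪ Fin N} {β : Fin l ↪ Fin N} (disjoint : ∀ a c, α a ≠ β c)
    {A : 𝓢(Conf d k, ℂ) →L[ℂ] 𝓢(Conf d k, ℂ)} {B : 𝓢(Conf d l, ℂ) →L[ℂ] 𝓢(Conf d l, ℂ)}
    (hA : A ∈ skewOps (Conf d k)) (hB : B ∈ skewOps (Conf d l)) : ⁅actOn α A, actOn β B⁆ = 0 := by
  ext1 f
  refine eq_zero_of_forall_l2Inner_bumpProduct fun c b => ?_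
  have annihilates : ⁅actOn α A, actOn β B⁆ (bumpProduct b) = 0 := by
    ext x
    simp only [Ring.lie_def, sub_apply, ContinuousLinearMap.mul_def,
      ContinuousLinearMap.comp_apply, zero_apply]
    rw [actOn_actOn_bumpProduct b disjoint,
      actOn_actOn_bumpProduct b fun a c => (disjoint c a).symm, Finset.union_comm]
    ring
  rw [lie_mem_skewOps (actOn_mem_skewOps α hA) (actOn_mem_skewOps β hB), annihilates]
  simp [l2Inner]

end Commutation

/-! ### Commutators of embedded observables -/

section Bracket

variable {d k l m N : ℕ}

-- Both sides equal the sum of `φ (γ.trans π)` over all `γ` and `π`, as the sum over `π` does not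
-- depend on `γ`.
theorem descFactorial_nsmul_sum_perm_trans {M : Type*} [AddCommMonoid M] (γ : Fin k ↪ Fin N)
    (φ : (Fin k ↪ Fin N) → M) :
    N.descFactorial k • ∑ π : Equiv.Perm (Fin N), φ (γ.trans π.toEmbedding)
      = N.factorial • ∑ j, φ j := by
  have independent : ∀ γ' : Fin k ↪ Fin N, ∑ π : Equiv.Perm (Fin N), φ (γ'.trans π.toEmbedding)
      = ∑ π : Equiv.Perm (Fin N), φ (γ.trans π.toEmbedding) := fun γ' => by
    obtain ⟨σ, rfl⟩ := exists_perm_trans γ γ'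
    exact Fintype.sum_equiv (Equiv.mulRight σ) _ _ fun π => rfl
  have reindex : ∀ π : Equiv.Perm (Fin N), ∑ γ' : Fin k ↪ Fin N, φ (γ'.trans π.toEmbedding)
      = ∑ j, φ j := fun π =>
    Fintype.sum_equiv (Equiv.embeddingCongr (Equiv.refl _) π) _ _ fun γ' => rfl
  calc N.descFactorial k • ∑ π : Equiv.Perm (Fin N), φ (γ.trans π.toEmbedding)
      = ∑ γ' : Fin k ↪ Fin N, ∑ π : Equiv.Perm (Fin N), φ (γ'.trans π.toEmbedding) := by
        simp [independent, Fintype.card_embedding_eq]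
    _ = ∑ π : Equiv.Perm (Fin N), ∑ γ' : Fin k ↪ Fin N, φ (γ'.trans π.toEmbedding) :=
        Finset.sum_comm
    _ = N.factorial • ∑ j, φ j := by simp [reindex, Fintype.card_perm]

theorem average_eq_sum_perm (γ : Fin k ↪ Fin N) (D : 𝓢(Conf d k, ℂ) →L[ℂ] 𝓢(Conf d k, ℂ)) :
    average N D = (N.factorial : ℂ)⁻¹ •
      ∑ π : Equiv.Perm (Fin N), actOn (γ.trans π.toEmbedding) D := by
  have descFactorial_ne_zero : (N.descFactorial k : ℂ) ≠ 0 :=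
    Nat.cast_ne_zero.2 (Nat.descFactorial_pos.2 (le_of_embedding γ)).ne'
  have factorial_ne_zero : (N.factorial : ℂ) ≠ 0 := Nat.cast_ne_zero.2 N.factorial_ne_zero
  rw [average_eq, inv_smul_eq_iff₀ descFactorial_ne_zero, smul_comm,
    eq_inv_smul_iff₀ factorial_ne_zero, Nat.cast_smul_eq_nsmul, Nat.cast_smul_eq_nsmul,
    descFactorial_nsmul_sum_perm_trans γ fun j => actOn j D]

theorem exists_trans_eq {U : Finset (Fin N)} (hU : U.card = k) {α : Fin l ↪ Fin N}
    (hα : ∀ a, α a ∈ U) : ∃ α' : Fin l ↪ Fin k, α'.trans (U.orderEmbOfFin hU).toEmbedding = α := by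
  have mem_range : ∀ a, ∃ i, U.orderEmbOfFin hU i = α a := fun a => by
    rw [← Set.mem_range, Finset.range_orderEmbOfFin]
    exact hα a
  choose α' hα' using mem_range
  exact ⟨⟨α', fun a b h => α.injective (by rw [← hα', ← hα', h])⟩, DFunLike.ext _ _ hα'⟩

theorem exists_trans_eq_of_overlap (hk : k = min (l + m - 1) N) {α : Fin l ↪ Fin N}
    {β : Fin m ↪ Fin N} (overlap : ∃ a c, α a = β c) :
    ∃ (γ : Fin k ↪ Fin N) (α' : Fin l ↪ Fin k) (β' : Fin m ↪ Fin k),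
      α'.trans γ = α ∧ β'.trans γ = β := by
  classical
  let U := Finset.univ.map α ∪ Finset.univ.map β
  have card_add_card : U.card + (Finset.univ.map α ∩ Finset.univ.map β).card = l + m := by
    simp [U, Finset.card_union_add_card_inter]
  have inter_card_pos : 0 < (Finset.univ.map α ∩ Finset.univ.map β).card := by
    obtain ⟨a, c, h⟩ := overlap
    exact Finset.card_pos.2 ⟨α a, Finset.mem_inter.2 ⟨by simp, by simp [h]⟩⟩
  have card_le : U.card ≤ N := by simpa using Finset.card_le_univ U
  obtain ⟨V, subset, card_eq⟩ := Finset.exists_superset_card_eq (s := U) (n := k) (by omega)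
    (by rw [Fintype.card_fin]; omega)
  obtain ⟨α', hα'⟩ := exists_trans_eq card_eq (α := α) fun a => subset (by simp [U])
  obtain ⟨β', hβ'⟩ := exists_trans_eq card_eq (α := β) fun a => subset (by simp [U])
  exact ⟨_, α', β', hα', hβ'⟩

theorem actOn_lie (γ : Fin k ↪ Fin N) (α : Fin l ↪ Fin k) (β : Fin m ↪ Fin k)
    (A : 𝓢(Conf d l, ℂ) →L[ℂ] 𝓢(Conf d l, ℂ)) (B : 𝓢(Conf d m, ℂ) →L[ℂ] 𝓢(Conf d m, ℂ)) :
    actOn γ ⁅actOn α A, actOn β B⁆ = ⁅actOn (α.trans γ) A, actOn (β.trans γ) B⁆ := by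
  simp only [Ring.lie_def, map_sub, map_mul, actOn_actOn]

theorem exists_average_eq_sum_perm_lie (hk : k = min (l + m - 1) N) (A : skewOps (Conf d l))
    (B : skewOps (Conf d m)) (α : Fin l ↪ Fin N) (β : Fin m ↪ Fin N) :
    ∃ D : skewOps (Conf d k), average N D.1 = (N.factorial : ℂ)⁻¹ • ∑ π : Equiv.Perm (Fin N),
      ⁅actOn (α.trans π.toEmbedding) A.1, actOn (β.trans π.toEmbedding) B.1⁆ := by
  by_cases overlap : ∃ a c, α a = β c
  · obtain ⟨γ, α', β', rfl, rfl⟩ := exists_trans_eq_of_overlap hk overlap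
    refine ⟨⟨⁅actOn α' A.1, actOn β' B.1⁆,
      lie_mem_skewOps (actOn_mem_skewOps α' A.2) (actOn_mem_skewOps β' B.2)⟩, ?_⟩
    simp only [average_eq_sum_perm γ, actOn_lie]
    rfl
  · push Not at overlap
    refine ⟨0, ?_⟩
    rw [Finset.sum_eq_zero fun π _ => lie_actOn_eq_zero (fun a c => ?_) A.2 B.2]
    · simp
    · exact π.injective.ne (overlap a c)

theorem exists_average_eq_sum_lie (hk : k = min (l + m - 1) N) (A : skewOps (Conf d l))
    (B : skewOps (Conf d m)) : ∃ D : skewOps (Conf d k), average N D.1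
      = ∑ α : Fin l ↪ Fin N, ∑ β : Fin m ↪ Fin N, ⁅actOn α A.1, actOn β B.1⁆ := by
  choose D hD using exists_average_eq_sum_perm_lie hk A B
  have reindex : ∀ π : Equiv.Perm (Fin N), ∑ α : Fin l ↪ Fin N, ∑ β : Fin m ↪ Fin N,
      ⁅actOn (α.trans π.toEmbedding) A.1, actOn (β.trans π.toEmbedding) B.1⁆
        = ∑ α : Fin l ↪ Fin N, ∑ β : Fin m ↪ Fin N, ⁅actOn α A.1, actOn β B.1⁆ := fun π =>
    Fintype.sum_equiv (Equiv.embeddingCongr (Equiv.refl _) π) _ _ fun α =>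
      Fintype.sum_equiv (Equiv.embeddingCongr (Equiv.refl _) π) _ _ fun β => rfl
  refine ⟨∑ α, ∑ β, D α β, ?_⟩
  simp only [AddSubmonoidClass.coe_finsetSum, map_sum, hD, ← Finset.smul_sum]
  rw [Finset.sum_congr rfl fun α _ => Finset.sum_comm, Finset.sum_comm,
    Finset.sum_congr rfl fun π _ => reindex π]
  simp [Fintype.card_perm, ← Nat.cast_smul_eq_nsmul ℂ, N.factorial_ne_zero]

theorem lie_average (A : 𝓢(Conf d l, ℂ) →L[ℂ] 𝓢(Conf d l, ℂ))
    (B : 𝓢(Conf d m, ℂ) →L[ℂ] 𝓢(Conf d m, ℂ)) :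
    ⁅average N A, average N B⁆ = ((N.descFactorial l : ℂ)⁻¹ * (N.descFactorial m : ℂ)⁻¹) •
      ∑ α : Fin l ↪ Fin N, ∑ β : Fin m ↪ Fin N, ⁅actOn α A, actOn β B⁆ := by
  simp only [average_eq, Ring.lie_def, smul_mul_smul_comm, Finset.sum_mul_sum,
    Finset.sum_sub_distrib, smul_sub]
  rw [mul_comm (N.descFactorial m : ℂ)⁻¹, Finset.sum_comm (f := fun β α => actOn β B * actOn α A)]

theorem exists_average_eq_smul_lie_average (hk : k = min (l + m - 1) N) (r : ℝ)
    (A : skewOps (Conf d l)) (B : skewOps (Conf d m)) :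
    ∃ D : skewOps (Conf d k), average N D.1 = r • ⁅average N A.1, average N B.1⁆ := by
  obtain ⟨D, hD⟩ := exists_average_eq_sum_lie hk A B
  refine ⟨(r * ((N.descFactorial l : ℝ)⁻¹ * (N.descFactorial m : ℝ)⁻¹)) • D, ?_⟩
  rw [Submodule.coe_smul, ← Complex.coe_smul, map_smul, hD, lie_average, ← Complex.coe_smul r,
    smul_smul]
  push_cast
  rfl

theorem exists_embed_eq_obsBracket (hk : k = min (l + m - 1) N) (A : Obs d l) (B : Obs d m) :
    ∃ C : Obs d k, embed N C = obsBracket (embed N A) (embed N B) := by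
  obtain ⟨D, hD⟩ := exists_average_eq_smul_lie_average hk (N : ℝ)
    ⟨fullOp A.1, fullOp_mem_skewOps A⟩ ⟨fullOp B.1, fullOp_mem_skewOps B⟩
  refine ⟨obsOfSkew D, ?_⟩
  ext1
  refine ContinuousLinearMap.ext fun f => Subtype.ext ?_
  rw [embed_obsOfSkew, obsOfSkew_apply, coe_symmetrize_of_mem (average_mem_symSchwartz _ f)]
  change average N D.1 f.1 = (N : ℝ) • (((embed N A).1 ((embed N B).1 f)).1
    - ((embed N B).1 ((embed N A).1 f)).1)
  rw [hD, coe_embed_apply, coe_embed_apply, coe_embed_apply, coe_embed_apply]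
  rfl

end Bracket

/-! ### Bounded sets of operators -/

section BoundedConvergence

variable {𝕜 X W : Type*} [RCLike 𝕜] [AddCommGroup X] [Module 𝕜 X] [TopologicalSpace X]
  [NormedAddCommGroup W] [NormedSpace 𝕜 W]

theorem tendsto_clm_nhds_zero {Y : Type*} {l : Filter Y} {S : Y → X →L[𝕜] W}
    (h : ∀ B, Bornology.IsVonNBounded 𝕜 B → ∀ ε > 0, ∀ᶠ p in l, ∀ f ∈ B, ‖S p f‖ ≤ ε) :
    Tendsto S l (𝓝 0) := by
  rw [(ContinuousLinearMap.hasBasis_nhds_zero_of_basis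
    (Metric.nhds_basis_closedBall (x := (0 : W)))).tendsto_right_iff]
  rintro ⟨B, ε⟩ ⟨hB, hε⟩
  filter_upwards [h B hB ε hε] with p hp f hf
  simpa using hp f hf

theorem isVonNBounded_clm_iff {S : Set (X →L[𝕜] W)} : Bornology.IsVonNBounded 𝕜 S ↔
    ∀ B, Bornology.IsVonNBounded 𝕜 B → ∃ C, ∀ u ∈ S, ∀ f ∈ B, ‖u f‖ ≤ C := by
  rw [ContinuousLinearMap.isVonNBounded_iff]
  simp only [NormedSpace.isVonNBounded_iff, isBounded_iff_forall_norm_le, Set.forall_mem_image2]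

variable [IsTopologicalAddGroup X] [ContinuousSMul 𝕜 X]

-- If `f n` is a sequence on which `S` is large, but `(n + 1) • f n` tends to zero, then `S` is
-- unbounded on the bounded set of all `(n + 1) • f n`.
theorem eventually_norm_apply_le_of_isVonNBounded [FirstCountableTopology X]
    {S : Set (X →L[𝕜] W)} (hS : Bornology.IsVonNBounded 𝕜 S) {ε : ℝ} (hε : 0 < ε) :
    ∀ᶠ f in 𝓝 (0 : X), ∀ u ∈ S, ‖u f‖ ≤ ε := by
  by_contra not_small
  obtain ⟨V, hV⟩ := (𝓝 (0 : X)).exists_antitone_basis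
  have large_on_small_multiple : ∀ n : ℕ, ∃ f : X, ((n + 1 : ℕ) : 𝕜) • f ∈ V n ∧
      ∃ u ∈ S, ε < ‖u f‖ := fun n => by
    have scaling : Tendsto (fun f : X => ((n + 1 : ℕ) : 𝕜) • f) (𝓝 0) (𝓝 0) :=
      (continuous_const_smul _).tendsto' _ _ (smul_zero _)
    obtain ⟨f, large, small⟩ :=
      ((not_eventually.1 not_small).and_eventually (scaling.eventually (hV.mem n))).exists
    push Not at large
    exact ⟨f, small, large⟩
  choose f hf u hu large using large_on_small_multiple
  have tendsto_zero : Tendsto (fun n : ℕ => ((n + 1 : ℕ) : 𝕜) • f n) atTop (𝓝 0) := hV.tendsto hf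
  obtain ⟨C, hC⟩ := isVonNBounded_clm_iff.1 hS _ (tendsto_zero.isVonNBounded_range 𝕜)
  obtain ⟨n, hn⟩ := exists_nat_gt (C / ε)
  refine absurd (hC (u n) (hu n) _ ⟨n, rfl⟩) (not_le.2 ?_)
  calc C < n * ε := (div_lt_iff₀ hε).1 hn
    _ ≤ (n + 1 : ℕ) * ‖u n (f n)‖ := by
      have := (large n).le
      gcongr
      exact n.le_succ
    _ = ‖u n (((n + 1 : ℕ) : 𝕜) • f n)‖ := by rw [map_smul, norm_smul, RCLike.norm_natCast]

end BoundedConvergence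

section SchwartzBounded

variable {E F V W : Type*} [NormedAddCommGroup E] [NormedSpace ℝ E] [NormedAddCommGroup F]
  [NormedSpace ℝ F] [NormedAddCommGroup V] [NormedSpace ℂ V] [NormedAddCommGroup W]
  [NormedSpace ℂ W]

theorem exists_seminorm_le_of_isVonNBounded {B : Set 𝓢(E, V)} (hB : Bornology.IsVonNBounded ℂ B)
    (k n : ℕ) : ∃ C, ∀ f ∈ B, SchwartzMap.seminorm ℂ k n f ≤ C := by
  obtain ⟨C, -, hC⟩ :=
    (schwartz_withSeminorms ℂ E V).isVonNBounded_iff_seminorm_bounded.1 hB (k, n)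
  exact ⟨C, fun f hf => (hC f hf).le⟩

theorem isVonNBounded_range_smul_sliceAt [FiniteDimensional ℝ F] (f : 𝓢(F × E, V)) (m : ℕ) :
    Bornology.IsVonNBounded ℂ (Set.range fun x : E => (‖x‖ ^ m : ℝ) • sliceAt x f) := fun U hU => by
  filter_upwards [absorbent_nhds_zero (𝕜 := ℂ) (eventually_smul_sliceAt_mem (E := E) m hU) f]
    with c hc
  obtain ⟨g, hg, hgf⟩ := Set.singleton_subset_iff.1 hc
  rintro _ ⟨x, rfl⟩
  refine ⟨_, hg x, ?_⟩
  simp only [← hgf, map_smul]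
  exact smul_comm _ _ _

variable [FiniteDimensional ℝ E] [FiniteDimensional ℝ F]

theorem tendsto_partialApply_right (f : 𝓢(F × E, V)) :
    Tendsto (fun u : 𝓢(F, V) →L[ℂ] W => partialApply f u) (𝓝 0) (𝓝 0) :=
  tendsto_partialApply fun D m ε hε => by
    filter_upwards [ContinuousLinearMap.eventually_nhds_zero_mapsTo (𝕜₁ := ℂ) (𝕜₂ := ℂ)
      (σ := RingHom.id ℂ) (isVonNBounded_range_smul_sliceAt (D f) m)
      (Metric.closedBall_mem_nhds (0 : W) hε)] with u hu x
    simpa [u.map_smul_of_tower, norm_smul] using hu ⟨x, rfl⟩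

theorem tendsto_partialApply_nhds_prod_principal {S : Set (𝓢(F, V) →L[ℂ] W)}
    (hS : Bornology.IsVonNBounded ℂ S) :
    Tendsto (fun p : 𝓢(F × E, V) × (𝓢(F, V) →L[ℂ] W) => partialApply p.1 p.2) (𝓝 0 ×ˢ 𝓟 S) (𝓝 0) :=
  tendsto_partialApply fun D m ε hε => by
    have small_slices := (D.continuous.tendsto' 0 0 (map_zero D)).eventually
      (eventually_smul_sliceAt_mem m (eventually_norm_apply_le_of_isVonNBounded hS hε))
    filter_upwards [small_slices.prod_mk (mem_principal_self S)] with p hp x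
    simpa [p.2.map_smul_of_tower, norm_smul] using hp.1 x p.2 hp.2

/-- The map sending `u` to the function `x ↦ u(f(·, x))`, as a continuous function of `u`. -/
def partialApplyRight (f : 𝓢(F × E, V)) : (𝓢(F, V) →L[ℂ] W) →L[ℂ] 𝓢(E, W) :=
  let L : (𝓢(F, V) →L[ℂ] W) →ₗ[ℂ] 𝓢(E, W) :=
    { toFun := partialApply f
      map_add' := fun u v => by ext x; simp
      map_smul' := fun c u => by ext x; simp }
  ⟨L, continuous_of_continuousAt_zero L <| by
    rw [ContinuousAt, map_zero]
    exact tendsto_partialApply_right f⟩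

variable (E F V W) in
/-- The map sending `f` and `u` to the function `x ↦ u(f(·, x))`, where the operators in the
target carry the topology of bounded convergence. -/
def partialApplyBilin : 𝓢(F × E, V) →L[ℂ] (𝓢(F, V) →L[ℂ] W) →L[ℂ] 𝓢(E, W) :=
  let L : 𝓢(F × E, V) →ₗ[ℂ] (𝓢(F, V) →L[ℂ] W) →L[ℂ] 𝓢(E, W) :=
    { toFun := partialApplyRight
      map_add' := fun f g => by ext u x; simp [partialApplyRight]
      map_smul' := fun c f => by ext u x; simp [partialApplyRight] }
  ⟨L, continuous_of_continuousAt_zero L <| by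
    rw [ContinuousAt, map_zero, ContinuousLinearMap.hasBasis_nhds_zero.tendsto_right_iff]
    rintro ⟨S, U⟩ ⟨hS, hU⟩
    have uniformly := tendsto_partialApply_nhds_prod_principal (E := E) hS hU
    rw [Filter.mem_map, mem_prod_principal] at uniformly
    exact uniformly⟩

end SchwartzBounded

/-! ### Schwartz kernels -/

section Delta

variable {d k : ℕ}

theorem tendsto_slope_evalAt (x v : Conf d k) :
    Tendsto (fun t : ℝ => t⁻¹ • (evalAt (x + t • v) - evalAt x)) (𝓝[≠] 0)
      (𝓝 (evalAt x ∘L lineDerivOpCLM ℂ 𝓢(Conf d k, ℂ) v)) := by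
  rw [← tendsto_sub_nhds_zero_iff]
  refine tendsto_clm_nhds_zero fun B hB ε hε => ?_
  let D := lineDerivOpCLM ℂ 𝓢(Conf d k, ℂ) v
  obtain ⟨C, hC⟩ := exists_seminorm_le_of_isVonNBounded
    (hB.image (σ := RingHom.id ℂ) (D ∘L D)) 0 0
  have error_tendsto : Tendsto (fun t : ℝ => C * |t|) (𝓝[≠] 0) (𝓝 0) :=
    ((continuous_const.mul continuous_abs).tendsto' 0 0 (by simp)).mono_left nhdsWithin_le_nhds
  filter_upwards [error_tendsto.eventually (ge_mem_nhds hε), self_mem_nhdsWithin]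
    with t error_le (ht : t ≠ 0) f hf
  have taylor : ‖f (x + t • v) - f x - t • ∂_{v} f x‖ ≤ C * |t| ^ 2 :=
    norm_image_add_smul_sub_sub_smul_le (hasLineDerivAt_lineDerivOp f · v)
      (hasLineDerivAt_lineDerivOp (∂_{v} f) · v)
      fun s _ => (SchwartzMap.norm_le_seminorm ℂ _ _).trans (hC _ ⟨f, hf, rfl⟩)
  calc ‖t⁻¹ • (f (x + t • v) - f x) - ∂_{v} f x‖
      = |t|⁻¹ * ‖f (x + t • v) - f x - t • ∂_{v} f x‖ := by
        rw [← Real.norm_eq_abs, ← norm_inv, ← norm_smul, smul_sub _ _ (t • _), inv_smul_smul₀ ht]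
    _ ≤ |t|⁻¹ * (C * |t| ^ 2) := by gcongr
    _ = C * |t| := by field_simp
    _ ≤ ε := error_le

variable (d k) in
/-- Symmetrization of tempered distributions. -/
def symFunctional : (𝓢(Conf d k, ℂ) →L[ℂ] ℂ) →L[ℂ] SymTempered d k :=
  (ContinuousLinearMap.precomp ℂ ((SymSchwartz d k).subtypeL ∘L symmetrize d k)).codRestrict
    (SymTempered d k) fun u π f => by
      have symmetrize_perm : symmetrize d k (permSchwartz d π f) = symmetrize d k f := by
        ext x
        rw [symmetrize_apply, symmetrize_apply]
        congr 1
        exact Fintype.sum_equiv (Equiv.mulRight π) _ _ fun σ => rfl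
      exact congrArg (fun g : SymSchwartz d k => u g.1) symmetrize_perm

theorem symFunctional_apply (u : 𝓢(Conf d k, ℂ) →L[ℂ] ℂ) (f : 𝓢(Conf d k, ℂ)) :
    (symFunctional d k u).1 f = u (symmetrize d k f).1 := rfl

theorem symFunctional_evalAt (x : Conf d k) : symFunctional d k (evalAt x) = symDelta x := by
  ext f
  rw [symFunctional_apply, evalAt_apply, symmetrize_apply]
  simp [symDelta]

theorem symDelta_apply (x : Conf d k) (f : 𝓢(Conf d k, ℂ)) :
    (symDelta x).1 f = (symmetrize d k f).1 x := by
  rw [← symFunctional_evalAt, symFunctional_apply, evalAt_apply]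

theorem symDelta_comp_perm (π : Equiv.Perm (Fin k)) (x : Conf d k) :
    symDelta (x ∘ π) = symDelta x := by
  ext f
  rw [symDelta_apply, symDelta_apply, (symmetrize d k f).2]

/-- The functions `x' ↦ (T ↦ T (δ_{x'} ∘ D))`; the operators `D` make this set closed under
derivatives. -/
def deltaFamily (d k : ℕ) :
    Set (Conf d k → (SymTempered d k →L[ℂ] 𝓢(Conf d k, ℂ)) →ₗ[ℂ] 𝓢(Conf d k, ℂ)) :=
  {θ | ∃ D : 𝓢(Conf d k, ℂ) →L[ℂ] 𝓢(Conf d k, ℂ),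
    θ = fun x => LinearMap.applyₗ (symFunctional d k (evalAt x ∘L D)) ∘ₗ
      ContinuousLinearMap.coeLM ℂ}

theorem isVonNBounded_range_smul_evalAt (D : 𝓢(Conf d k, ℂ) →L[ℂ] 𝓢(Conf d k, ℂ)) (m : ℕ) :
    Bornology.IsVonNBounded ℂ (Set.range fun x => ((‖x‖ ^ m : ℝ) : ℂ) • evalAt x ∘L D) := by
  refine isVonNBounded_clm_iff.2 fun B hB => ?_
  obtain ⟨C, hC⟩ := exists_seminorm_le_of_isVonNBounded (hB.image (σ := RingHom.id ℂ) D) m 0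
  refine ⟨C, ?_⟩
  rintro _ ⟨x, rfl⟩ f hf
  simpa using (SchwartzMap.norm_pow_mul_le_seminorm ℂ (D f) m x).trans (hC _ ⟨f, hf, rfl⟩)

theorem isVectorSchwartzFamily_deltaFamily (d k : ℕ) :
    IsVectorSchwartzFamily (Module.finBasis ℝ (Conf d k)) (deltaFamily d k) := by
  constructor
  · rintro θ ⟨D, rfl⟩ i
    set v := Module.finBasis ℝ (Conf d k) i
    refine ⟨_, ⟨lineDerivOpCLM ℂ 𝓢(Conf d k, ℂ) v ∘L D, rfl⟩, fun T x => ?_⟩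
    let L : (𝓢(Conf d k, ℂ) →L[ℂ] ℂ) →L[ℂ] 𝓢(Conf d k, ℂ) :=
      T ∘L symFunctional d k ∘L ContinuousLinearMap.precomp ℂ D
    refine ((L.continuous.tendsto _).comp (tendsto_slope_evalAt x v)).congr fun t => ?_
    rw [Function.comp_apply, L.map_smul_of_tower, map_sub]
    rfl
  · rintro θ ⟨D, rfl⟩ m U hU
    filter_upwards [ContinuousLinearMap.eventually_nhds_zero_mapsTo
      ((isVonNBounded_range_smul_evalAt D m).image (symFunctional d k)) hU] with T hT x
    have h := hT ⟨_, ⟨x, rfl⟩, rfl⟩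
    rw [map_smul, map_smul] at h
    exact h

/-- The Schwartz kernel of an operator from distributions to functions, as a Schwartz function. -/
def kernelCLM (d k : ℕ) :
    (SymTempered d k →L[ℂ] 𝓢(Conf d k, ℂ)) →L[ℂ] 𝓢(Conf d k × Conf d k, ℂ) :=
  (isVectorSchwartzFamily_deltaFamily d k).uncurryCLM ⟨ContinuousLinearMap.id ℂ _, rfl⟩

/-- The kernel of a density matrix, as a Schwartz function. -/
def dmKernel (Ψ : SymTempered d k →L[ℂ] SymSchwartz d k) : 𝓢(Conf d k × Conf d k, ℂ) :=
  kernelCLM d k ((SymSchwartz d k).subtypeL ∘L Ψ)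

theorem dmKernel_apply (Ψ : SymTempered d k →L[ℂ] SymSchwartz d k) (x x' : Conf d k) :
    dmKernel Ψ (x, x') = kernel Ψ x x' := by
  rw [kernel, ← symFunctional_evalAt]
  rfl

variable (d k) in
/-- The operator with a given kernel, as a continuous function of the kernel. -/
def ofKernel : 𝓢(Conf d k × Conf d k, ℂ) →L[ℂ] SymTempered d k →L[ℂ] SymSchwartz d k :=
  ContinuousLinearMap.postcomp _ (symmetrize d k) ∘L
    ContinuousLinearMap.precomp _ (SymTempered d k).subtypeL ∘L
      partialApplyBilin (Conf d k) (Conf d k) ℂ ℂ ∘L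
        SchwartzMap.compCLMOfContinuousLinearEquiv ℂ
          (ContinuousLinearEquiv.prodComm ℝ (Conf d k) (Conf d k))

/-- The function `K(x, ·)`. -/
def kernelRow (K : 𝓢(Conf d k × Conf d k, ℂ)) (x : Conf d k) : 𝓢(Conf d k, ℂ) :=
  sliceAt x (SchwartzMap.compCLMOfContinuousLinearEquiv ℂ
    (ContinuousLinearEquiv.prodComm ℝ (Conf d k) (Conf d k)) K)

theorem ofKernel_apply {K : 𝓢(Conf d k × Conf d k, ℂ)}
    (hK : ∀ (π : Equiv.Perm (Fin k)) x x', K (x ∘ π, x') = K (x, x')) (u : SymTempered d k)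
    (x : Conf d k) : (ofKernel d k K u).1 x = u.1 (kernelRow K x) := by
  let f := partialApply (SchwartzMap.compCLMOfContinuousLinearEquiv ℂ
    (ContinuousLinearEquiv.prodComm ℝ (Conf d k) (Conf d k)) K) u.1
  have f_apply : ∀ y, f y = u.1 (kernelRow K y) := fun y => rfl
  have symmetric : f ∈ SymSchwartz d k := fun π y => by
    rw [f_apply, f_apply]
    congr 1
    exact SchwartzMap.ext fun x' => hK π y x'
  exact DFunLike.congr_fun (coe_symmetrize_of_mem symmetric) x

theorem hasKernel_ofKernel {K : 𝓢(Conf d k × Conf d k, ℂ)}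
    (hK : ∀ (π : Equiv.Perm (Fin k)) x x', K (x ∘ π, x') = K (x, x')) :
    HasKernel (ofKernel d k K) fun x x' => K (x, x') := fun x =>
  ⟨kernelRow K x, fun _ => rfl, fun u => ofKernel_apply hK u x⟩

theorem HasKernel.unique {γ γ' : SymTempered d k →L[ℂ] SymSchwartz d k}
    {K : Conf d k → Conf d k → ℂ} (h : HasKernel γ K) (h' : HasKernel γ' K) : γ = γ' := by
  ext u x
  obtain ⟨κ, hκ, hu⟩ := h x
  obtain ⟨κ', hκ', hu'⟩ := h' x
  have : κ = κ' := by ext x'; rw [hκ, hκ']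
  rw [hu, hu', this]

theorem HasKernel.kernel_eq {γ : SymTempered d k →L[ℂ] SymSchwartz d k}
    {K : Conf d k → Conf d k → ℂ} (h : HasKernel γ K)
    (hK : ∀ (π : Equiv.Perm (Fin k)) x x', K x (x' ∘ π) = K x x') (x x' : Conf d k) :
    kernel γ x x' = K x x' := by
  obtain ⟨κ, hκ, hu⟩ := h x
  have symmetric : κ ∈ SymSchwartz d k := fun π y => by rw [hκ, hκ, hK]
  rw [kernel, hu, symDelta_apply, coe_symmetrize_of_mem symmetric, hκ]

theorem HasKernel.apply_toTempered {γ : SymTempered d k →L[ℂ] SymSchwartz d k}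
    {K : Conf d k → Conf d k → ℂ} (h : HasKernel γ K) (g : SymSchwartz d k) (x : Conf d k) :
    (γ (toTempered g)).1 x = ∫ x', g.1 x' * K x x' := by
  obtain ⟨κ, hκ, hu⟩ := h x
  rw [hu, toTempered_apply]
  simp only [hκ]

theorem integrable_conj_mul_mul {E F : Type*} [NormedAddCommGroup E] [NormedSpace ℝ E]
    [NormedAddCommGroup F] [NormedSpace ℝ F] [MeasurableSpace (E × F)] [BorelSpace (E × F)]
    [SecondCountableTopology (E × F)] {μ : Measure (E × F)} [μ.HasTemperateGrowth]
    (f : 𝓢(E, ℂ)) (g : 𝓢(F, ℂ)) (K : 𝓢(E × F, ℂ)) :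
    Integrable (fun p => (starRingEnd ℂ) (f p.1) * (g p.2 * K p)) μ := by
  refine ((K.integrable (μ := μ)).bdd_mul (c := SchwartzMap.seminorm ℂ 0 0 g)
    ?_ (Eventually.of_forall fun p => g.norm_le_seminorm ℂ p.2)).bdd_mul
    (c := SchwartzMap.seminorm ℂ 0 0 f) ?_ (Eventually.of_forall fun p => ?_)
  · exact (g.continuous.comp continuous_snd).aestronglyMeasurable
  · exact (Complex.continuous_conj.comp (f.continuous.comp continuous_fst)).aestronglyMeasurable
  · simpa using f.norm_le_seminorm ℂ p.1

theorem HasKernel.mem_DM {K : 𝓢(Conf d k × Conf d k, ℂ)}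
    {γ : SymTempered d k →L[ℂ] SymSchwartz d k} (h : HasKernel γ fun x x' => K (x, x'))
    (hermitian : ∀ x x', (starRingEnd ℂ) (K (x', x)) = K (x, x')) : γ ∈ DM d k := fun f g => by
  calc ip f (γ (toTempered g))
      = ∫ x, ∫ x', (starRingEnd ℂ) (f.1 x) * (g.1 x' * K (x, x')) := by
        simp only [ip, h.apply_toTempered, integral_const_mul]
    _ = ∫ x', ∫ x, (starRingEnd ℂ) (f.1 x) * (g.1 x' * K (x, x')) :=
        integral_integral_swap (integrable_conj_mul_mul (μ := volume) f.1 g.1 K)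
    _ = ip (γ (toTempered f)) g := by
        simp only [ip, h.apply_toTempered, ← integral_conj, ← integral_mul_const, map_mul,
          hermitian]
        congr with x
        congr with x'
        ring

end Delta

/-! ### Hermitian kernels -/

section Hermitian

open scoped ComplexConjugate

variable {d k : ℕ}

theorem symTempered_apply_symmetrize (u : SymTempered d k) (φ : 𝓢(Conf d k, ℂ)) :
    u.1 (symmetrize d k φ).1 = u.1 φ := by
  simp only [coe_symmetrize, map_smul, map_sum, u.2 _ φ, inv_factorial_mul_sum_perm_const,
    smul_eq_mul]

/-- The functional `φ ↦ ∫ conj b φ` attached to a Schwartz function `b`. -/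
def l2InnerCLM (b : 𝓢(Conf d k, ℂ)) : 𝓢(Conf d k, ℂ) →L[ℂ] ℂ :=
  innerSL ℂ (toLpCLM ℂ ℂ 2 volume b) ∘L toLpCLM ℂ ℂ 2 volume

theorem l2InnerCLM_apply (b φ : 𝓢(Conf d k, ℂ)) : l2InnerCLM b φ = l2Inner b φ :=
  (l2Inner_eq_inner b φ).symm

theorem toTempered_apply_of_real {f : SymSchwartz d k} (real : ∀ y, conj (f.1 y) = f.1 y)
    (g : SymSchwartz d k) : (toTempered f).1 g.1 = ip f g := by
  rw [toTempered_apply]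
  simp only [ip, real]

theorem conj_symmetrize {b : 𝓢(Conf d k, ℂ)} (real : ∀ y, conj (b y) = b y) (y : Conf d k) :
    conj ((symmetrize d k b).1 y) = (symmetrize d k b).1 y := by
  simp [symmetrize_apply, real]

theorem toTempered_symmetrize {b : 𝓢(Conf d k, ℂ)} (real : ∀ y, conj (b y) = b y) :
    toTempered (symmetrize d k b) = symFunctional d k (l2InnerCLM b) := by
  ext φ
  rw [← symTempered_apply_symmetrize, toTempered_apply_of_real (conj_symmetrize real),
    symFunctional_apply, l2InnerCLM_apply, l2Inner_coe]

/-- A smooth probability density concentrated near `x`. -/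
def approxDelta (β : ContDiffBump (0 : Conf d k)) (x : Conf d k) : 𝓢(Conf d k, ℂ) :=
  HasCompactSupport.toSchwartzMap (f := fun y => ((β.normed volume (x - y) : ℝ) : ℂ))
    ((β.hasCompactSupport_normed.comp_homeomorph (Homeomorph.subLeft x)).comp_left
      Complex.ofReal_zero)
    (Complex.ofRealCLM.contDiff.comp (β.contDiff_normed.comp (contDiff_const.sub contDiff_id)))

theorem conj_approxDelta (β : ContDiffBump (0 : Conf d k)) (x y : Conf d k) :
    conj (approxDelta β x y) = approxDelta β x y := Complex.conj_ofReal _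

theorem dist_l2Inner_approxDelta_le (β : ContDiffBump (0 : Conf d k)) (x : Conf d k)
    {f : 𝓢(Conf d k, ℂ)} {C : ℝ} (hC : SchwartzMap.seminorm ℂ 0 1 f ≤ C) :
    dist (l2Inner (approxDelta β x) f) (f x) ≤ C * β.rOut := by
  have fderiv_le : ∀ y, ‖fderiv ℝ f y‖ ≤ C := fun y => by
    rw [← norm_iteratedFDeriv_one]
    exact (SchwartzMap.norm_iteratedFDeriv_le_seminorm ℂ f 1 y).trans hC
  have lipschitz : ∀ y, dist (f y) (f x) ≤ C * dist y x := fun y => by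
    rw [dist_eq_norm, dist_eq_norm]
    exact convex_univ.norm_image_sub_le_of_norm_fderiv_le (fun y _ => f.differentiableAt)
      (fun y _ => fderiv_le y) (Set.mem_univ x) (Set.mem_univ y)
  have l2Inner_eq : l2Inner (approxDelta β x) f
      = convolution (β.normed volume) f (ContinuousLinearMap.lsmul ℝ ℝ) volume x := by
    have := Pi.isNegInvariant_volume (ι := Fin k) (α := EuclideanSpace ℝ (Fin d))
    rw [convolution_eq_swap, l2Inner]
    simp only [conj_approxDelta]
    rfl
  rw [l2Inner_eq]
  refine ContDiffBump.dist_normed_convolution_le f.continuous.aestronglyMeasurable fun y hy => ?_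
  exact (lipschitz y).trans (mul_le_mul_of_nonneg_left (Metric.mem_ball.1 hy).le
    ((norm_nonneg _).trans (fderiv_le x)))

theorem tendsto_l2InnerCLM_approxDelta {β : ℕ → ContDiffBump (0 : Conf d k)}
    (hβ : Tendsto (fun n => (β n).rOut) atTop (𝓝 0)) (x : Conf d k) :
    Tendsto (fun n => l2InnerCLM (approxDelta (β n) x)) atTop (𝓝 (evalAt x)) := by
  rw [← tendsto_sub_nhds_zero_iff]
  refine tendsto_clm_nhds_zero fun B hB ε hε => ?_
  obtain ⟨C, hC⟩ := exists_seminorm_le_of_isVonNBounded hB 0 1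
  have error_tendsto : Tendsto (fun n => C * (β n).rOut) atTop (𝓝 0) := by
    simpa using hβ.const_mul C
  filter_upwards [error_tendsto.eventually (ge_mem_nhds hε)] with n hn f hf
  rw [sub_apply, l2InnerCLM_apply, evalAt_apply, ← dist_eq_norm]
  exact (dist_l2Inner_approxDelta_le (β n) x (hC f hf)).trans hn

variable (d k) in
/-- The real-valued bosonic Schwartz functions, as tempered distributions. -/
def realFunctions : Set (SymTempered d k) :=
  {u | ∃ s : SymSchwartz d k, (∀ y, conj (s.1 y) = s.1 y) ∧ toTempered s = u}

theorem symDelta_mem_closure_realFunctions (x : Conf d k) :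
    symDelta x ∈ closure (realFunctions d k) := by
  let β : ℕ → ContDiffBump (0 : Conf d k) := fun n =>
    ⟨1 / (n + 1) / 2, 1 / (n + 1), by positivity, half_lt_self (by positivity)⟩
  rw [← symFunctional_evalAt]
  refine mem_closure_of_tendsto (((symFunctional d k).continuous.tendsto _).comp
    (tendsto_l2InnerCLM_approxDelta (β := β) tendsto_one_div_add_atTop_nhds_zero_nat x))
    (Eventually.of_forall fun n => ?_)
  exact ⟨symmetrize d k (approxDelta (β n) x), conj_symmetrize (conj_approxDelta (β n) x),
    toTempered_symmetrize (conj_approxDelta (β n) x)⟩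

theorem continuous_symTempered_apply (f : 𝓢(Conf d k, ℂ)) :
    Continuous fun u : SymTempered d k => u.1 f :=
  (continuous_eval_const f).comp continuous_subtype_val

theorem continuous_apply_coe (Ψ : SymTempered d k →L[ℂ] SymSchwartz d k) (v : SymTempered d k) :
    Continuous fun u : SymTempered d k => v.1 (Ψ u).1 :=
  v.1.continuous.comp (continuous_subtype_val.comp Ψ.continuous)

theorem apply_eq_conj_of_mem_closure (Ψ : DM d k) {u v : SymTempered d k}
    (hu : u ∈ closure (realFunctions d k)) (hv : v ∈ closure (realFunctions d k)) :
    u.1 (Ψ.1 v).1 = conj (v.1 (Ψ.1 u).1) := by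
  refine closure_minimal (t := {u | u.1 (Ψ.1 v).1 = conj (v.1 (Ψ.1 u).1)}) ?_
    (isClosed_eq (continuous_symTempered_apply _)
      (Complex.continuous_conj.comp (continuous_apply_coe Ψ.1 v))) hu
  rintro _ ⟨f, hf, rfl⟩
  refine closure_minimal
    (t := {v | (toTempered f).1 (Ψ.1 v).1 = conj (v.1 (Ψ.1 (toTempered f)).1)}) ?_
    (isClosed_eq (continuous_apply_coe Ψ.1 _)
      (Complex.continuous_conj.comp (continuous_symTempered_apply _))) hv
  rintro _ ⟨g, hg, rfl⟩
  change (toTempered f).1 (Ψ.1 (toTempered g)).1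
    = conj ((toTempered g).1 (Ψ.1 (toTempered f)).1)
  rw [toTempered_apply_of_real hf, toTempered_apply_of_real hg, ip_conj]
  exact Ψ.2 f g

theorem conj_kernel (Ψ : DM d k) (x x' : Conf d k) :
    conj (kernel Ψ.1 x' x) = kernel Ψ.1 x x' := by
  have h := apply_eq_conj_of_mem_closure Ψ (symDelta_mem_closure_realFunctions x)
    (symDelta_mem_closure_realFunctions x')
  rw [symDelta_apply, symDelta_apply, symmetrize_coe, symmetrize_coe] at h
  exact h.symm

theorem kernel_comp_perm_left (Ψ : SymTempered d k →L[ℂ] SymSchwartz d k) (π : Equiv.Perm (Fin k))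
    (x x' : Conf d k) : kernel Ψ (x ∘ π) x' = kernel Ψ x x' := (Ψ (symDelta x')).2 π x

theorem kernel_comp_perm_right (Ψ : SymTempered d k →L[ℂ] SymSchwartz d k)
    (π : Equiv.Perm (Fin k)) (x x' : Conf d k) : kernel Ψ x (x' ∘ π) = kernel Ψ x x' := by
  rw [kernel, kernel, symDelta_comp_perm]

end Hermitian

/-! ### Partial traces -/

section Marginal

variable {E F : Type*} [NormedAddCommGroup E] [NormedSpace ℝ E] [FiniteDimensional ℝ E]
  [MeasureSpace E] [BorelSpace E] [(volume : Measure E).HasTemperateGrowth]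
  [NormedAddCommGroup F] [NormedSpace ℝ F] [FiniteDimensional ℝ F]

variable (E F) in
/-- Integration over the second variable. -/
def marginal : 𝓢(F × E, ℂ) →L[ℂ] 𝓢(F, ℂ) :=
  partialApplyCLM (integralCLM ℂ volume) ∘L
    compCLMOfContinuousLinearEquiv ℂ (ContinuousLinearEquiv.prodComm ℝ E F)

@[simp] theorem marginal_apply (K : 𝓢(F × E, ℂ)) (w : F) : marginal E F K w = ∫ y, K (w, y) := by
  rw [marginal, ContinuousLinearMap.comp_apply, partialApplyCLM_apply, integralCLM_apply]
  rfl

variable [MeasureSpace F] [BorelSpace F] [SFinite (volume : Measure E)]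
  [SFinite (volume : Measure F)] [(volume : Measure (F × E)).HasTemperateGrowth]

theorem integral_marginal (K : 𝓢(F × E, ℂ)) : ∫ w, marginal E F K w = ∫ p, K p := by
  simp only [marginal_apply]
  exact (integral_prod _ K.integrable).symm

theorem l2Inner_marginal (g : 𝓢(F, ℂ)) (K : 𝓢(F × E, ℂ)) :
    l2Inner g (marginal E F K) = ∫ y, l2Inner g (sliceAt y K) := by
  have integrable : Integrable fun p : F × E => (starRingEnd ℂ) (g p.1) * K p :=
    (K.integrable (μ := volume)).bdd_mul (c := SchwartzMap.seminorm ℂ 0 0 g)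
      (Complex.continuous_conj.comp (g.continuous.comp continuous_fst)).aestronglyMeasurable
      (Eventually.of_forall fun p => by simpa using g.norm_le_seminorm ℂ p.1)
  simp only [l2Inner, marginal_apply, sliceAt_apply, ← integral_const_mul]
  exact integral_integral_swap integrable

theorem marginal_ampl [(volume : Measure F).HasTemperateGrowth]
    [(volume : Measure F).IsOpenPosMeasure] {B : 𝓢(F, ℂ) →L[ℂ] 𝓢(F, ℂ)} (hB : B ∈ skewOps F)
    (K : 𝓢(F × E, ℂ)) : marginal E F (ampl B K) = B (marginal E F K) := by
  have sliceAt_ampl : ∀ y, sliceAt y (ampl B K) = B (sliceAt y K) := fun y => rfl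
  have l2Inner_eq : ∀ g, l2Inner g (marginal E F (ampl B K)) = l2Inner g (B (marginal E F K)) :=
    fun g => by
      rw [hB, l2Inner_marginal, l2Inner_marginal, ← integral_neg]
      simp only [sliceAt_ampl, hB g]
  rw [← sub_eq_zero, ← l2Inner_self_eq_zero, l2Inner_sub_right, l2Inner_eq, sub_self]

end Marginal

section PartialTrace

variable {d k N : ℕ}

@[simp] theorem glue_castLE (h : k ≤ N) (z : Conf d k) (y : Conf d (N - k)) (a : Fin k) :
    glue z y (Fin.castLE h a) = z a := by
  simp [glue]

theorem splitEquiv_symm_apply (h : k ≤ N) (p : Conf d k × Conf d (N - k)) :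
    (splitEquiv _ (glueEquiv h)).symm p = glue p.1 p.2 := by
  rw [ContinuousLinearEquiv.symm_apply_eq, splitEquiv_apply]
  refine Prod.ext (funext fun a => ?_) (funext fun b => ?_)
  · simp
  · simp [glue, glueEquiv]

theorem integral_glue (h : k ≤ N) (f : Conf d N → ℂ) :
    ∫ p : Conf d k × Conf d (N - k), f (glue p.1 p.2) = ∫ x, f x := by
  rw [← (measurePreserving_splitEquiv (glueEquiv h)).integral_comp'
    (f := (splitEquiv _ (glueEquiv h)).toHomeomorph.toMeasurableEquiv)]
  refine congrArg _ (funext fun x => congrArg f ?_)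
  exact (splitEquiv_symm_apply h _).symm.trans (ContinuousLinearEquiv.symm_apply_apply _ x)

/-- The map `((z, z'), y) ↦ ((z, y), (z', y))`. -/
def glueDiag (d : ℕ) {k N : ℕ} (h : k ≤ N) :
    (Conf d k × Conf d k) × Conf d (N - k) →L[ℝ] Conf d N × Conf d N :=
  let glueCLM := (splitEquiv (EuclideanSpace ℝ (Fin d)) (glueEquiv h)).symm.toContinuousLinearMap
  (glueCLM ∘L (ContinuousLinearMap.fst ℝ _ _).prodMap (.id ℝ _)).prod
    (glueCLM ∘L (ContinuousLinearMap.snd ℝ _ _).prodMap (.id ℝ _))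

theorem glueDiag_apply (h : k ≤ N) (p : (Conf d k × Conf d k) × Conf d (N - k)) :
    glueDiag d h p = (glue p.1.1 p.2, glue p.1.2 p.2) :=
  Prod.ext (splitEquiv_symm_apply h _) (splitEquiv_symm_apply h _)

theorem exists_antilipschitz_glueDiag (d : ℕ) {k N : ℕ} (h : k ≤ N) :
    ∃ K, AntilipschitzWith K (glueDiag d h) := by
  have injective : Function.Injective (glueDiag d h) := fun p q hpq => by
    obtain ⟨hz, hy⟩ := Prod.ext_iff.1 ((splitEquiv _ _).symm.injective (congrArg Prod.fst hpq))
    obtain ⟨hz', -⟩ := Prod.ext_iff.1 ((splitEquiv _ _).symm.injective (congrArg Prod.snd hpq))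
    exact Prod.ext (Prod.ext hz hz') hy
  obtain ⟨K, -, hK⟩ := (glueDiag d h).toLinearMap.exists_antilipschitzWith
    (LinearMap.ker_eq_bot.2 injective)
  exact ⟨K, hK⟩

/-- The function `((z, z'), y) ↦ K((z, y), (z', y))`. -/
def glueDiagPull (d : ℕ) {k N : ℕ} (h : k ≤ N) :
    𝓢(Conf d N × Conf d N, ℂ) →L[ℂ] 𝓢((Conf d k × Conf d k) × Conf d (N - k), ℂ) :=
  compCLMOfAntilipschitz ℂ (glueDiag d h).hasTemperateGrowth
    (exists_antilipschitz_glueDiag d h).choose_spec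

theorem glueDiagPull_apply (h : k ≤ N) (K : 𝓢(Conf d N × Conf d N, ℂ))
    (p : (Conf d k × Conf d k) × Conf d (N - k)) :
    glueDiagPull d h K p = K (glue p.1.1 p.2, glue p.1.2 p.2) := congrArg K (glueDiag_apply h p)

/-- The partial trace of Schwartz kernels. -/
def ptrace (d : ℕ) {k N : ℕ} (h : k ≤ N) :
    𝓢(Conf d N × Conf d N, ℂ) →L[ℂ] 𝓢(Conf d k × Conf d k, ℂ) :=
  marginal _ _ ∘L glueDiagPull d h

theorem ptrace_apply (h : k ≤ N) (K : 𝓢(Conf d N × Conf d N, ℂ)) (z z' : Conf d k) :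
    ptrace d h K (z, z') = ∫ y, K (glue z y, glue z' y) := by
  rw [ptrace, ContinuousLinearMap.comp_apply, marginal_apply]
  simp only [glueDiagPull_apply]

theorem partialTraceKernel_eq (h : k ≤ N) (Ψ : SymTempered d N →L[ℂ] SymSchwartz d N) :
    partialTraceKernel k Ψ = fun z z' => ptrace d h (dmKernel Ψ) (z, z') := by
  funext z z'
  simp only [ptrace_apply, dmKernel_apply, partialTraceKernel]

theorem exists_glue_comp_perm (h : k ≤ N) (π : Equiv.Perm (Fin k)) :
    ∃ σ : Equiv.Perm (Fin N), ∀ (z : Conf d k) (y : Conf d (N - k)),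
      glue (z ∘ π) y = glue z y ∘ σ := by
  refine ⟨π.viaFintypeEmbedding (Fin.castLEEmb h), fun z y => funext fun i => ?_⟩
  rw [Function.comp_apply]
  by_cases hi : i.val < k
  · obtain ⟨a, rfl⟩ : ∃ a, Fin.castLEEmb h a = i := ⟨⟨i, hi⟩, rfl⟩
    rw [Equiv.Perm.viaFintypeEmbedding_apply_image]
    simp
  · rw [Equiv.Perm.viaFintypeEmbedding_apply_notMem_range]
    · simp [glue, hi]
    · rintro ⟨a, rfl⟩
      exact hi a.isLt

theorem partialTraceKernel_comp_perm_left (h : k ≤ N) (Ψ : SymTempered d N →L[ℂ] SymSchwartz d N)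
    (π : Equiv.Perm (Fin k)) (z z' : Conf d k) :
    partialTraceKernel k Ψ (z ∘ π) z' = partialTraceKernel k Ψ z z' := by
  obtain ⟨σ, hσ⟩ := exists_glue_comp_perm (d := d) h π
  simp only [partialTraceKernel, hσ, kernel_comp_perm_left]

theorem partialTraceKernel_comp_perm_right (h : k ≤ N) (Ψ : SymTempered d N →L[ℂ] SymSchwartz d N)
    (π : Equiv.Perm (Fin k)) (z z' : Conf d k) :
    partialTraceKernel k Ψ z (z' ∘ π) = partialTraceKernel k Ψ z z' := by
  obtain ⟨σ, hσ⟩ := exists_glue_comp_perm (d := d) h π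
  simp only [partialTraceKernel, hσ, kernel_comp_perm_right]

/-- The partial trace `Tr_{k+1,…,N}`, as a continuous linear function of the operator. -/
def reduce (d : ℕ) {k N : ℕ} (h : k ≤ N) :
    (SymTempered d N →L[ℂ] SymSchwartz d N) →L[ℂ] SymTempered d k →L[ℂ] SymSchwartz d k :=
  ofKernel d k ∘L ptrace d h ∘L kernelCLM d N ∘L
    ContinuousLinearMap.postcomp (SymTempered d N) (SymSchwartz d N).subtypeL

theorem hasKernel_reduce (h : k ≤ N) (Ψ : SymTempered d N →L[ℂ] SymSchwartz d N) :
    HasKernel (reduce d h Ψ) (partialTraceKernel k Ψ) := by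
  have symmetric := partialTraceKernel_comp_perm_left h Ψ
  rw [partialTraceKernel_eq h] at symmetric ⊢
  exact hasKernel_ofKernel symmetric

theorem reduce_mem_DM (h : k ≤ N) (Ψ : DM d N) : reduce d h Ψ.1 ∈ DM d k := by
  have hasKernel := hasKernel_reduce h Ψ.1
  rw [partialTraceKernel_eq h] at hasKernel
  refine hasKernel.mem_DM fun x x' => ?_
  simp only [ptrace_apply, dmKernel_apply, ← integral_conj, conj_kernel]

theorem kernel_reduce (h : k ≤ N) (Ψ : SymTempered d N →L[ℂ] SymSchwartz d N)
    (z z' : Conf d k) : kernel (reduce d h Ψ) z z' = ptrace d h (dmKernel Ψ) (z, z') := by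
  rw [(hasKernel_reduce h Ψ).kernel_eq (partialTraceKernel_comp_perm_right h Ψ),
    partialTraceKernel_eq h]

/-- The reduced density matrix map `ι_{RDM,N}`. -/
def rdmMap (d N : ℕ) : DM d N →L[ℝ] DMHier d N where
  toFun Ψ k := ⟨reduce d (Nat.succ_le_of_lt k.isLt) Ψ.1, reduce_mem_DM _ Ψ⟩
  map_add' Ψ Φ := funext fun _ => Subtype.ext ((reduce d _).map_add Ψ.1 Φ.1)
  map_smul' c Ψ := funext fun _ => Subtype.ext ((reduce d _).map_smul_of_tower c Ψ.1)
  cont := continuous_pi fun k =>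
    ((reduce d (Nat.succ_le_of_lt k.isLt)).continuous.comp continuous_subtype_val).subtype_mk _

theorem isRDMMap_rdmMap (d N : ℕ) : IsRDMMap ⇑(rdmMap d N) := fun Ψ _ => hasKernel_reduce _ Ψ.1

theorem IsRDMMap.eq_rdmMap {ι : DM d N → DMHier d N} (h : IsRDMMap ι) : ι = ⇑(rdmMap d N) :=
  funext fun Ψ => funext fun k => Subtype.ext ((h Ψ k).unique (isRDMMap_rdmMap d N Ψ k))

end PartialTrace

/-! ### Traces -/

section Trace

variable {d k N : ℕ}

/-- The restriction of Schwartz kernels to the diagonal. -/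
def diagCLM (d k : ℕ) : 𝓢(Conf d k × Conf d k, ℂ) →L[ℂ] 𝓢(Conf d k, ℂ) :=
  compCLMOfAntilipschitz ℂ (K := 1)
    ((ContinuousLinearMap.id ℝ (Conf d k)).prod (.id ℝ (Conf d k))).hasTemperateGrowth
    (AntilipschitzWith.of_le_mul_dist fun x y => by
      rw [NNReal.coe_one, one_mul]
      exact le_max_left (dist x y) (dist x y))

/-- The trace, as a continuous linear functional on operators whose values need not be bosonic. -/
def traceCLM (d k : ℕ) : (SymTempered d k →L[ℂ] 𝓢(Conf d k, ℂ)) →L[ℂ] ℂ :=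
  integralCLM ℂ (volume : Measure (Conf d k)) ∘L diagCLM d k ∘L kernelCLM d k

theorem traceCLM_apply (T : SymTempered d k →L[ℂ] 𝓢(Conf d k, ℂ)) :
    traceCLM d k T = ∫ x, kernelCLM d k T (x, x) := by
  rw [traceCLM, ContinuousLinearMap.comp_apply, integralCLM_apply]
  rfl

theorem kernelCLM_apply (T : SymTempered d k →L[ℂ] 𝓢(Conf d k, ℂ)) (x x' : Conf d k) :
    kernelCLM d k T (x, x') = T (symDelta x') x := by
  rw [← symFunctional_evalAt]
  rfl

theorem trace_eq_traceCLM (T : SymTempered d k →L[ℂ] SymSchwartz d k) :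
    trace T = traceCLM d k ((SymSchwartz d k).subtypeL ∘L T) := by
  simp only [traceCLM_apply, kernelCLM_apply, trace, kernel]
  rfl

theorem integral_ptrace_diag (h : k ≤ N) (K : 𝓢(Conf d N × Conf d N, ℂ)) :
    ∫ z, ptrace d h K (z, z) = ∫ x, K (x, x) := by
  let K' : 𝓢(Conf d k × Conf d (N - k), ℂ) :=
    compCLMOfContinuousLinearEquiv ℂ (splitEquiv _ (glueEquiv h)).symm (diagCLM d N K)
  have K'_apply : ∀ p, K' p = K (glue p.1 p.2, glue p.1 p.2) := fun p =>
    congrArg (diagCLM d N K) (splitEquiv_symm_apply h p)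
  calc ∫ z, ptrace d h K (z, z)
      = ∫ z, marginal _ _ K' z := by simp only [ptrace_apply, marginal_apply, K'_apply]
    _ = ∫ p, K' p := integral_marginal K'
    _ = ∫ x, K (x, x) := by
        simp only [K'_apply]
        exact integral_glue h fun x => K (x, x)

/-- The function `(w, y) ↦ K((w, y), (z, y))`. -/
def blockSlice (h : k ≤ N) (z : Conf d k) (K : 𝓢(Conf d N × Conf d N, ℂ)) :
    𝓢(Conf d k × Conf d (N - k), ℂ) :=
  sliceAt z (compCLMOfContinuousLinearEquiv ℂ
    ((ContinuousLinearEquiv.prodAssoc ℝ (Conf d k) (Conf d (N - k)) (Conf d k)).trans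
      (((ContinuousLinearEquiv.refl ℝ _).prodCongr (ContinuousLinearEquiv.prodComm ℝ _ _)).trans
        (ContinuousLinearEquiv.prodAssoc ℝ _ _ _).symm))
    (glueDiagPull d h K))

theorem blockSlice_apply (h : k ≤ N) (z : Conf d k) (K : 𝓢(Conf d N × Conf d N, ℂ))
    (p : Conf d k × Conf d (N - k)) : blockSlice h z K p = K (glue p.1 p.2, glue z p.2) :=
  glueDiagPull_apply h K ((p.1, z), p.2)

theorem sliceAt_ptrace (h : k ≤ N) (z : Conf d k) (K : 𝓢(Conf d N × Conf d N, ℂ)) :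
    sliceAt z (ptrace d h K) = marginal _ _ (blockSlice h z K) := by
  ext w
  simp only [sliceAt_apply, ptrace_apply, marginal_apply, blockSlice_apply]

theorem moveTo_glue (h : k ≤ N) (w z : Conf d k) (y : Conf d (N - k)) :
    moveTo (Fin.castLEEmb h) (glue w y) z = glue z y :=
  moveTo_eq (fun a => by simp) fun i hi => by
    have : ¬ i.val < k := fun hik => hi ⟨i, hik⟩ rfl
    simp [glue, this]

theorem blockSlice_actOn (h : k ≤ N) (B : 𝓢(Conf d k, ℂ) →L[ℂ] 𝓢(Conf d k, ℂ))
    (T : SymTempered d N →L[ℂ] 𝓢(Conf d N, ℂ)) (z : Conf d k) :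
    blockSlice h z (kernelCLM d N (actOn (Fin.castLEEmb h) B ∘L T))
      = ampl B (blockSlice h z (kernelCLM d N T)) := by
  ext ⟨w, y⟩
  have slice_eq : sliceCLM (Fin.castLEEmb h) (glue w y) (T (symDelta (glue z y)))
      = sliceAt y (blockSlice h z (kernelCLM d N T)) := by
    ext v
    rw [sliceCLM_apply, sliceAt_apply, blockSlice_apply, kernelCLM_apply, moveTo_glue]
  have comp_eq : glue w y ∘ Fin.castLEEmb h = w := funext fun a => by simp
  rw [blockSlice_apply, kernelCLM_apply, ContinuousLinearMap.comp_apply, actOn_apply, ampl_apply,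
    slice_eq, comp_eq]

theorem sliceAt_ptrace_actOn (h : k ≤ N) {B : 𝓢(Conf d k, ℂ) →L[ℂ] 𝓢(Conf d k, ℂ)}
    (hB : B ∈ skewOps (Conf d k)) (T : SymTempered d N →L[ℂ] 𝓢(Conf d N, ℂ)) (z : Conf d k) :
    sliceAt z (ptrace d h (kernelCLM d N (actOn (Fin.castLEEmb h) B ∘L T)))
      = B (sliceAt z (ptrace d h (kernelCLM d N T))) := by
  rw [sliceAt_ptrace, sliceAt_ptrace, blockSlice_actOn, marginal_ampl hB]

theorem traceCLM_actOn_castLE (h : k ≤ N) (A : Obs d k)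
    (Ψ : SymTempered d N →L[ℂ] SymSchwartz d N) :
    traceCLM d N (actOn (Fin.castLEEmb h) (fullOp A.1) ∘L (SymSchwartz d N).subtypeL ∘L Ψ)
      = trace (A.1 ∘L reduce d h Ψ) := by
  have coe_reduce : ∀ z, (reduce d h Ψ (symDelta z)).1 = sliceAt z (ptrace d h (dmKernel Ψ)) :=
    fun z => SchwartzMap.ext fun w => kernel_reduce h Ψ w z
  rw [traceCLM_apply, ← integral_ptrace_diag h, trace]
  refine integral_congr_ae (Eventually.of_forall fun z => ?_)
  have commute := sliceAt_ptrace_actOn h (fullOp_mem_skewOps A)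
    ((SymSchwartz d N).subtypeL ∘L Ψ) z
  calc _ = fullOp A.1 (sliceAt z (ptrace d h (dmKernel Ψ))) z := DFunLike.congr_fun commute z
    _ = kernel (A.1 ∘L reduce d h Ψ) z z := by
        rw [← coe_reduce, fullOp_apply, symmetrize_coe]
        rfl

theorem traceCLM_actOn_eq (j j' : Fin k ↪ Fin N) (B : 𝓢(Conf d k, ℂ) →L[ℂ] 𝓢(Conf d k, ℂ))
    (Ψ : SymTempered d N →L[ℂ] SymSchwartz d N) :
    traceCLM d N (actOn j B ∘L (SymSchwartz d N).subtypeL ∘L Ψ)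
      = traceCLM d N (actOn j' B ∘L (SymSchwartz d N).subtypeL ∘L Ψ) := by
  obtain ⟨σ, rfl⟩ := exists_perm_trans j j'
  have kernel_eq : ∀ i x, kernelCLM d N (actOn i B ∘L (SymSchwartz d N).subtypeL ∘L Ψ) (x, x)
      = actOn i B (Ψ (symDelta x)).1 x := fun _ _ => kernelCLM_apply _ _ _
  simp only [traceCLM_apply, kernel_eq, actOn_trans_perm]
  rw [← integral_comp_perm d σ]
  simp only [symDelta_comp_perm]

theorem trace_embed_comp (h : k ≤ N) (A : Obs d k) (Ψ : SymTempered d N →L[ℂ] SymSchwartz d N) :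
    trace ((embed N A).1 ∘L Ψ) = trace (A.1 ∘L reduce d h Ψ) := by
  have embed_comp : (SymSchwartz d N).subtypeL ∘L (embed N A).1 ∘L Ψ
      = (N.descFactorial k : ℂ)⁻¹ • ∑ j : Fin k ↪ Fin N,
          actOn j (fullOp A.1) ∘L (SymSchwartz d N).subtypeL ∘L Ψ := by
    ext u x
    simpa using (DFunLike.congr_fun (coe_embed_apply A (Ψ u)) x).trans (average_apply _ _ _)
  have descFactorial_ne_zero : (N.descFactorial k : ℂ) ≠ 0 :=
    Nat.cast_ne_zero.2 (Nat.descFactorial_eq_zero_iff_lt.not.2 h.not_gt)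
  rw [trace_eq_traceCLM, embed_comp, map_smul, map_sum]
  simp only [traceCLM_actOn_eq _ (Fin.castLEEmb h), traceCLM_actOn_castLE, Finset.sum_const,
    Finset.card_univ, Fintype.card_embedding_eq, Fintype.card_fin, nsmul_eq_mul, smul_eq_mul]
  exact inv_mul_cancel_left₀ descFactorial_ne_zero _

end Trace

/-! ### The pairings -/

section Pairing

variable {d k N : ℕ}

theorem obsPairing_add_left (A B : Obs d k) (Ψ : DM d k) :
    obsPairing (A + B) Ψ = obsPairing A Ψ + obsPairing B Ψ := by
  simp [obsPairing, trace_eq_traceCLM, ContinuousLinearMap.add_comp, ContinuousLinearMap.comp_add,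
    mul_add]

theorem obsPairing_smul_left (r : ℝ) (A : Obs d k) (Ψ : DM d k) :
    obsPairing (r • A) Ψ = r * obsPairing A Ψ := by
  have comp_smul : (SymSchwartz d k).subtypeL ∘L (r • A).1 ∘L Ψ.1
      = (r : ℂ) • ((SymSchwartz d k).subtypeL ∘L A.1 ∘L Ψ.1) := rfl
  simp only [obsPairing, trace_eq_traceCLM]
  rw [comp_smul, map_smul, smul_eq_mul, mul_left_comm, Complex.re_ofReal_mul]

/-- The functional `Ψ ↦ i Tr(AΨ)` on density matrices. -/
def obsPairingCLM (A : Obs d k) : DM d k →L[ℝ] ℝ :=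
  Complex.reCLM ∘L ((Complex.I • traceCLM d k) ∘L ContinuousLinearMap.postcomp
    (SymTempered d k) ((SymSchwartz d k).subtypeL ∘L A.1)).restrictScalars ℝ ∘L (DM d k).subtypeL

theorem obsPairingCLM_apply (A : Obs d k) (Ψ : DM d k) :
    obsPairingCLM A Ψ = obsPairing A Ψ := by
  rw [obsPairing, trace_eq_traceCLM]
  rfl

/-- The pairing of observables and density matrices as a bilinear map, continuous in the density
matrix. -/
def obsPairingBilin (d k : ℕ) : Obs d k →ₗ[ℝ] DM d k →L[ℝ] ℝ where
  toFun := obsPairingCLM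
  map_add' A B := ContinuousLinearMap.ext fun Ψ => by
    simpa only [obsPairingCLM_apply, add_apply] using obsPairing_add_left A B Ψ
  map_smul' r A := ContinuousLinearMap.ext fun Ψ => by
    simpa only [obsPairingCLM_apply, smul_apply, RingHom.id_apply, smul_eq_mul] using
      obsPairing_smul_left r A Ψ

theorem obsPairingBilin_apply (A : Obs d k) (Ψ : DM d k) :
    obsPairingBilin d k A Ψ = obsPairing A Ψ :=
  obsPairingCLM_apply A Ψ

/-- The pairing of hierarchies of observables and of density matrices as a bilinear map, continuous
in the density matrices. -/
def hierPairingBilin (d N : ℕ) : ObsHier d N →ₗ[ℝ] DMHier d N →L[ℝ] ℝ where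
  toFun A := ∑ k : Fin N, obsPairingBilin d (k.val + 1) (A k) ∘L ContinuousLinearMap.proj k
  map_add' A B := by
    ext Γ
    simp [Finset.sum_add_distrib]
  map_smul' r A := by
    ext Γ
    simp [Finset.mul_sum]

theorem hierPairingBilin_apply (A : ObsHier d N) (Γ : DMHier d N) :
    hierPairingBilin d N A Γ = hierPairing A Γ := by
  simp [hierPairingBilin, hierPairing, obsPairingBilin_apply]

theorem obsPairing_embed (h : k ≤ N) (A : Obs d k) (Ψ : DM d N) :
    obsPairing (embed N A) Ψ = obsPairing A ⟨reduce d h Ψ.1, reduce_mem_DM h Ψ⟩ := by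
  rw [obsPairing, trace_embed_comp h]
  rfl

theorem obsPairing_sumEmbed (A : ObsHier d N) (Ψ : DM d N) :
    obsPairing (sumEmbed A) Ψ = hierPairing A (rdmMap d N Ψ) := by
  let pairWith : Obs d N →+ ℝ :=
    AddMonoidHom.mk' (fun B => obsPairing B Ψ) fun B C => obsPairing_add_left B C Ψ
  exact (map_sum pairWith _ _).trans
    (Finset.sum_congr rfl fun k _ => obsPairing_embed (Nat.succ_le_of_lt k.isLt) (A k) Ψ)

/-- Complex conjugation of Schwartz functions. -/
def conjSchwartz (E : Type*) [NormedAddCommGroup E] [NormedSpace ℝ E] : 𝓢(E, ℂ) →L[ℝ] 𝓢(E, ℂ) :=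
  SchwartzMap.postcompCLM (𝕜 := ℝ) Complex.conjCLE.toContinuousLinearMap

theorem conjSchwartz_apply {E : Type*} [NormedAddCommGroup E] [NormedSpace ℝ E] (f : 𝓢(E, ℂ))
    (x : E) : conjSchwartz E f x = (starRingEnd ℂ) (f x) := rfl

theorem toTempered_conjSchwartz (f g : SymSchwartz d k) :
    (toTempered g).1 (conjSchwartz (Conf d k) f.1) = ip f g := by
  rw [toTempered_apply, ip]
  simp only [conjSchwartz_apply, mul_comm]

/-- Evaluation of bosonic tempered distributions at a Schwartz function. -/
def evalTempered (f : 𝓢(Conf d k, ℂ)) : SymTempered d k →L[ℂ] ℂ where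
  toFun u := u.1 f
  map_add' _ _ := rfl
  map_smul' _ _ := rfl
  cont := continuous_symTempered_apply f

/-- The rank one density matrix `|f⟩⟨f|`. -/
def rankOne (f : SymSchwartz d k) : DM d k :=
  ⟨(evalTempered (conjSchwartz (Conf d k) f.1)).smulRight f, fun g h => by
    change l2Inner g.1 ((toTempered h).1 (conjSchwartz _ f.1) • f.1)
      = l2Inner ((toTempered g).1 (conjSchwartz _ f.1) • f.1) h.1
    rw [toTempered_conjSchwartz, toTempered_conjSchwartz, l2Inner_smul_right, l2Inner_smul_left,
      ip_conj, mul_comm]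
    rfl⟩

theorem kernel_rankOne (A : SymSchwartz d k →L[ℂ] SymSchwartz d k) (f : SymSchwartz d k)
    (x y : Conf d k) :
    kernel (A ∘L (rankOne f).1) x y = (starRingEnd ℂ) (f.1 y) * (A f).1 x := by
  have conj_mem : conjSchwartz (Conf d k) f.1 ∈ SymSchwartz d k := fun σ z => by
    rw [conjSchwartz_apply, conjSchwartz_apply, f.2]
  change (A ((symDelta y).1 (conjSchwartz _ f.1) • f)).1 x = _
  rw [map_smul, symDelta_apply, coe_symmetrize_of_mem conj_mem]
  rfl

theorem trace_comp_rankOne (A : SymSchwartz d k →L[ℂ] SymSchwartz d k) (f : SymSchwartz d k) :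
    trace (A ∘L (rankOne f).1) = ip f (A f) := by
  simp only [trace, ip, kernel_rankOne]

theorem eq_zero_of_ip_self_eq_zero {A : SymSchwartz d k →L[ℂ] SymSchwartz d k}
    (h : ∀ f, ip f (A f) = 0) : A = 0 := by
  have polarized : ∀ f g, l2Inner f.1 (A g).1 + l2Inner g.1 (A f).1 = 0 := fun f g => by
    have expand : ip (f + g) (A f + A g) = 0 := map_add A f g ▸ h (f + g)
    rw [ip_add_right, ip_add_left, ip_add_left, h, h, zero_add, add_zero, add_comm] at expand
    exact expand
  ext1 g
  have rotated := polarized (A g) (Complex.I • g)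
  have A_smul : (A (Complex.I • g)).1 = Complex.I • (A g).1 := by rw [map_smul]; rfl
  have coe_smul : (Complex.I • g).1 = Complex.I • g.1 := rfl
  rw [A_smul, coe_smul, l2Inner_smul_right, l2Inner_smul_left, Complex.conj_I] at rotated
  have two_I_mul : 2 * Complex.I * l2Inner (A g).1 (A g).1 = 0 := by
    linear_combination rotated + Complex.I * polarized (A g) g
  exact Subtype.ext (l2Inner_self_eq_zero.1 (by simpa using two_I_mul))

theorem obsPairingBilin_injective (d k : ℕ) : Function.Injective (obsPairingBilin d k) := by
  refine (injective_iff_map_eq_zero _).2 fun A hA => Subtype.ext ?_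
  refine eq_zero_of_ip_self_eq_zero fun f => Complex.ext ?_ ?_
  · have skew := congrArg Complex.re (A.2 f f)
    rw [← ip_conj f, Complex.neg_re, Complex.conj_re] at skew
    exact self_eq_neg.1 skew
  · have pairing_eq_zero : obsPairingBilin d k A (rankOne f) = 0 := by rw [hA]; rfl
    rwa [obsPairingBilin_apply, obsPairing, trace_comp_rankOne, Complex.I_mul_re, neg_eq_zero]
      at pairing_eq_zero

end Pairing

/-! ### Lie–Poisson structures in duality -/

section Gateaux

variable {X Y : Type*} [AddCommGroup X] [Module ℝ X] [AddCommGroup Y] [Module ℝ Y]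
  [TopologicalSpace Y]

theorem hasGateauxDerivAt_linear (L : X →ₗ[ℝ] Y) (x v : X) :
    HasGateauxDerivAt (fun x => L x) x v (L v) := by
  refine tendsto_const_nhds.congr' ?_
  filter_upwards [self_mem_nhdsWithin] with t (ht : t ≠ 0)
  rw [← map_sub, add_sub_cancel_left, map_smul, inv_smul_smul₀ ht]

theorem hasGateauxDerivAt_const (c : Y) (x v : X) :
    HasGateauxDerivAt (fun _ : X => c) x v 0 := by
  simpa [HasGateauxDerivAt] using tendsto_const_nhds

theorem HasGateauxDerivAt.add [IsTopologicalAddGroup Y] {F G : X → Y} {x v : X} {a b : Y}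
    (hF : HasGateauxDerivAt F x v a) (hG : HasGateauxDerivAt G x v b) :
    HasGateauxDerivAt (F + G) x v (a + b) := by
  refine (Tendsto.add hF hG).congr fun t => ?_
  rw [Pi.add_apply, Pi.add_apply, ← smul_add, add_sub_add_comm]

theorem HasGateauxDerivAt.tendsto [IsTopologicalAddGroup Y] [ContinuousSMul ℝ Y] {F : X → Y}
    {x v : X} {a : Y} (hF : HasGateauxDerivAt F x v a) :
    Tendsto (fun t : ℝ => F (x + t • v)) (𝓝[≠] 0) (𝓝 (F x)) := by
  have tendsto_zero : Tendsto (fun t : ℝ => t) (𝓝[≠] 0) (𝓝 0) := nhdsWithin_le_nhds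
  have increment := (tendsto_zero.smul hF).add_const (F x)
  rw [zero_smul, zero_add] at increment
  refine increment.congr' ?_
  filter_upwards [self_mem_nhdsWithin] with t (ht : t ≠ 0)
  rw [smul_inv_smul₀ ht, sub_add_cancel]

theorem HasGateauxDerivAt.mul {F G : X → ℝ} {x v : X} {a b : ℝ} (hF : HasGateauxDerivAt F x v a)
    (hG : HasGateauxDerivAt G x v b) :
    HasGateauxDerivAt (F * G) x v (G x * a + F x * b) := by
  refine ((hG.tendsto.mul hF).add (hG.const_mul (F x))).congr fun t => ?_
  simp only [Pi.mul_apply, smul_eq_mul]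
  ring

theorem gateauxSmooth_clm [TopologicalSpace X] (L : X →L[ℝ] Y) : GateauxSmooth fun x => L x := by
  refine ⟨fun r => match r with
    | 0 => fun x _ => L x
    | 1 => fun _ v => L (v 0)
    | _ + 2 => fun _ _ => 0, fun x v => rfl, fun r => ?_, fun r x v w => ?_⟩
  · match r with
    | 0 => exact L.continuous.comp continuous_fst
    | 1 => exact L.continuous.comp ((continuous_apply 0).comp continuous_snd)
    | _ + 2 => exact continuous_const
  · match r with
    | 0 =>
      have snoc_zero : (Fin.snoc v w : Fin (0 + 1) → X) 0 = w :=
        Fin.snoc_last (α := fun _ => X) w v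
      change HasGateauxDerivAt (fun y => L y) x w (L ((Fin.snoc v w : Fin (0 + 1) → X) 0))
      rw [snoc_zero]
      exact hasGateauxDerivAt_linear (L : X →ₗ[ℝ] Y) x w
    | 1 => exact hasGateauxDerivAt_const _ x w
    | _ + 2 => exact hasGateauxDerivAt_const _ x w

end Gateaux

section LiePoisson

variable {L M : Type*} [AddCommGroup M] [Module ℝ M]

theorem IsFunctionalDeriv.functionalDeriv [Zero L] {p : L → M → ℝ} {F : M → ℝ} {m : M} {A : L}
    (h : IsFunctionalDeriv p F m A) : IsFunctionalDeriv p F m (functionalDeriv p F m) := by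
  have exists_deriv : ∃ A, IsFunctionalDeriv p F m A := ⟨A, h⟩
  rw [BosonicRDM.functionalDeriv, dif_pos exists_deriv]
  exact exists_deriv.choose_spec

variable [TopologicalSpace M] [AddCommMonoid L] [Module ℝ L] {p : L →ₗ[ℝ] M →L[ℝ] ℝ}

theorem IsFunctionalDeriv.functionalDeriv_eq (injective : Function.Injective p) {F : M → ℝ} {m : M}
    {A : L} (h : IsFunctionalDeriv (fun A => ⇑(p A)) F m A) :
    BosonicRDM.functionalDeriv (fun A => ⇑(p A)) F m = A :=
  injective (ContinuousLinearMap.ext fun v => tendsto_nhds_unique (h.functionalDeriv v) (h v))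

theorem exists_isFunctionalDeriv {br : L → L → L} {F : M → ℝ}
    (hF : F ∈ (liePoisson (fun A => ⇑(p A)) br).functionals) (m : M) :
    ∃ A, IsFunctionalDeriv (fun A => ⇑(p A)) F m A := by
  have exists_const : ∀ c : ℝ, ∃ A, IsFunctionalDeriv (fun A => ⇑(p A)) (fun _ => c) m A :=
    fun c => ⟨0, fun v => by simpa using hasGateauxDerivAt_const c m v⟩
  induction hF using Algebra.adjoin_induction with
  | mem F hF =>
    rcases hF with ⟨-, A, hA⟩ | ⟨c, hc⟩
    · obtain rfl : F = ⇑(p A) := funext hA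
      exact ⟨A, hasGateauxDerivAt_linear (p A : M →ₗ[ℝ] ℝ) m⟩
    · obtain rfl : F = fun _ => c := funext hc
      exact exists_const c
  | algebraMap r => exact exists_const r
  | add F G _ _ hF hG =>
    obtain ⟨A, hA⟩ := hF
    obtain ⟨B, hB⟩ := hG
    exact ⟨A + B, fun v => by simpa using (hA v).add (hB v)⟩
  | mul F G _ _ hF hG =>
    obtain ⟨A, hA⟩ := hF
    obtain ⟨B, hB⟩ := hG
    exact ⟨G m • A + F m • B, fun v => by simpa using (hA v).mul (hB v)⟩

variable {L₁ M₁ : Type*} [AddCommGroup M₁] [Module ℝ M₁] [TopologicalSpace M₁]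
  [AddCommMonoid L₁] [Module ℝ L₁] {p₁ : L₁ →ₗ[ℝ] M₁ →L[ℝ] ℝ}
  {br₁ : L₁ → L₁ → L₁} {br : L → L → L} {ε : L → L₁} {ι : M₁ →L[ℝ] M}

theorem comp_mem_liePoisson_functionals (dual : ∀ A m, p₁ (ε A) m = p A (ι m)) {F : M → ℝ}
    (hF : F ∈ (liePoisson (fun A => ⇑(p A)) br).functionals) :
    F ∘ ι ∈ (liePoisson (fun A => ⇑(p₁ A)) br₁).functionals := by
  induction hF using Algebra.adjoin_induction with
  | mem F hF =>
    refine Algebra.subset_adjoin ?_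
    rcases hF with ⟨-, A, hA⟩ | ⟨c, hc⟩
    · have comp_eq : F ∘ ι = ⇑(p₁ (ε A)) := funext fun m => (hA _).trans (dual A m).symm
      exact Or.inl ⟨comp_eq ▸ gateauxSmooth_clm _, ε A, congrFun comp_eq⟩
    · exact Or.inr ⟨c, fun m => hc _⟩
  | algebraMap r => exact Subalgebra.algebraMap_mem _ r
  | add F G _ _ hF hG => exact add_mem hF hG
  | mul F G _ _ hF hG => exact mul_mem hF hG

theorem functionalDeriv_comp (injective : Function.Injective p₁)
    (dual : ∀ A m, p₁ (ε A) m = p A (ι m)) {F : M → ℝ}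
    (hF : F ∈ (liePoisson (fun A => ⇑(p A)) br).functionals) (m : M₁) :
    functionalDeriv (fun A => ⇑(p₁ A)) (F ∘ ι) m
      = ε (functionalDeriv (fun A => ⇑(p A)) F (ι m)) := by
  obtain ⟨A, hA⟩ := exists_isFunctionalDeriv hF (ι m)
  refine IsFunctionalDeriv.functionalDeriv_eq injective fun v => ?_
  change HasGateauxDerivAt _ _ _ (p₁ (ε _) v)
  rw [dual]
  refine (hA.functionalDeriv (ι v)).congr fun t => ?_
  simp only [Function.comp_apply, map_add, map_smul]

/-- The derivative of `F ∘ ι` is the image under `ε` of the derivative of `F`, so that `ι` preserves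
Poisson brackets because `ε` preserves Lie brackets. -/
theorem isPoissonMap_of_dual {q₁ : L₁ → M₁ → ℝ} {q : L → M → ℝ} (p₁_apply : ∀ A m, p₁ A m = q₁ A m)
    (p_apply : ∀ A m, p A m = q A m) (injective : Function.Injective p₁)
    (dual : ∀ A m, q₁ (ε A) m = q A (ι m)) (map_bracket : ∀ A B, ε (br A B) = br₁ (ε A) (ε B)) :
    IsPoissonMap (liePoisson q₁ br₁) (liePoisson q br) ι := by
  obtain rfl : (fun A => ⇑(p₁ A)) = q₁ := funext₂ p₁_apply
  obtain rfl : (fun A => ⇑(p A)) = q := funext₂ p_apply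
  refine ⟨gateauxSmooth_clm ι, fun F hF => comp_mem_liePoisson_functionals dual hF,
    fun F hF G hG => funext fun m => ?_⟩
  change p (br _ _) (ι m) = p₁ (br₁ _ _) m
  rw [functionalDeriv_comp injective dual hF, functionalDeriv_comp injective dual hG,
    ← map_bracket]
  exact (dual _ m).symm

end LiePoisson

/-! ### The sum of the embeddings preserves brackets -/

theorem biadditive_sum_sum {ι κ G H K : Type*} [Fintype ι] [Fintype κ] [AddCommGroup G]
    [AddCommGroup H] [AddCommGroup K] {b : G → H → K}
    (add_left : ∀ x x' y, b (x + x') y = b x y + b x' y)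
    (add_right : ∀ x y y', b x (y + y') = b x y + b x y') (f : ι → G) (g : κ → H) :
    b (∑ i, f i) (∑ j, g j) = ∑ p : ι × κ, b (f p.1) (g p.2) := by
  let B : G →+ H →+ K := AddMonoidHom.mk' (fun x => AddMonoidHom.mk' (b x) (add_right x))
    fun x x' => AddMonoidHom.ext (add_left x x')
  change B (∑ i, f i) (∑ j, g j) = ∑ p : ι × κ, B (f p.1) (g p.2)
  rw [map_sum B, AddMonoidHom.finsetSum_apply, Fintype.sum_prod_type]
  simp only [map_sum]

theorem additive_sum {ι G H : Type*} [AddCommGroup G] [AddCommGroup H] {e : G → H}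
    (h : ∀ x y, e (x + y) = e x + e y) (s : Finset ι) (f : ι → G) :
    e (∑ i ∈ s, f i) = ∑ i ∈ s, e (f i) :=
  map_sum (AddMonoidHom.mk' e h) f s

section Bracket

variable {d k N : ℕ}

-- Instance search for these two is too slow without the shortcuts.
local instance instAddCommGroupObs (d k : ℕ) : AddCommGroup (Obs d k) := Submodule.addCommGroup _

local instance instAddCommMonoidObs (d k : ℕ) : AddCommMonoid (Obs d k) :=
  (instAddCommGroupObs d k).toAddCommMonoid

theorem embed_add (A B : Obs d k) : embed N (A + B) = embed N A + embed N B := by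
  have average_add :
      average N (fullOp (A + B).1) = average N (fullOp A.1) + average N (fullOp B.1) :=
    map_add (average N) (fullOp A.1) (fullOp B.1)
  refine Subtype.ext (ContinuousLinearMap.ext fun f => Subtype.ext ?_)
  change ((embed N (A + B)).1 f).1 = ((embed N A).1 f).1 + ((embed N B).1 f).1
  rw [coe_embed_apply, coe_embed_apply, coe_embed_apply, average_add]
  rfl

theorem obsBracket_add_left (A A' B : Obs d k) :
    obsBracket (A + A') B = obsBracket A B + obsBracket A' B := by
  refine Subtype.ext ?_
  change (k : ℝ) • ((A.1 + A'.1) ∘L B.1 - B.1 ∘L (A.1 + A'.1))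
    = (k : ℝ) • (A.1 ∘L B.1 - B.1 ∘L A.1) + (k : ℝ) • (A'.1 ∘L B.1 - B.1 ∘L A'.1)
  rw [ContinuousLinearMap.add_comp, ContinuousLinearMap.comp_add, add_sub_add_comm]
  exact smul_add _ _ _

theorem obsBracket_add_right (A B B' : Obs d k) :
    obsBracket A (B + B') = obsBracket A B + obsBracket A B' := by
  refine Subtype.ext ?_
  change (k : ℝ) • (A.1 ∘L (B.1 + B'.1) - (B.1 + B'.1) ∘L A.1)
    = (k : ℝ) • (A.1 ∘L B.1 - B.1 ∘L A.1) + (k : ℝ) • (A.1 ∘L B'.1 - B'.1 ∘L A.1)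
  rw [ContinuousLinearMap.add_comp, ContinuousLinearMap.comp_add, add_sub_add_comm]
  exact smul_add _ _ _

theorem obsBracket_sumEmbed (A B : ObsHier d N) : obsBracket (sumEmbed A) (sumEmbed B)
    = ∑ p : Fin N × Fin N, obsBracket (embed N (A p.1)) (embed N (B p.2)) :=
  biadditive_sum_sum obsBracket_add_left obsBracket_add_right _ _

theorem embed_hierBracket (A B : ObsHier d N) (k : Fin N) : embed N (hierBracket A B k)
    = ∑ p : Fin N × Fin N with min ((p.1.val + 1) + (p.2.val + 1) - 1) N = k.val + 1,
        obsBracket (embed N (A p.1)) (embed N (B p.2)) := by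
  rw [hierBracket, additive_sum embed_add]
  refine Finset.sum_congr rfl fun p hp => ?_
  exact Function.invFun_eq
    (exists_embed_eq_obsBracket (Finset.mem_filter.1 hp).2.symm (A p.1) (B p.2))

theorem sumEmbed_hierBracket (A B : ObsHier d N) :
    sumEmbed (hierBracket A B) = obsBracket (sumEmbed A) (sumEmbed B) := by
  let level : Fin N × Fin N → Fin N := fun p =>
    ⟨min ((p.1.val + 1) + (p.2.val + 1) - 1) N - 1, by have := p.1.isLt; omega⟩
  have level_eq_iff : ∀ p k,
      min ((p.1.val + 1) + (p.2.val + 1) - 1) N = k.val + 1 ↔ level p = k := fun p k => by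
    have := p.1.isLt
    simp only [level, Fin.ext_iff]
    omega
  rw [obsBracket_sumEmbed, sumEmbed, ← Finset.sum_fiberwise Finset.univ level]
  refine Finset.sum_congr rfl fun k _ => ?_
  rw [embed_hierBracket]
  exact Finset.sum_congr (Finset.filter_congr fun p _ => level_eq_iff p k) fun _ _ => rfl

end Bracket

theorem isPoissonMap_rdmMap (d N : ℕ) :
    IsPoissonMap (dmPoisson d N) (hierPoisson d N) ⇑(rdmMap d N) :=
  isPoissonMap_of_dual obsPairingBilin_apply hierPairingBilin_apply
    (obsPairingBilin_injective d N) obsPairing_sumEmbed sumEmbed_hierBracket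

end

end BosonicRDM

theorem proposition4p7 (d N : ℕ) (hd : 1 ≤ d) (hN : 1 ≤ N) :
    (∃! ι : DM d N → DMHier d N, IsRDMMap ι) ∧
    ∀ ι : DM d N → DMHier d N, IsRDMMap ι →
      IsPoissonMap (dmPoisson d N) (hierPoisson d N) ι ∧
      ∀ (A : ObsHier d N) (Ψ : DM d N),
        obsPairing (sumEmbed A) Ψ = hierPairing A (ι Ψ) := by
  refine ⟨⟨_, isRDMMap_rdmMap d N, fun ι h => h.eq_rdmMap⟩, fun ι h => ?_⟩
  obtain rfl := h.eq_rdmMap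
  exact ⟨isPoissonMap_rdmMap d N, obsPairing_sumEmbed⟩
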